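/- **Setting.** Let $m,d,T\ge 1$ and let $W=\{w_0,\dots,w_{|W|-1}\}\subset\mathbb R^d$ be a finite ordered set of actions that spans $\mathbb R^d$ and lies in the Euclidean unit ball. There are $n\ge |W|$ individuals per round. In rounds $t=0,1,\dots,T$ and for $i=1,\dots,n$, features $x_i^t\in\mathbb R^m$ are drawn i.i.d. from a probability distribution $D_x$. If action $w$ is taken on individual $i$ in round $t$, the label is $c_i^t=F_wx_i^t+\epsilon_i^t$ with $\epsilon_i^t\sim\mathcal N(0,\sigma^2I_d)$, and the cost is $u=(c_i^t)^\top w+\mu^\top w+\eta_i^t$ with $\eta_i^t\sim\mathcal N(0,\sigma^2)$. All features and noises are independent, the matrices $F_w\in\mathbb R^{d\times m}$ and the vector $\mu$ are unknown, and the bandit part $\mu^\top w+\eta_i^t$ of the cost is observed. There are constants $K_X,K_F,K_C,K_\mu,K_\sigma$ such that $D_x$-almost surely $\|x\|_2\le K_X$ and $\|F_wx\|_1\le K_C$ for all $w\in W$, all entries of the $F_w$ are bounded by $K_F$ in absolute value, $|\mu^\top w|\le K_\mu$ for all $w\in W$, and $\sigma\le K_\sigma$. **Procedure.** Let $\delta\in(0,1)$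 and $\tilde T=\lceil T^{2/3}|W|^{1/3}(md)^{2/3}\rceil$. Let $b_1,\dots,b_d\in W$ be a barycentric spanner of $W$: every $w\in W$ is a combination of the $b_k$ with coefficients in $[-1,1]$. Put $A_i^t=\sum_k b_kb_k^\top+\sum_{1\le\tau<t}w_i^\tau (w_i^\tau)^\top$ and $\hat\mu_i^t=(A_i^t)^{-1}\sum_{1\le\tau<t}(\mu^\top w_i^\tau+\eta_i^\tau)w_i^\tau$. In round $0$ (the initial data set) arbitrary fixed actions are taken. In rounds $1\le t\le\tilde T$ the procedure takes $w_i^t=w_{(nt+i)\bmod |W|}$. In rounds $t>\tilde T$, for each $w$ a learning algorithm is given the data collected under $w$ in the rounds $0,\dots,s_t$, where $\tilde T\le s_t<t$ ($s_t=t-1$ means retraining on all data, $s_t=\tilde T$ training once after exploration); it returns a matrix $\hat F_w^t$ with entries bounded by $K_F$. Then $w_i^t$ is a minimizer over $w\in W$ of $\min_{\nu}(\hat F_w^tx_i^t+\nu)^\top w$, where $\nu$ ranges over the ball $(\nu-\hat\mu_i^t)^\top A_i^t(\nu-\hat\mu_i^t)\le\beta^t$ with $\beta^t=\max\bigl(128\,d\log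 t\,\log(nt^2/\delta),\,(\tfrac83\log(nt^2/\delta))^2\bigr)$; ties are broken by a fixed measurable rule. **Assumption (constant empirical risk).** There is a constant $K_E$ such that one of the following holds. (a) The predictors are trained once after exploration ($s_t=\tilde T$), and for every $w\in W$ and every number $k$ of i.i.d. training points $(x_r,F_wx_r+\epsilon_r)$ the learned $\hat F$ satisfies $\mathbb E\sum_{r=1}^k\|F_wx_r-\hat Fx_r\|_2^2\le K_E(md)^2$, a bound that does not depend on $k$. (b) For every $w\in W$ and every $\tilde T<t\le T$, the same bound holds along the run of the procedure, for $\hat F_w^t$ and the sum over the data on which it was trained. **Regret.** Let $R_T=\sum_{t=1}^T\sum_{i=1}^n\bigl(\mathbb E[u\mid x_i^t,w_i^t]-\min_{w\in W}\mathbb E[u\mid x_i^t,w]\bigr)$, where $\mathbb E[u\mid x,w]$ is the expected cost, over the label and the bandit noise, of action $w$ at feature $x$. **Theorem.** There are an absolute constant $\kappa$ and a constant $C$ depending only on $K_X,K_F,K_C,K_\mu,K_E,K_\sigma$ such that, with $$\mathcal B=C\Bigl(1+\log\frac{md\,n\,|W|\,T}{\delta}\Bigr)^{\kappa}\,|W|^{1/3}(md)^{2/3}\,n\,T^{2/3},$$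 the regret $R_T$ is integrable, there is an event $G$ of probability at least $1-\delta$ with $\mathbb E[R_T\mid G]\le\mathcal B$, and $R_T\le\mathcal B/\sqrt\delta$ with probability at least $1-\delta$. Thus the regret is $\tilde O(|W|^{1/3}(md)^{2/3}nT^{2/3})$ with probability $1-\delta$. -/

import Mathlib

open MeasureTheory ProbabilityTheory
open scoped NNReal ENNReal Matrix

noncomputable section

namespace BanditDDO

/-- A data point: a feature vector in `ℝ^m` and a label vector in `ℝ^d`. -/
abbrev Point (m d : ℕ) := (Fin m → ℝ) × (Fin d → ℝ)

/-- A learning algorithm for the linear class: it maps a finite data set to a matrix, that is, to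
the linear predictor `x ↦ F x`. -/
abbrev Learner (m d : ℕ) := List (Point m d) → Matrix (Fin d) (Fin m) ℝ

/-- The randomness of one run: for round `t` and individual `i`, the feature vector, the label
noise and the bandit noise. -/
abbrev Randomness (m d n : ℕ) := ℕ → Fin n → Point m d × ℝ

/-- The interventions (as indices into the ordered action set), by round and individual. -/
abbrev Trajectory (n N : ℕ) := ℕ → Fin n → Fin N

/-- The unknown environment, with `N` actions in `ℝ^d` and `n` individuals per round. -/
structure Model (m d n N : ℕ) where
  /-- the ordered action set -/
  W : Fin N → Fin d → ℝ
  /-- the default interventions of the initial data set -/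
  w₀ : Fin n → Fin N
  /-- the mean label of feature `x` under action `j` is `F j *ᵥ x` -/
  F : Fin N → Matrix (Fin d) (Fin m) ℝ
  /-- the unknown bandit cost vector -/
  μ : Fin d → ℝ
  /-- the standard deviation of the label noise and of the bandit noise -/
  σ : ℝ≥0
  /-- the distribution of the features -/
  Dx : Measure (Fin m → ℝ)

/-- The choices left open in the procedure. -/
structure Procedure (m d N : ℕ) where
  /-- the barycentric spanner of the action set -/
  b : Fin d → Fin d → ℝ
  /-- the learning algorithm -/
  L : Learner m d
  /-- the rule that returns a minimizer of a real function on the actions -/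
  sel : (Fin N → ℝ) → Fin N
  /-- the predictors used in round `t` are trained on the data of rounds `0, …, last t` -/
  last : ℕ → ℕ
  /-- the length of the exploration phase -/
  explore : ℕ
  /-- the confidence parameter -/
  γ : ℝ

/-- The law `N(0, σ² I)` of the label noise. -/
def labelNoise (d : ℕ) (σ : ℝ≥0) : Measure (Fin d → ℝ) :=
  Measure.pi fun _ => gaussianReal 0 (σ ^ 2)

/-- `b` is a barycentric spanner of the set `S`, which spans `ℝ^d`. -/
def IsBarycentricSpanner {d : ℕ} (b : Fin d → Fin d → ℝ) (S : Set (Fin d → ℝ)) : Prop :=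
  (∀ k, b k ∈ S) ∧ ∀ w ∈ S, ∃ a : Fin d → ℝ, (∀ k, |a k| ≤ 1) ∧ w = ∑ k, a k • b k

/-- The class of linear predictors with entries bounded by `K`. -/
def BoundedEntries {m d : ℕ} (K : ℝ) (F : Matrix (Fin d) (Fin m) ℝ) : Prop :=
  ∀ k l, |F k l| ≤ K

/-- The sum over a data set of the squared Euclidean distances `‖F x - G x‖²`. -/
def inSampleError {m d : ℕ} (F G : Matrix (Fin d) (Fin m) ℝ) (D : List (Point m d)) : ℝ :=
  (D.map fun p => ∑ k, ((F *ᵥ p.1) k - (G *ᵥ p.1) k) ^ 2).sum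

/-- On any number `k` of i.i.d. training points `(x, F x + ε)`, the expected in-sample error of the
learned predictor is at most `B`, which does not depend on `k`. -/
def ConstantER {m d : ℕ} (L : Learner m d) (Dx : Measure (Fin m → ℝ)) (σ : ℝ≥0)
    (F : Matrix (Fin d) (Fin m) ℝ) (B : ℝ) : Prop :=
  ∀ k : ℕ, ∫⁻ s : Fin k → Point m d,
      ENNReal.ofReal (inSampleError F
        (L (List.ofFn fun r => ((s r).1, F *ᵥ (s r).1 + (s r).2)))
        (List.ofFn fun r => ((s r).1, F *ᵥ (s r).1 + (s r).2)))
      ∂(Measure.pi fun _ => Dx.prod (labelNoise d σ)) ≤ ENNReal.ofReal B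

section Environment

variable {m d n N : ℕ} (M : Model m d n N)

/-- The law of the label of feature `x` under action `j`. -/
def labelLaw (j : Fin N) (x : Fin m → ℝ) : Measure (Fin d → ℝ) :=
  (labelNoise d M.σ).map fun e => M.F j *ᵥ x + e

/-- The cost of action `j` for one individual, with label `c` and bandit noise `e`. -/
def cost (c : Fin d → ℝ) (j : Fin N) (e : ℝ) : ℝ :=
  c ⬝ᵥ M.W j + (M.μ ⬝ᵥ M.W j + e)

/-- The expected cost of action `j` given the feature `x`, over the label and the bandit noise. -/
def expectedCost (j : Fin N) (x : Fin m → ℝ) : ℝ :=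
  ∫ c, ∫ e, cost M c j e ∂(gaussianReal 0 (M.σ ^ 2)) ∂(labelLaw M j x)

/-- The expected cost of the optimal policy at the feature `x`. -/
def optimalCost (x : Fin m → ℝ) : ℝ := ⨅ j, expectedCost M j x

/-- The law of the randomness of one individual in one round. -/
def sampleLaw : Measure (Point m d × ℝ) :=
  (M.Dx.prod (labelNoise d M.σ)).prod (gaussianReal 0 (M.σ ^ 2))

end Environment

section Run

variable {m d n N : ℕ} (M : Model m d n N) (Q : Procedure m d N) (ξ : Randomness m d n)

/-- The feature of individual `i` in round `t`. -/
def feature (t : ℕ) (i : Fin n) : Fin m → ℝ := (ξ t i).1.1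

/-- The observed label of individual `i` in round `t`. -/
def label (a : Trajectory n N) (t : ℕ) (i : Fin n) : Fin d → ℝ :=
  M.F (a t i) *ᵥ feature ξ t i + (ξ t i).1.2

/-- The observed bandit part of the cost. -/
def banditCost (a : Trajectory n N) (t : ℕ) (i : Fin n) : ℝ :=
  M.μ ⬝ᵥ M.W (a t i) + (ξ t i).2

/-- The data of the rounds `0, …, s` that were collected under action `j`, in chronological
order; round `0` is the initial data set. -/
def dataUnder (a : Trajectory n N) (s : ℕ) (j : Fin N) : List (Point m d) :=
  (List.range (s + 1)).flatMap fun τ =>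
    ((List.finRange n).filter fun i => a τ i = j).map fun i => (feature ξ τ i, label M ξ a τ i)

/-- The predictor for action `j` in round `t`. -/
def predictor (a : Trajectory n N) (t : ℕ) (j : Fin N) : Matrix (Fin d) (Fin m) ℝ :=
  Q.L (dataUnder M ξ a (Q.last t) j)

/-- The matrix `A` of individual `i` at the start of round `t`. -/
def gram (a : Trajectory n N) (t : ℕ) (i : Fin n) : Matrix (Fin d) (Fin d) ℝ :=
  ∑ k, Matrix.vecMulVec (Q.b k) (Q.b k) +
    ∑ τ ∈ Finset.Ico 1 t, Matrix.vecMulVec (M.W (a τ i)) (M.W (a τ i))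

/-- The estimate of `μ` of individual `i` at the start of round `t`. -/
def muHat (a : Trajectory n N) (t : ℕ) (i : Fin n) : Fin d → ℝ :=
  (gram M Q a t i)⁻¹ *ᵥ ∑ τ ∈ Finset.Ico 1 t, banditCost M ξ a τ i • M.W (a τ i)

/-- The squared radius `β^t` of the confidence ball. -/
def radius (d n : ℕ) (γ : ℝ) (t : ℕ) : ℝ :=
  max (128 * d * Real.log t * Real.log (n * (t : ℝ) ^ 2 / γ))
    ((8 / 3 * Real.log (n * (t : ℝ) ^ 2 / γ)) ^ 2)

/-- The confidence ball of individual `i` in round `t`. -/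
def confidenceBall (a : Trajectory n N) (t : ℕ) (i : Fin n) : Set (Fin d → ℝ) :=
  {ν | Real.sqrt ((ν - muHat M Q ξ a t i) ⬝ᵥ
      (gram M Q a t i *ᵥ (ν - muHat M Q ξ a t i))) ≤ Real.sqrt (radius d n Q.γ t)}

/-- The optimistic value of action `j` for individual `i` in round `t`: the minimum of
`(ĉ(w_j) + ν)ᵀ w_j` over the confidence ball. -/
def optimisticValue (a : Trajectory n N) (t : ℕ) (i : Fin n) (j : Fin N) : ℝ :=
  sInf ((fun ν => (predictor M Q ξ a t j *ᵥ feature ξ t i + ν) ⬝ᵥ M.W j) ''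
    confidenceBall M Q ξ a t i)

/-- The intervention of individual `i` in round `t`. It uses `a` in the rounds before `t` only
(when `Q.last t < t` after the exploration phase). -/
def nextAction (a : Trajectory n N) (t : ℕ) (i : Fin n) : Fin N :=
  if t = 0 then M.w₀ i
  else if t ≤ Q.explore then ⟨(n * t + (i + 1)) % N, Nat.mod_lt _ (M.w₀ i).pos⟩
  else Q.sel (optimisticValue M Q ξ a t i)

/-- The interventions of the rounds `0, …, t` (later entries are placeholders). -/
def runUpTo : ℕ → Trajectory n N
  | 0 => fun _ i => M.w₀ i
  | t + 1 => Function.update (runUpTo t) (t + 1) fun i => nextAction M Q ξ (runUpTo t) (t + 1) i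

/-- The interventions chosen by the procedure. -/
def run : Trajectory n N := fun t => runUpTo M Q ξ t t

/-- The regret over `T` rounds: the expected costs of the chosen interventions, given the features,
minus those of the optimal policy. -/
def regret (T : ℕ) : ℝ :=
  ∑ t ∈ Finset.Icc 1 T, ∑ i, (expectedCost M (run M Q ξ t i) (feature ξ t i) -
    optimalCost M (feature ξ t i))

end Run

/-- In every round after the exploration phase and for every action, the expected in-sample error
of the predictor in use, on the data it was trained on, is at most `B`. -/
def ConstantERAlongRun {m d n N : ℕ} (M : Model m d n N) (Q : Procedure m d N) {Ω : Type*}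
    [MeasurableSpace Ω] (P : Measure Ω) (ξ : ℕ → Fin n → Ω → Point m d × ℝ) (T : ℕ) (B : ℝ) :
    Prop :=
  ∀ t, Q.explore < t → t ≤ T → ∀ j : Fin N,
    ∫⁻ ω, ENNReal.ofReal (inSampleError (M.F j)
      (predictor M Q (fun τ i => ξ τ i ω) (run M Q (fun τ i => ξ τ i ω)) t j)
      (dataUnder M (fun τ i => ξ τ i ω) (run M Q (fun τ i => ξ τ i ω)) (Q.last t) j)) ∂P
      ≤ ENNReal.ofReal B

/-- The length `T^{2/3} |W|^{1/3} (md)^{2/3}` of the exploration phase, rounded up. -/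
def exploreLength (m d N T : ℕ) : ℕ :=
  ⌈(T : ℝ) ^ (2 / 3 : ℝ) * (N : ℝ) ^ (1 / 3 : ℝ) * ((m : ℝ) * d) ^ (2 / 3 : ℝ)⌉₊

/-- The rate `|W|^{1/3} (md)^{2/3} n T^{2/3}`. -/
def rate (m d n N T : ℕ) : ℝ :=
  (N : ℝ) ^ (1 / 3 : ℝ) * ((m : ℝ) * d) ^ (2 / 3 : ℝ) * n * (T : ℝ) ^ (2 / 3 : ℝ)

/-- The logarithmic factor hidden in the soft-O notation. -/
def logFactor (m d n N T : ℕ) (δ : ℝ) : ℝ :=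
  1 + Real.log ((m : ℝ) * d * n * N * T / δ)

end BanditDDO

end

/- Off an event of probability at most `δ / 4`, two things hold. First, a self-normalized bound
(method of mixtures: the Gaussian mixture of the exponential martingales of the bandit noise is a
nonnegative supermartingale started at one) puts `μ` in all the confidence balls, so that optimism
bounds the bandit regret of a round by the width of its ball, and the elliptical potential lemma
sums the widths to `Õ(d √T)`. Second, the features met with each action during the exploration
phase dominate the second moments of `D_x` up to a slack `Õ(m²)`, uniformly over a net of
directions, so that the constant empirical risk of a predictor controls its error at a fresh
feature: the mean squared error is `Õ((md)² |W| / (n T̃))`.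

By Cauchy-Schwarz the prediction regret of all rounds is then at most `2 √Z` with `𝔼[Z; G]` of
order `(n T)² (md)² |W| / (n T̃)`, while the exploration costs `n T̃`; the choice of `T̃` balances
the two. The conditional expectation bounds `√Z` by `D + Z / D`, and Markov's inequality for `Z`
gives the factor `1 / √δ` in the tail bound. -/

noncomputable section

namespace BanditDDO

section PosDef

variable {ι : Type*} {A : Matrix ι ι ℝ}

lemma posSemidef_vecMulVec_self [Finite ι] (w : ι → ℝ) : (Matrix.vecMulVec w w).PosSemidef := by
  simpa using Matrix.posSemidef_vecMulVec_self_star (R := ℝ) w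

lemma posDef_add_vecMulVec_self [Finite ι] (hA : A.PosDef) (w : ι → ℝ) :
    (A + Matrix.vecMulVec w w).PosDef :=
  hA.add_posSemidef (posSemidef_vecMulVec_self w)

variable [Fintype ι]

lemma vecMulVec_self_mulVec (w z : ι → ℝ) : Matrix.vecMulVec w w *ᵥ z = (w ⬝ᵥ z) • w := by
  rw [Matrix.vecMulVec_mulVec, op_smul_eq_smul]

lemma dotProduct_vecMulVec_self_mulVec (w z : ι → ℝ) :
    z ⬝ᵥ (Matrix.vecMulVec w w *ᵥ z) = (z ⬝ᵥ w) ^ 2 := by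
  rw [vecMulVec_self_mulVec, dotProduct_smul, smul_eq_mul, dotProduct_comm w z, sq]

lemma dotProduct_mulVec_self_nonneg (hA : A.PosSemidef) (z : ι → ℝ) : 0 ≤ z ⬝ᵥ (A *ᵥ z) := by
  simpa using hA.dotProduct_mulVec_nonneg z

lemma dotProduct_mulVec_comm (hA : A.IsHermitian) (y z : ι → ℝ) :
    y ⬝ᵥ (A *ᵥ z) = z ⬝ᵥ (A *ᵥ y) := by
  have hAt : Aᵀ = A := by simpa [Matrix.IsHermitian] using hA
  rw [Matrix.dotProduct_mulVec, ← Matrix.mulVec_transpose, hAt, dotProduct_comm]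

lemma det_le_pow_of_trace_le [DecidableEq ι] (hA : A.PosSemidef) {c : ℝ}
    (hc : A.trace ≤ Fintype.card ι * c) : A.det ≤ c ^ Fintype.card ι := by
  cases isEmpty_or_nonempty ι
  · simp
  set ev := hA.isHermitian.eigenvalues
  have hcard : (0 : ℝ) < Fintype.card ι := by exact_mod_cast Fintype.card_pos
  have hdet : A.det = ∏ i, ev i := by simpa using hA.isHermitian.det_eq_prod_eigenvalues
  have htrace : A.trace = ∑ i, ev i := by simpa using hA.isHermitian.trace_eq_sum_eigenvalues
  have hprod : 0 ≤ ∏ i, ev i := Finset.prod_nonneg fun i _ => hA.eigenvalues_nonneg i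
  have hmean : (∏ i, ev i) ^ (Fintype.card ι : ℝ)⁻¹ ≤ c := by
    have amgm := Real.geom_mean_le_arith_mean Finset.univ (fun _ : ι => (1 : ℝ)) ev
      (fun _ _ => zero_le_one) (by simp [Fintype.card_pos]) fun i _ => hA.eigenvalues_nonneg i
    simp only [Real.rpow_one, Finset.sum_const, Finset.card_univ, nsmul_eq_mul, mul_one,
      one_mul] at amgm
    refine amgm.trans ?_
    rwa [div_le_iff₀' hcard, ← htrace]
  calc A.det = ((∏ i, ev i) ^ (Fintype.card ι : ℝ)⁻¹) ^ Fintype.card ι := by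
        rw [hdet, Real.rpow_inv_natCast_pow hprod Fintype.card_ne_zero]
    _ ≤ c ^ Fintype.card ι := pow_le_pow_left₀ (Real.rpow_nonneg hprod _) hmean _

variable [DecidableEq ι]

lemma mulVec_inv_mulVec (hA : A.PosDef) (z : ι → ℝ) : A *ᵥ (A⁻¹ *ᵥ z) = z := by
  rw [Matrix.mulVec_mulVec, Matrix.mul_nonsing_inv _ hA.det_pos.ne'.isUnit, Matrix.one_mulVec]

lemma inv_mulVec_mulVec (hA : A.PosDef) (z : ι → ℝ) : A⁻¹ *ᵥ (A *ᵥ z) = z := by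
  rw [Matrix.mulVec_mulVec, Matrix.nonsing_inv_mul _ hA.det_pos.ne'.isUnit, Matrix.one_mulVec]

lemma dotProduct_inv_mulVec_self_nonneg (hA : A.PosDef) (z : ι → ℝ) : 0 ≤ z ⬝ᵥ (A⁻¹ *ᵥ z) :=
  dotProduct_mulVec_self_nonneg hA.inv.posSemidef z

lemma sq_dotProduct_le_mul_inv (hA : A.PosDef) (y z : ι → ℝ) :
    (z ⬝ᵥ y) ^ 2 ≤ (z ⬝ᵥ (A *ᵥ z)) * (y ⬝ᵥ (A⁻¹ *ᵥ y)) := by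
  have cauchySchwarz := LinearMap.BilinForm.apply_sq_le_of_symm (Matrix.toLinearMap₂' ℝ A)
    (fun x => by simpa [Matrix.toLinearMap₂'_apply'] using
      dotProduct_mulVec_self_nonneg hA.posSemidef x)
    ⟨fun x y => by simpa [Matrix.toLinearMap₂'_apply'] using
      dotProduct_mulVec_comm hA.isHermitian x y⟩ z (A⁻¹ *ᵥ y)
  simpa only [Matrix.toLinearMap₂'_apply', mulVec_inv_mulVec hA, dotProduct_comm _ y]
    using cauchySchwarz

lemma abs_dotProduct_le_sqrt_mul_sqrt_inv (hA : A.PosDef) (y z : ι → ℝ) :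
    |z ⬝ᵥ y| ≤ √(z ⬝ᵥ (A *ᵥ z)) * √(y ⬝ᵥ (A⁻¹ *ᵥ y)) := by
  rw [← Real.sqrt_mul (dotProduct_mulVec_self_nonneg hA.posSemidef z), ← Real.sqrt_sq_eq_abs]
  exact Real.sqrt_le_sqrt (sq_dotProduct_le_mul_inv hA y z)

lemma dotProduct_inv_mulVec_self_mulVec (hA : A.PosDef) (z : ι → ℝ) :
    (A *ᵥ z) ⬝ᵥ (A⁻¹ *ᵥ (A *ᵥ z)) = z ⬝ᵥ (A *ᵥ z) := by
  rw [inv_mulVec_mulVec hA, dotProduct_comm]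

lemma dotProduct_inv_mulVec_sub_self_le (hA : A.PosDef) (y z : ι → ℝ) :
    (y - z) ⬝ᵥ (A⁻¹ *ᵥ (y - z)) ≤ 2 * (y ⬝ᵥ (A⁻¹ *ᵥ y)) + 2 * (z ⬝ᵥ (A⁻¹ *ᵥ z)) := by
  have hsum := dotProduct_inv_mulVec_self_nonneg hA (y + z)
  simp only [Matrix.mulVec_add, Matrix.mulVec_sub, add_dotProduct, sub_dotProduct, dotProduct_add,
    dotProduct_sub] at hsum ⊢
  linarith

lemma dotProduct_add_inv_mulVec_mulVec_le {B C : Matrix ι ι ℝ} (hB : B.PosDef)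
    (hC : C.PosSemidef) (z : ι → ℝ) :
    (B *ᵥ z) ⬝ᵥ ((B + C)⁻¹ *ᵥ (B *ᵥ z)) ≤ z ⬝ᵥ (B *ᵥ z) := by
  have hA : (B + C).PosDef := hB.add_posSemidef hC
  set y := (B + C)⁻¹ *ᵥ (B *ᵥ z)
  have hp : 0 ≤ y ⬝ᵥ (B *ᵥ z) := by
    rw [dotProduct_comm]
    exact dotProduct_inv_mulVec_self_nonneg hA _
  have hBy : y ⬝ᵥ (B *ᵥ y) ≤ y ⬝ᵥ (B *ᵥ z) := by
    have hAy : (B + C) *ᵥ y = B *ᵥ z := mulVec_inv_mulVec hA _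
    rw [← hAy, Matrix.add_mulVec, dotProduct_add]
    exact le_add_of_nonneg_right (dotProduct_mulVec_self_nonneg hC y)
  have hz := dotProduct_mulVec_self_nonneg hB.posSemidef z
  have cauchySchwarz := sq_dotProduct_le_mul_inv hB (B *ᵥ z) y
  rw [dotProduct_inv_mulVec_self_mulVec hB, sq] at cauchySchwarz
  rw [dotProduct_comm]
  rcases hp.eq_or_lt with h | h
  · rwa [← h]
  · exact le_of_mul_le_mul_left (cauchySchwarz.trans
      ((mul_le_mul_of_nonneg_right hBy hz))) h

lemma exists_mem_ellipsoid_dotProduct_eq (hA : A.PosDef) (w : ι → ℝ) {ρ : ℝ} (hρ : 0 ≤ ρ) :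
    ∃ z, √(z ⬝ᵥ (A *ᵥ z)) ≤ ρ ∧ z ⬝ᵥ w = -(ρ * √(w ⬝ᵥ (A⁻¹ *ᵥ w))) := by
  set q := w ⬝ᵥ (A⁻¹ *ᵥ w) with hq
  have hq0 : 0 ≤ q := dotProduct_inv_mulVec_self_nonneg hA w
  refine ⟨(-(ρ / √q)) • (A⁻¹ *ᵥ w), ?_, ?_⟩
  · refine Real.sqrt_le_iff.2 ⟨hρ, ?_⟩
    rw [Matrix.mulVec_smul, mulVec_inv_mulVec hA, smul_dotProduct, dotProduct_smul,
      dotProduct_comm, ← hq]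
    calc -(ρ / √q) * (-(ρ / √q) * q) = ρ ^ 2 * (q / √q ^ 2) := by ring
      _ ≤ ρ ^ 2 := by
        rw [Real.sq_sqrt hq0]
        exact mul_le_of_le_one_right (sq_nonneg ρ) (div_self_le_one q)
  · rw [smul_dotProduct, dotProduct_comm, ← hq, smul_eq_mul, neg_mul, div_mul_eq_mul_div,
      mul_div_assoc, Real.div_sqrt]

lemma isLeast_dotProduct_ellipsoid (hA : A.PosDef) (c w : ι → ℝ) {ρ : ℝ} (hρ : 0 ≤ ρ) :
    IsLeast ((fun ν => ν ⬝ᵥ w) '' {ν | √((ν - c) ⬝ᵥ (A *ᵥ (ν - c))) ≤ ρ})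
      (c ⬝ᵥ w - ρ * √(w ⬝ᵥ (A⁻¹ *ᵥ w))) := by
  constructor
  · obtain ⟨z, hz, hzw⟩ := exists_mem_ellipsoid_dotProduct_eq hA w hρ
    exact ⟨c + z, by simpa using hz, by simp only [add_dotProduct, hzw]; ring⟩
  · rintro _ ⟨ν, hν, rfl⟩
    have hdev : |(ν - c) ⬝ᵥ w| ≤ ρ * √(w ⬝ᵥ (A⁻¹ *ᵥ w)) :=
      (abs_dotProduct_le_sqrt_mul_sqrt_inv hA w (ν - c)).trans
        (mul_le_mul_of_nonneg_right hν (Real.sqrt_nonneg _))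
    rw [sub_dotProduct] at hdev
    linarith [(abs_le.1 hdev).1]

lemma det_add_vecMulVec_self (hA : A.PosDef) (w : ι → ℝ) :
    (A + Matrix.vecMulVec w w).det = A.det * (1 + w ⬝ᵥ (A⁻¹ *ᵥ w)) := by
  have h := Matrix.det_add_replicateCol_mul_replicateRow (ι := Unit) hA.det_pos.ne'.isUnit w w
  rw [← Matrix.vecMulVec_eq, Matrix.det_unique (n := Unit), Matrix.mul_assoc] at h
  simpa only [Matrix.add_apply, Matrix.one_apply_eq, Matrix.mul_apply, Matrix.replicateRow_apply,
    Matrix.replicateCol_apply, dotProduct, Matrix.mulVec] using h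

lemma inv_add_vecMulVec_self_mulVec (hA : A.PosDef) (w y : ι → ℝ) (e : ℝ) :
    (A + Matrix.vecMulVec w w)⁻¹ *ᵥ (y + e • w) =
      A⁻¹ *ᵥ y + ((e - w ⬝ᵥ (A⁻¹ *ᵥ y)) / (1 + w ⬝ᵥ (A⁻¹ *ᵥ w))) • (A⁻¹ *ᵥ w) := by
  set q := w ⬝ᵥ (A⁻¹ *ᵥ w) with hq
  set r := w ⬝ᵥ (A⁻¹ *ᵥ y) with hr
  have hq0 : 0 ≤ q := dotProduct_inv_mulVec_self_nonneg hA w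
  have hsolution : (A + Matrix.vecMulVec w w) *ᵥ (A⁻¹ *ᵥ y + ((e - r) / (1 + q)) • (A⁻¹ *ᵥ w)) =
      y + e • w := by
    have hcoeff : (e - r) / (1 + q) + (r + (e - r) / (1 + q) * q) = e := by
      field_simp
      ring
    rw [Matrix.add_mulVec, Matrix.mulVec_add, Matrix.mulVec_smul, mulVec_inv_mulVec hA,
      mulVec_inv_mulVec hA, vecMulVec_self_mulVec, dotProduct_add, dotProduct_smul, ← hq, ← hr,
      smul_eq_mul, add_assoc, ← add_smul, hcoeff]
  rw [← hsolution, inv_mulVec_mulVec (posDef_add_vecMulVec_self hA w)]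

lemma dotProduct_inv_add_vecMulVec_self (hA : A.PosDef) (w y : ι → ℝ) (e : ℝ) :
    (y + e • w) ⬝ᵥ ((A + Matrix.vecMulVec w w)⁻¹ *ᵥ (y + e • w)) =
      y ⬝ᵥ (A⁻¹ *ᵥ y) + (2 * e * (w ⬝ᵥ (A⁻¹ *ᵥ y)) + e ^ 2 * (w ⬝ᵥ (A⁻¹ *ᵥ w))
        - (w ⬝ᵥ (A⁻¹ *ᵥ y)) ^ 2) / (1 + w ⬝ᵥ (A⁻¹ *ᵥ w)) := by
  have hq0 : 0 ≤ w ⬝ᵥ (A⁻¹ *ᵥ w) := dotProduct_inv_mulVec_self_nonneg hA w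
  rw [inv_add_vecMulVec_self_mulVec hA, add_dotProduct, dotProduct_add, dotProduct_add,
    smul_dotProduct, smul_dotProduct, dotProduct_smul, dotProduct_smul,
    dotProduct_mulVec_comm hA.inv.isHermitian y w]
  simp only [smul_eq_mul]
  field_simp
  ring

end PosDef

section Spanner

lemma trace_vecMulVec_self_le_card {ι : Type*} [Fintype ι] {a : ι → ℝ} (ha : ∀ k, |a k| ≤ 1) :
    (Matrix.vecMulVec a a).trace ≤ Fintype.card ι := by
  simp only [Matrix.trace, Matrix.diag, Matrix.vecMulVec_apply]
  calc ∑ k, a k * a k ≤ ∑ _k : ι, (1 : ℝ) :=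
        Finset.sum_le_sum fun k _ => by
          rw [← abs_mul_abs_self]
          exact mul_le_one₀ (ha k) (abs_nonneg _) (ha k)
    _ = Fintype.card ι := by simp

variable {d : ℕ}

lemma sum_vecMulVec_self_eq_transpose_mul (b : Fin d → Fin d → ℝ) :
    ∑ k, Matrix.vecMulVec (b k) (b k) = (Matrix.of b)ᵀ * Matrix.of b := by
  ext i j
  simp [Matrix.sum_apply, Matrix.vecMulVec_apply, Matrix.mul_apply]

lemma vecMulVec_sum_smul_self (b : Fin d → Fin d → ℝ) (a : Fin d → ℝ) :
    Matrix.vecMulVec (∑ k, a k • b k) (∑ k, a k • b k) =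
      (Matrix.of b)ᵀ * Matrix.vecMulVec a a * Matrix.of b := by
  have hcomb : ∑ k, a k • b k = (Matrix.of b)ᵀ *ᵥ a := by
    ext i
    simp [Matrix.mulVec, dotProduct, mul_comm]
  rw [hcomb, Matrix.mul_vecMulVec, Matrix.vecMulVec_mul, Matrix.mulVec_transpose]

lemma det_spanner_gram_le {κ : Type*} {b : Fin d → Fin d → ℝ} {S : Set (Fin d → ℝ)}
    (hb : IsBarycentricSpanner b S) (s : Finset κ) {w : κ → Fin d → ℝ} (hw : ∀ τ, w τ ∈ S) :
    (∑ k, Matrix.vecMulVec (b k) (b k) + ∑ τ ∈ s, Matrix.vecMulVec (w τ) (w τ)).det ≤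
      ((s.card : ℝ) + 1) ^ d * (∑ k, Matrix.vecMulVec (b k) (b k)).det := by
  choose a ha hwa using fun τ => hb.2 (w τ) (hw τ)
  set V : Matrix (Fin d) (Fin d) ℝ := Matrix.of b
  set X : Matrix (Fin d) (Fin d) ℝ := 1 + ∑ τ ∈ s, Matrix.vecMulVec (a τ) (a τ) with hX
  have hfactor : ∑ k, Matrix.vecMulVec (b k) (b k) + ∑ τ ∈ s, Matrix.vecMulVec (w τ) (w τ) =
      Vᵀ * X * V := by
    simp only [hwa, vecMulVec_sum_smul_self, sum_vecMulVec_self_eq_transpose_mul]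
    rw [hX, Matrix.mul_add, Matrix.add_mul, Matrix.mul_one, Matrix.mul_sum, Matrix.sum_mul]
  have hXpos : X.PosSemidef :=
    Matrix.PosSemidef.one.add (Matrix.posSemidef_sum _ fun τ _ => posSemidef_vecMulVec_self _)
  have htrace : X.trace ≤ Fintype.card (Fin d) * ((s.card : ℝ) + 1) := by
    have hsum := Finset.sum_le_sum fun τ (_ : τ ∈ s) => trace_vecMulVec_self_le_card (ha τ)
    rw [Finset.sum_const, nsmul_eq_mul] at hsum
    rw [hX, Matrix.trace_add, Matrix.trace_one, Matrix.trace_sum]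
    linarith
  have hdet := det_le_pow_of_trace_le hXpos htrace
  rw [Fintype.card_fin] at hdet
  rw [hfactor, sum_vecMulVec_self_eq_transpose_mul, Matrix.det_mul, Matrix.det_mul, Matrix.det_mul,
    Matrix.det_transpose]
  nlinarith [mul_self_nonneg V.det]

lemma posDef_spanner_gram {S : Set (Fin d → ℝ)} (hS : Submodule.span ℝ S = ⊤)
    {b : Fin d → Fin d → ℝ} (hb : IsBarycentricSpanner b S) :
    (∑ k, Matrix.vecMulVec (b k) (b k)).PosDef := by
  have hspan : ⊤ ≤ Submodule.span ℝ (Set.range b) := by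
    rw [← hS, Submodule.span_le]
    intro w hw
    obtain ⟨a, -, rfl⟩ := hb.2 w hw
    exact Submodule.sum_mem _ fun k _ =>
      Submodule.smul_mem _ _ (Submodule.subset_span ⟨k, rfl⟩)
  have hrows : LinearIndependent ℝ (Matrix.of b).row :=
    linearIndependent_of_top_le_span_of_card_eq_finrank hspan (by simp)
  have hunit : IsUnit (Matrix.of b) := Matrix.linearIndependent_rows_iff_isUnit.1 hrows
  rw [sum_vecMulVec_self_eq_transpose_mul, ← Matrix.conjTranspose_eq_transpose_of_trivial]
  exact Matrix.PosDef.conjTranspose_mul_self _ (Matrix.mulVec_injective_of_isUnit hunit)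

end Spanner

section MethodOfMixtures

lemma lintegral_exp_mul_sub_mul_sq_gaussianReal (a : ℝ) (b s : ℝ≥0) (e : ℝ) :
    ∫⁻ t, ENNReal.ofReal (Real.exp (t * e - s * t ^ 2 / 2)) ∂(gaussianReal a b) =
      ENNReal.ofReal ((√(1 + s * b))⁻¹ *
        Real.exp ((2 * a * e + b * e ^ 2 - s * a ^ 2) / (2 * (1 + s * b)))) := by
  rcases eq_or_ne b 0 with rfl | hb
  · rw [gaussianReal_zero_var, lintegral_dirac]
    congr 1
    simp only [NNReal.coe_zero, mul_zero, add_zero, Real.sqrt_one, inv_one, one_mul, zero_mul,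
      mul_one]
    ring_nf
  set V : ℝ≥0 := b / (1 + s * b) with hV
  have hV0 : V ≠ 0 := div_ne_zero hb (by positivity)
  have hVr : (V : ℝ) = b / (1 + s * b) := by simp [hV]
  have hsqrt : √(2 * Real.pi * b) = √(1 + s * b) * √(2 * Real.pi * V) := by
    rw [← Real.sqrt_mul (by positivity), hVr]
    field_simp
  have hsquare (t : ℝ) : Real.exp (-(t - a) ^ 2 / (2 * b)) * Real.exp (t * e - s * t ^ 2 / 2) =
      Real.exp ((2 * a * e + b * e ^ 2 - s * a ^ 2) / (2 * (1 + s * b))) *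
        Real.exp (-(t - (a + b * e) / (1 + s * b)) ^ 2 / (2 * V)) := by
    have hb' : (b : ℝ) ≠ 0 := by exact_mod_cast hb
    rw [← Real.exp_add, ← Real.exp_add, hVr]
    congr 1
    field_simp
    ring
  have hdensity (t : ℝ) : gaussianPDF a b t * ENNReal.ofReal (Real.exp (t * e - s * t ^ 2 / 2)) =
      ENNReal.ofReal ((√(1 + s * b))⁻¹ *
        Real.exp ((2 * a * e + b * e ^ 2 - s * a ^ 2) / (2 * (1 + s * b)))) *
        gaussianPDF ((a + b * e) / (1 + s * b)) V t := by
    rw [gaussianPDF, gaussianPDF, ← ENNReal.ofReal_mul (gaussianPDFReal_nonneg _ _ _),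
      ← ENNReal.ofReal_mul (by positivity), gaussianPDFReal, gaussianPDFReal, mul_assoc, hsquare,
      hsqrt, mul_inv]
    congr 1
    ring
  rw [gaussianReal_of_var_ne_zero a hb,
    lintegral_withDensity_eq_lintegral_mul _ (measurable_gaussianPDF _ _) (by fun_prop)]
  simp only [Pi.mul_apply, hdensity]
  rw [lintegral_const_mul _ (measurable_gaussianPDF _ _), lintegral_gaussianPDF_eq_one _ hV0,
    mul_one]

lemma hasSubgaussianMGF_id_gaussianReal {v s : ℝ≥0} (hvs : v ≤ s) :
    HasSubgaussianMGF id s (gaussianReal 0 v) where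
  integrable_exp_mul t := integrable_exp_mul_gaussianReal t
  mgf_le t := by
    rw [mgf_gaussianReal Measure.map_id]
    have : (v : ℝ) ≤ s := hvs
    gcongr
    simp only [zero_mul, zero_add]
    gcongr

/- The integrand is, up to the factor `√(1 + q)`, the mixture of the exponentials
`exp (t e - s t² / 2)` over a Gaussian `t`, and each of these has integral at most `1`. -/
lemma lintegral_exp_quadratic_le {ν : Measure ℝ} [SFinite ν] {s : ℝ≥0}
    (hν : HasSubgaussianMGF id s ν) (hs : s ≠ 0) {q : ℝ} (hq : 0 ≤ q) (r : ℝ) :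
    ∫⁻ e, ENNReal.ofReal (Real.exp ((2 * e * r + e ^ 2 * q - r ^ 2) / (1 + q) / (2 * s))) ∂ν ≤
      ENNReal.ofReal (√(1 + q)) := by
  set b : ℝ≥0 := q.toNNReal / s with hb
  have hbr : (b : ℝ) = q / s := by simp [hb, hq]
  have hs' : (s : ℝ) ≠ 0 := by exact_mod_cast hs
  have hsb : (s : ℝ) * b = q := by rw [hbr]; field_simp
  have hmix (e : ℝ) :
      ENNReal.ofReal (Real.exp ((2 * e * r + e ^ 2 * q - r ^ 2) / (1 + q) / (2 * s))) =
      ENNReal.ofReal (√(1 + q)) *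
        ∫⁻ t, ENNReal.ofReal (Real.exp (t * e - s * t ^ 2 / 2)) ∂(gaussianReal (r / s) b) := by
    rw [lintegral_exp_mul_sub_mul_sq_gaussianReal, ← ENNReal.ofReal_mul (Real.sqrt_nonneg _), hsb,
      ← mul_assoc, mul_inv_cancel₀ (by positivity), one_mul, hbr]
    congr 2
    field_simp
  have hexp (t : ℝ) : ∫⁻ e, ENNReal.ofReal (Real.exp (t * e - s * t ^ 2 / 2)) ∂ν ≤ 1 := by
    rw [← ofReal_integral_eq_lintegral_ofReal _ (ae_of_all _ fun _ => (Real.exp_pos _).le),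
      ENNReal.ofReal_le_one]
    · simp only [Real.exp_sub, integral_div]
      exact div_le_one_of_le₀ (hν.mgf_le t) (Real.exp_pos _).le
    · simp only [Real.exp_sub]
      exact (hν.integrable_exp_mul t).div_const _
  simp only [hmix]
  rw [lintegral_const_mul _ (by fun_prop), lintegral_lintegral_swap (by fun_prop)]
  exact mul_le_of_le_one_right' <| (lintegral_mono hexp).trans (by simp)

end MethodOfMixtures

section Chernoff

variable {ι Ω : Type*} [MeasurableSpace Ω] {P : Measure Ω} [IsProbabilityMeasure P]

lemma exp_neg_le_one_sub_half {u : ℝ} (h0 : 0 ≤ u) (h1 : u ≤ 1) : Real.exp (-u) ≤ 1 - u / 2 := by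
  rw [Real.exp_neg, inv_le_iff_one_le_mul₀ (Real.exp_pos _)]
  nlinarith [Real.add_one_le_exp u]

lemma integrable_exp_neg_mul {Y : Ω → ℝ} (hY : AEMeasurable Y P) (hY0 : ∀ᵐ ω ∂P, 0 ≤ Y ω)
    {a : ℝ} (ha : 0 ≤ a) : Integrable (fun ω => Real.exp (-a * Y ω)) P := by
  refine Integrable.of_bound (by fun_prop) 1 (hY0.mono fun ω h => ?_)
  rw [Real.norm_eq_abs, Real.abs_exp, Real.exp_le_one_iff, neg_mul]
  exact neg_nonpos.2 (mul_nonneg ha h)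

lemma mgf_neg_inv_le {Y : Ω → ℝ} (hYm : AEMeasurable Y P) {B : ℝ} (hB : 0 < B)
    (hY : ∀ᵐ ω ∂P, 0 ≤ Y ω ∧ Y ω ≤ B) :
    mgf Y P (-B⁻¹) ≤ Real.exp (-((∫ ω, Y ω ∂P) / (2 * B))) := by
  have hint : Integrable Y P := Integrable.of_bound hYm.aestronglyMeasurable B
    (hY.mono fun ω h => by rw [Real.norm_eq_abs, abs_of_nonneg h.1]; exact h.2)
  calc mgf Y P (-B⁻¹) ≤ ∫ ω, (1 - Y ω / (2 * B)) ∂P := by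
        refine integral_mono_ae
          (integrable_exp_neg_mul hYm (hY.mono fun _ h => h.1) (by positivity))
          ((integrable_const _).sub (hint.div_const _)) ?_
        filter_upwards [hY] with ω h
        have := exp_neg_le_one_sub_half (div_nonneg h.1 hB.le) (div_le_one_of_le₀ h.2 hB.le)
        calc Real.exp (-B⁻¹ * Y ω) = Real.exp (-(Y ω / B)) := by ring_nf
          _ ≤ 1 - Y ω / B / 2 := this
          _ = 1 - Y ω / (2 * B) := by ring
    _ = -((∫ ω, Y ω ∂P) / (2 * B)) + 1 := by
        rw [integral_sub (integrable_const _) (hint.div_const _), integral_div]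
        simp [sub_eq_neg_add]
    _ ≤ Real.exp (-((∫ ω, Y ω ∂P) / (2 * B))) := Real.add_one_le_exp _

lemma measureReal_sum_lower_tail_le {Y : ι → Ω → ℝ} (hYm : ∀ p, Measurable (Y p))
    (hind : iIndepFun Y P) {B : ℝ} (hB : 0 < B) (hY : ∀ p, ∀ᵐ ω ∂P, 0 ≤ Y p ω ∧ Y p ω ≤ B)
    (S : Finset ι) {r : ℝ} (hr : 0 < r) :
    P.real {ω | 2 * ∑ p ∈ S, Y p ω + 2 * B * Real.log (1 / r) ≤ ∑ p ∈ S, ∫ ω, Y p ω ∂P} ≤ r := by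
  set E : ℝ := ∑ p ∈ S, ∫ ω, Y p ω ∂P
  set a : ℝ := E / 2 - B * Real.log (1 / r) with ha
  have hmgf : mgf (∑ p ∈ S, Y p) P (-B⁻¹) ≤ Real.exp (-(E / (2 * B))) := by
    rw [hind.mgf_sum hYm, Finset.sum_div, ← Finset.sum_neg_distrib, Real.exp_sum]
    exact Finset.prod_le_prod (fun p _ => mgf_nonneg)
      fun p _ => mgf_neg_inv_le (hYm p).aemeasurable hB (hY p)
  have hint : Integrable (fun ω => Real.exp (-B⁻¹ * (∑ p ∈ S, Y p) ω)) P :=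
    hind.integrable_exp_mul_sum hYm fun p _ => integrable_exp_neg_mul (hYm p).aemeasurable
      ((hY p).mono fun _ h => h.1) (by positivity)
  calc P.real {ω | 2 * ∑ p ∈ S, Y p ω + 2 * B * Real.log (1 / r) ≤ E}
      = P.real {ω | (∑ p ∈ S, Y p) ω ≤ a} := by
        congr 1 with ω
        simp only [Set.mem_ofPred_eq, Finset.sum_apply, ha]
        constructor <;> intro h <;> linarith
    _ ≤ Real.exp (- -B⁻¹ * a) * mgf (∑ p ∈ S, Y p) P (-B⁻¹) :=
        measure_le_le_exp_mul_mgf a (by simp [hB.le]) hint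
    _ ≤ Real.exp (- -B⁻¹ * a) * Real.exp (-(E / (2 * B))) := by gcongr
    _ = Real.exp (-Real.log (1 / r)) := by
        rw [← Real.exp_add, ha]
        congr 1
        field_simp
        ring
    _ = r := by rw [Real.exp_neg, Real.exp_log (by positivity), one_div, inv_inv]

end Chernoff

section Net

lemma exists_finset_net_Icc {b : ℝ} (hb : 0 ≤ b) {k : ℕ} (hk : 0 < k) :
    ∃ net : Finset ℝ, (net.card : ℝ) ≤ (2 * b + 3) * k ∧ (∀ y ∈ net, |y| ≤ b + 1) ∧
      ∀ x, |x| ≤ b → ∃ y ∈ net, |x - y| ≤ 1 / k := by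
  have hk0 : (0 : ℝ) < k := by exact_mod_cast hk
  have hk1 : (1 : ℝ) ≤ k := by exact_mod_cast hk
  set R : ℤ := ⌈b * k⌉
  have hR0 : 0 ≤ R := Int.ceil_nonneg (by positivity)
  have hR : (R : ℝ) ≤ b * k + 1 := (Int.ceil_lt_add_one _).le
  refine ⟨(Finset.Icc (-R) R).image fun z : ℤ => (z : ℝ) / k, ?_, ?_, fun x hx => ?_⟩
  · have hcard : (((R + 1 - -R).toNat : ℕ) : ℝ) = 2 * R + 1 := by
      have : (((R + 1 - -R).toNat : ℕ) : ℤ) = 2 * R + 1 := by omega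
      exact_mod_cast this
    calc (((Finset.Icc (-R) R).image fun z : ℤ => (z : ℝ) / k).card : ℝ)
        ≤ (Finset.Icc (-R) R).card := by exact_mod_cast Finset.card_image_le
      _ = 2 * R + 1 := by rw [Int.card_Icc, hcard]
      _ ≤ (2 * b + 3) * k := by nlinarith
  · simp only [Finset.mem_image, Finset.mem_Icc]
    rintro _ ⟨z, ⟨hz1, hz2⟩, rfl⟩
    have hz : |(z : ℝ)| ≤ R := abs_le.2 ⟨by exact_mod_cast hz1, by exact_mod_cast hz2⟩
    rw [abs_div, abs_of_pos hk0, div_le_iff₀ hk0]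
    nlinarith
  · obtain ⟨hx1, hx2⟩ := abs_le.1 hx
    have hceil : b * k ≤ R := Int.le_ceil _
    refine ⟨⌊x * k⌋ / k, Finset.mem_image_of_mem _ (Finset.mem_Icc.2 ⟨?_, ?_⟩), ?_⟩
    · rw [Int.le_floor, Int.cast_neg]
      nlinarith
    · have : ((⌊x * k⌋ : ℤ) : ℝ) ≤ R := (Int.floor_le _).trans (by nlinarith)
      exact_mod_cast this
    · have hsub : x - ⌊x * k⌋ / k = Int.fract (x * k) / k := by
        rw [← Int.self_sub_floor]
        field_simp
      rw [hsub, abs_of_nonneg (div_nonneg (Int.fract_nonneg _) hk0.le)]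
      exact div_le_div_of_nonneg_right (Int.fract_lt_one _).le hk0.le

lemma exists_finset_net_pi (κ : Type*) [Fintype κ] {b : ℝ} (hb : 0 ≤ b) {k : ℕ} (hk : 0 < k) :
    ∃ net : Finset (κ → ℝ), (net.card : ℝ) ≤ ((2 * b + 3) * k) ^ Fintype.card κ ∧
      (∀ g ∈ net, ∀ l, |g l| ≤ b + 1) ∧
      ∀ g : κ → ℝ, (∀ l, |g l| ≤ b) → ∃ g' ∈ net, ∀ l, |g l - g' l| ≤ 1 / k := by
  classical
  obtain ⟨net, hcard, hbound, hnear⟩ := exists_finset_net_Icc hb hk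
  refine ⟨Fintype.piFinset fun _ => net, ?_, ?_, fun g hg => ?_⟩
  · rw [Fintype.card_piFinset, Finset.prod_const, Finset.card_univ, Nat.cast_pow]
    exact pow_le_pow_left₀ (by positivity) hcard _
  · exact fun g hg l => hbound _ (Fintype.mem_piFinset.1 hg l)
  · choose g' hg' hgg' using fun l => hnear (g l) (hg l)
    exact ⟨g', Fintype.mem_piFinset.2 hg', hgg'⟩

end Net

section WellSpread

variable {κ ι : Type*} [Fintype κ]

/-- The second moments of `D` in all directions `g` with entries at most `b` are controlled by the
empirical ones of the points `x p`, `p ∈ S`, up to the additive error `c`. -/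
def WellSpread (D : Measure (κ → ℝ)) (S : Finset ι) (b c : ℝ) (x : ι → κ → ℝ) : Prop :=
  ∀ g : κ → ℝ, (∀ l, |g l| ≤ b) →
    S.card * ∫ y, (g ⬝ᵥ y) ^ 2 ∂D ≤ 8 * ∑ p ∈ S, (g ⬝ᵥ x p) ^ 2 + c

lemma measurableSet_wellSpread [Countable ι] (D : Measure (κ → ℝ)) (S : Finset ι) (b c : ℝ) :
    MeasurableSet {x : ι → κ → ℝ | WellSpread D S b c x} := by
  apply IsClosed.measurableSet
  simp only [WellSpread, Set.ofPred_forall]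
  refine isClosed_iInter fun g => isClosed_iInter fun _ => isClosed_le continuous_const ?_
  fun_prop

lemma sq_dotProduct_le {g y : κ → ℝ} {b K : ℝ} (hg : ∀ l, |g l| ≤ b) (hy : y ⬝ᵥ y ≤ K) :
    (g ⬝ᵥ y) ^ 2 ≤ b ^ 2 * Fintype.card κ * K := by
  have hnorm : ∑ l, y l ^ 2 = y ⬝ᵥ y := by simp [dotProduct, sq]
  calc (g ⬝ᵥ y) ^ 2 ≤ (∑ l, g l ^ 2) * ∑ l, y l ^ 2 := Finset.sum_mul_sq_le_sq_mul_sq _ _ _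
    _ ≤ (∑ _l : κ, b ^ 2) * K := by
        gcongr ?_ * ?_
        · exact Finset.sum_le_sum fun l _ => sq_le_sq' (abs_le.1 (hg l)).1 (abs_le.1 (hg l)).2
        · exact hnorm.trans_le hy
    _ = b ^ 2 * Fintype.card κ * K := by simp [mul_comm]

lemma sq_dotProduct_le_of_near {g g' y : κ → ℝ} {ε K : ℝ} (hg : ∀ l, |g l - g' l| ≤ ε)
    (hy : y ⬝ᵥ y ≤ K) :
    (g ⬝ᵥ y) ^ 2 ≤ 2 * (g' ⬝ᵥ y) ^ 2 + 2 * (ε ^ 2 * Fintype.card κ * K) := by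
  have h := sq_dotProduct_le (g := g - g') hg hy
  rw [sub_dotProduct] at h
  nlinarith [sq_nonneg (g ⬝ᵥ y - 2 * (g' ⬝ᵥ y))]

lemma integrable_sq_dotProduct {D : Measure (κ → ℝ)} [IsFiniteMeasure D] {K : ℝ}
    (hD : ∀ᵐ y ∂D, y ⬝ᵥ y ≤ K) (g : κ → ℝ) : Integrable (fun y => (g ⬝ᵥ y) ^ 2) D := by
  refine Integrable.of_bound (by fun_prop) ((∑ l, |g l|) ^ 2 * Fintype.card κ * K) ?_
  filter_upwards [hD] with y hy
  rw [Real.norm_of_nonneg (sq_nonneg _)]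
  exact sq_dotProduct_le (fun l => Finset.single_le_sum (f := fun l => |g l|)
    (fun _ _ => abs_nonneg _) (Finset.mem_univ l)) hy

lemma card_mul_integral_sq_dotProduct_le_of_near {D : Measure (κ → ℝ)} [IsProbabilityMeasure D]
    {K ε c : ℝ} (hD : ∀ᵐ y ∂D, y ⬝ᵥ y ≤ K) {S : Finset ι} {x : ι → κ → ℝ}
    (hx : ∀ p ∈ S, x p ⬝ᵥ x p ≤ K) {g g' : κ → ℝ} (hg : ∀ l, |g l - g' l| ≤ ε)
    (hg' : S.card * ∫ y, (g' ⬝ᵥ y) ^ 2 ∂D ≤ 2 * ∑ p ∈ S, (g' ⬝ᵥ x p) ^ 2 + c) :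
    S.card * ∫ y, (g ⬝ᵥ y) ^ 2 ∂D ≤
      8 * ∑ p ∈ S, (g ⬝ᵥ x p) ^ 2 + (10 * (S.card * (ε ^ 2 * Fintype.card κ * K)) + 2 * c) := by
  set a : ℝ := ε ^ 2 * Fintype.card κ * K
  have hint := integrable_sq_dotProduct hD
  have hpopulation : ∫ y, (g ⬝ᵥ y) ^ 2 ∂D ≤ 2 * ∫ y, (g' ⬝ᵥ y) ^ 2 ∂D + 2 * a := by
    calc ∫ y, (g ⬝ᵥ y) ^ 2 ∂D ≤ ∫ y, (2 * (g' ⬝ᵥ y) ^ 2 + 2 * a) ∂D :=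
          integral_mono_ae (hint g) (((hint g').const_mul 2).add (integrable_const _))
            (hD.mono fun y hy => sq_dotProduct_le_of_near hg hy)
      _ = 2 * ∫ y, (g' ⬝ᵥ y) ^ 2 ∂D + 2 * a := by
          rw [integral_add ((hint g').const_mul 2) (integrable_const _), integral_const_mul]
          simp
  have hempirical : ∑ p ∈ S, (g' ⬝ᵥ x p) ^ 2 ≤
      2 * ∑ p ∈ S, (g ⬝ᵥ x p) ^ 2 + S.card * (2 * a) := by
    calc ∑ p ∈ S, (g' ⬝ᵥ x p) ^ 2 ≤ ∑ p ∈ S, (2 * (g ⬝ᵥ x p) ^ 2 + 2 * a) :=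
          Finset.sum_le_sum fun p hp =>
            sq_dotProduct_le_of_near (fun l => (abs_sub_comm _ _).trans_le (hg l)) (hx p hp)
      _ = 2 * ∑ p ∈ S, (g ⬝ᵥ x p) ^ 2 + S.card * (2 * a) := by
          rw [Finset.sum_add_distrib, ← Finset.mul_sum, Finset.sum_const, nsmul_eq_mul]
  have := mul_le_mul_of_nonneg_left hpopulation S.card.cast_nonneg (α := ℝ)
  linarith

/-- The additive error in `WellSpread` for `k` independent points of squared norm at most `K` in
`ℝ^m`, with failure probability at most `r`. -/
def spreadSlack (m k : ℕ) (b K r : ℝ) : ℝ :=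
  10 * m * K + 4 * ((b + 1) ^ 2 * m * K) * (m * Real.log ((2 * b + 3) * k) + Real.log (1 / r))

variable {Ω : Type*} [MeasurableSpace Ω] {P : Measure Ω} [IsProbabilityMeasure P]

lemma measureReal_sum_sq_dotProduct_lower_tail_le {D : Measure (κ → ℝ)} {X : ι → Ω → κ → ℝ}
    (hXm : ∀ p, Measurable (X p)) (hlaw : ∀ p, P.map (X p) = D) (hind : iIndepFun X P)
    {K : ℝ} (hD : ∀ᵐ y ∂D, y ⬝ᵥ y ≤ K) {g : κ → ℝ} {b : ℝ} (hg : ∀ l, |g l| ≤ b)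
    (hB : 0 < b ^ 2 * Fintype.card κ * K) (S : Finset ι) {r : ℝ} (hr : 0 < r) :
    P.real {ω | 2 * ∑ p ∈ S, (g ⬝ᵥ X p ω) ^ 2 +
      2 * (b ^ 2 * Fintype.card κ * K) * Real.log (1 / r) ≤
        S.card * ∫ y, (g ⬝ᵥ y) ^ 2 ∂D} ≤ r := by
  have hsq : Measurable fun y : κ → ℝ => (g ⬝ᵥ y) ^ 2 := by fun_prop
  have hmean (p : ι) : ∫ ω, (g ⬝ᵥ X p ω) ^ 2 ∂P = ∫ y, (g ⬝ᵥ y) ^ 2 ∂D := by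
    rw [← hlaw p, integral_map (hXm p).aemeasurable hsq.aestronglyMeasurable]
  have htail := measureReal_sum_lower_tail_le (Y := fun p ω => (g ⬝ᵥ X p ω) ^ 2)
    (fun p => hsq.comp (hXm p)) (hind.comp (fun _ y => (g ⬝ᵥ y) ^ 2) fun _ => hsq) hB
    (fun p => (ae_of_ae_map (hXm p).aemeasurable (hlaw p ▸ hD)).mono
      fun ω h => ⟨sq_nonneg _, sq_dotProduct_le hg h⟩) S hr
  simpa only [hmean, Finset.sum_const, nsmul_eq_mul] using htail

/- Union bound over a net of mesh `1 / |S|` of the directions; the mesh contributes `10 m K`. -/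
lemma measureReal_not_wellSpread_le [Countable ι] [Nonempty κ] {D : Measure (κ → ℝ)}
    [IsProbabilityMeasure D] {X : ι → Ω → κ → ℝ} (hXm : ∀ p, Measurable (X p))
    (hlaw : ∀ p, P.map (X p) = D) (hind : iIndepFun X P) {K b r : ℝ} (hK : 0 < K)
    (hD : ∀ᵐ y ∂D, y ⬝ᵥ y ≤ K) (hb : 0 ≤ b) {S : Finset ι} (hS : S.Nonempty) (hr : 0 < r) :
    P.real {ω | ¬ WellSpread D S b (spreadSlack (Fintype.card κ) S.card b K r)
      (fun p => X p ω)} ≤ r := by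
  have hk : (1 : ℝ) ≤ S.card := by exact_mod_cast hS.card_pos
  set c : ℝ := (2 * b + 3) * S.card
  have hc0 : 0 < c := by positivity
  set r' : ℝ := r / c ^ Fintype.card κ with hr'
  have hlog : Real.log (1 / r') = Fintype.card κ * Real.log c + Real.log (1 / r) := by
    rw [hr', one_div_div, div_eq_mul_one_div, Real.log_mul (by positivity) (by positivity),
      Real.log_pow]
  obtain ⟨net, hcard, hbound, hnear⟩ := exists_finset_net_pi κ hb hS.card_pos
  set bad : (κ → ℝ) → Set Ω := fun g =>
    {ω | 2 * ∑ p ∈ S, (g ⬝ᵥ X p ω) ^ 2 + 2 * ((b + 1) ^ 2 * Fintype.card κ * K) *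
      Real.log (1 / r') ≤ S.card * ∫ y, (g ⬝ᵥ y) ^ 2 ∂D}
  have hsub : {ω | ¬ WellSpread D S b (spreadSlack (Fintype.card κ) S.card b K r)
      (fun p => X p ω)} ≤ᵐ[P] (⋃ g ∈ net, bad g : Set Ω) := by
    filter_upwards [ae_all_iff.2 fun p => ae_of_ae_map (hXm p).aemeasurable (hlaw p ▸ hD)]
      with ω hω
    refine not_imp_comm.1 fun hgood g hg => ?_
    obtain ⟨g', hg'net, hgg'⟩ := hnear g hg
    have hg' : ω ∉ bad g' := fun h => hgood (Set.mem_biUnion hg'net h)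
    have hmesh : (S.card : ℝ) * ((1 / S.card) ^ 2 * Fintype.card κ * K) ≤ Fintype.card κ * K := by
      rw [show (S.card : ℝ) * ((1 / S.card) ^ 2 * Fintype.card κ * K) =
        Fintype.card κ * K / S.card by field_simp]
      exact div_le_self (by positivity) hk
    refine (card_mul_integral_sq_dotProduct_le_of_near hD (fun p _ => hω p) hgg'
      (not_le.1 hg').le).trans ?_
    rw [hlog, spreadSlack]
    linarith
  calc P.real _ ≤ P.real (⋃ g ∈ net, bad g) :=
        ENNReal.toReal_mono (measure_ne_top _ _) (measure_mono_ae hsub)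
    _ ≤ ∑ g ∈ net, P.real (bad g) := measureReal_biUnion_finset_le _ _
    _ ≤ ∑ _g ∈ net, r' := Finset.sum_le_sum fun g hg =>
        measureReal_sum_sq_dotProduct_lower_tail_le hXm hlaw hind hD (hbound g hg)
          (by positivity) S (by positivity)
    _ ≤ c ^ Fintype.card κ * r' := by
        rw [Finset.sum_const, nsmul_eq_mul]
        gcongr
    _ = r := by rw [hr']; field_simp

end WellSpread

section Environment

variable {m d n N : ℕ}

instance isProbabilityMeasure_labelNoise (d : ℕ) (σ : ℝ≥0) :
    IsProbabilityMeasure (labelNoise d σ) := by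
  unfold labelNoise
  infer_instance

lemma integrable_id_gaussianReal (μ : ℝ) (v : ℝ≥0) :
    Integrable (fun e : ℝ => e) (gaussianReal μ v) :=
  (memLp_id_gaussianReal 1).integrable le_rfl

lemma integrable_labelNoise_apply (σ : ℝ≥0) (k : Fin d) :
    Integrable (fun e : Fin d → ℝ => e k) (labelNoise d σ) :=
  integrable_comp_eval (μ := fun _ => gaussianReal 0 (σ ^ 2)) (f := fun e => e)
    (integrable_id_gaussianReal _ _)

lemma integral_labelNoise_apply (σ : ℝ≥0) (k : Fin d) :
    ∫ e : Fin d → ℝ, e k ∂(labelNoise d σ) = 0 :=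
  (integral_comp_eval (μ := fun _ => gaussianReal 0 (σ ^ 2)) (f := fun e => e)
    (by fun_prop)).trans integral_id_gaussianReal

lemma integrable_labelNoise_dotProduct (σ : ℝ≥0) (w : Fin d → ℝ) :
    Integrable (fun e : Fin d → ℝ => e ⬝ᵥ w) (labelNoise d σ) :=
  integrable_finsetSum _ fun k _ => (integrable_labelNoise_apply σ k).mul_const _

lemma integral_labelNoise_dotProduct (σ : ℝ≥0) (w : Fin d → ℝ) :
    ∫ e, e ⬝ᵥ w ∂(labelNoise d σ) = 0 := by
  simp only [dotProduct]
  rw [integral_finsetSum _ fun k _ => (integrable_labelNoise_apply σ k).mul_const _]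
  simp only [integral_mul_const, integral_labelNoise_apply, zero_mul, Finset.sum_const_zero]

variable (M : Model m d n N)

lemma expectedCost_eq (j : Fin N) (x : Fin m → ℝ) :
    expectedCost M j x = (M.F j *ᵥ x) ⬝ᵥ M.W j + M.μ ⬝ᵥ M.W j := by
  have hnoise (c : Fin d → ℝ) : ∫ e, cost M c j e ∂(gaussianReal 0 (M.σ ^ 2)) =
      c ⬝ᵥ M.W j + M.μ ⬝ᵥ M.W j := by
    simp only [cost, ← add_assoc]
    rw [integral_add (integrable_const _) (integrable_id_gaussianReal _ _),
      integral_id_gaussianReal]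
    simp
  simp only [expectedCost, hnoise, labelLaw]
  rw [integral_map (by fun_prop) (by fun_prop)]
  simp only [add_dotProduct, add_right_comm _ (_ ⬝ᵥ _) (M.μ ⬝ᵥ M.W j)]
  rw [integral_add (integrable_const _) (integrable_labelNoise_dotProduct _ _),
    integral_labelNoise_dotProduct]
  simp

lemma measurable_expectedCost (j : Fin N) : Measurable (expectedCost M j) := by
  simp only [funext (expectedCost_eq M j)]
  fun_prop

lemma measurable_optimalCost : Measurable (optimalCost M) :=
  Measurable.iInf (measurable_expectedCost M)

end Environment

section Data

variable {m d n N : ℕ}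

/-- The rounds and individuals of the data collected under action `j` in the rounds `0, …, s`, in
the order of `dataUnder`. -/
def dataIndex (a : Trajectory n N) (s : ℕ) (j : Fin N) : List (ℕ × Fin n) :=
  (List.range (s + 1)).flatMap fun τ =>
    ((List.finRange n).filter fun i => a τ i = j).map fun i => (τ, i)

lemma mem_dataIndex {a : Trajectory n N} {s : ℕ} {j : Fin N} {p : ℕ × Fin n} :
    p ∈ dataIndex a s j ↔ p.1 ≤ s ∧ a p.1 p.2 = j := by
  obtain ⟨τ, i⟩ := p
  simp only [dataIndex, List.mem_flatMap, List.mem_range, List.mem_map, List.mem_filter,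
    List.mem_finRange, true_and, decide_eq_true_eq, Prod.mk.injEq, Nat.lt_succ_iff]
  constructor
  · rintro ⟨τ, hτ, i, hi, rfl, rfl⟩
    exact ⟨hτ, hi⟩
  · exact fun ⟨hτ, hi⟩ => ⟨τ, hτ, i, hi, rfl, rfl⟩

lemma nodup_dataIndex (a : Trajectory n N) (s : ℕ) (j : Fin N) : (dataIndex a s j).Nodup := by
  refine List.nodup_flatMap.2 ⟨fun τ _ => ?_, List.nodup_range.imp fun {τ τ'} hne => ?_⟩
  · exact ((List.nodup_finRange n).filter _).map fun i i' h => (Prod.mk.inj h).2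
  · simp only [Function.onFun, List.disjoint_left, List.mem_map, not_exists, not_and]
    rintro p ⟨i, -, rfl⟩ i' - h
    exact hne (Prod.mk.inj h).1.symm

lemma dataIndex_congr {a a' : Trajectory n N} {s : ℕ} (h : ∀ τ ≤ s, a τ = a' τ) (j : Fin N) :
    dataIndex a s j = dataIndex a' s j := by
  refine List.flatMap_congr fun τ hτ => ?_
  rw [h τ (Nat.lt_succ_iff.1 (List.mem_range.1 hτ))]

variable (M : Model m d n N) (Q : Procedure m d N)

lemma dataUnder_eq_map (ξ : Randomness m d n) (a : Trajectory n N) (s : ℕ) (j : Fin N) :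
    dataUnder M ξ a s j = (dataIndex a s j).map fun p =>
      (feature ξ p.1 p.2, M.F j *ᵥ feature ξ p.1 p.2 + (ξ p.1 p.2).1.2) := by
  rw [dataUnder, dataIndex, List.map_flatMap]
  refine List.flatMap_congr fun τ _ => ?_
  rw [List.map_map]
  refine List.map_congr_left fun i hi => ?_
  have : a τ i = j := by simpa using (List.mem_filter.1 hi).2
  simp only [label, this, Function.comp_apply]

lemma dataUnder_eq_ofFn (ξ : Randomness m d n) (a : Trajectory n N) (s : ℕ) (j : Fin N) :
    dataUnder M ξ a s j = List.ofFn fun r : Fin (dataIndex a s j).length =>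
      (feature ξ ((dataIndex a s j).get r).1 ((dataIndex a s j).get r).2,
        M.F j *ᵥ feature ξ ((dataIndex a s j).get r).1 ((dataIndex a s j).get r).2 +
          (ξ ((dataIndex a s j).get r).1 ((dataIndex a s j).get r).2).1.2) := by
  rw [dataUnder_eq_map]
  conv_lhs => rw [← List.ofFn_get (dataIndex a s j), List.map_ofFn]
  rfl

lemma dataUnder_congr {ξ ξ' : Randomness m d n} {a a' : Trajectory n N} {s : ℕ}
    (hξ : ∀ τ ≤ s, ξ τ = ξ' τ) (ha : ∀ τ ≤ s, a τ = a' τ) (j : Fin N) :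
    dataUnder M ξ a s j = dataUnder M ξ' a' s j := by
  rw [dataUnder_eq_map, dataUnder_eq_map, dataIndex_congr ha]
  refine List.map_congr_left fun p hp => ?_
  simp only [feature, hξ p.1 (mem_dataIndex.1 hp).1]

/-- The squared Euclidean distance of the predictions of `F` and `G` at the feature `x`. -/
def sqPredErr (F G : Matrix (Fin d) (Fin m) ℝ) (x : Fin m → ℝ) : ℝ :=
  ∑ k, ((F *ᵥ x) k - (G *ᵥ x) k) ^ 2

lemma sqPredErr_nonneg (F G : Matrix (Fin d) (Fin m) ℝ) (x : Fin m → ℝ) : 0 ≤ sqPredErr F G x :=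
  Finset.sum_nonneg fun _ _ => sq_nonneg _

lemma inSampleError_nonneg (F G : Matrix (Fin d) (Fin m) ℝ) (D : List (Point m d)) :
    0 ≤ inSampleError F G D :=
  List.sum_nonneg fun _ hx => by
    obtain ⟨p, -, rfl⟩ := List.mem_map.1 hx
    exact sqPredErr_nonneg F G p.1

lemma inSampleError_dataUnder (ξ : Randomness m d n) (a : Trajectory n N) (s : ℕ) (j : Fin N)
    (G : Matrix (Fin d) (Fin m) ℝ) :
    inSampleError (M.F j) G (dataUnder M ξ a s j) =
      ∑ p ∈ (dataIndex a s j).toFinset,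
        sqPredErr (M.F j) G (feature ξ p.1 p.2) := by
  rw [inSampleError, dataUnder_eq_map, List.map_map, List.sum_toFinset _ (nodup_dataIndex _ _ _)]
  rfl

end Data

section Run

variable {m d n N : ℕ} (M : Model m d n N) (Q : Procedure m d N)

/-- After the exploration phase the predictors of round `t` are trained on earlier rounds only, so
that the action of an individual is a function of its feature and of the past. -/
def Procedure.IsCausal (Q : Procedure m d N) : Prop :=
  ∀ t, Q.explore < t → Q.last t < t

variable {M Q}

lemma predictor_congr {ξ ξ' : Randomness m d n} {a a' : Trajectory n N} {t : ℕ}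
    (hlast : Q.last t < t) (hξ : ∀ τ < t, ξ τ = ξ' τ) (ha : ∀ τ < t, a τ = a' τ) (j : Fin N) :
    predictor M Q ξ a t j = predictor M Q ξ' a' t j := by
  rw [predictor, predictor, dataUnder_congr M (fun τ h => hξ τ (h.trans_lt hlast))
    (fun τ h => ha τ (h.trans_lt hlast))]

lemma gram_congr {a a' : Trajectory n N} {t : ℕ} (ha : ∀ τ < t, a τ = a' τ) (i : Fin n) :
    gram M Q a t i = gram M Q a' t i := by
  unfold gram
  congr 1
  exact Finset.sum_congr rfl fun τ h => by rw [ha τ (Finset.mem_Ico.1 h).2]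

lemma muHat_congr {ξ ξ' : Randomness m d n} {a a' : Trajectory n N} {t : ℕ}
    (hξ : ∀ τ < t, ξ τ = ξ' τ) (ha : ∀ τ < t, a τ = a' τ) (i : Fin n) :
    muHat M Q ξ a t i = muHat M Q ξ' a' t i := by
  unfold muHat banditCost
  rw [gram_congr ha]
  congr 1
  refine Finset.sum_congr rfl fun τ h => ?_
  rw [ha τ (Finset.mem_Ico.1 h).2, hξ τ (Finset.mem_Ico.1 h).2]

lemma nextAction_congr (hQ : Q.IsCausal) {ξ ξ' : Randomness m d n} {a a' : Trajectory n N} {t : ℕ}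
    {i : Fin n} (hξ : ∀ τ < t, ξ τ = ξ' τ) (hx : (ξ t i).1 = (ξ' t i).1)
    (ha : ∀ τ < t, a τ = a' τ) : nextAction M Q ξ a t i = nextAction M Q ξ' a' t i := by
  unfold nextAction
  split_ifs with h0 h1
  · rfl
  · rfl
  · congr 1
    ext j
    unfold optimisticValue confidenceBall
    rw [predictor_congr (hQ t (not_le.1 h1)) hξ ha, muHat_congr hξ ha, gram_congr ha]
    simp only [feature, hx]

lemma runUpTo_eq_run (ξ : Randomness m d n) {τ t : ℕ} (h : τ ≤ t) :
    runUpTo M Q ξ t τ = run M Q ξ τ := by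
  induction t, h using Nat.le_induction with
  | base => rfl
  | succ t h ih => rw [runUpTo, Function.update_of_ne (by omega), ih]

lemma run_eq_nextAction (hQ : Q.IsCausal) (ξ : Randomness m d n) (t : ℕ) (i : Fin n) :
    run M Q ξ t i = nextAction M Q ξ (run M Q ξ) t i := by
  cases t with
  | zero => simp only [run, runUpTo, nextAction, if_true]
  | succ t =>
    rw [run, runUpTo, Function.update_self]
    exact nextAction_congr hQ (fun _ _ => rfl) rfl fun τ h => runUpTo_eq_run ξ (by omega)

lemma run_congr (hQ : Q.IsCausal) {ξ ξ' : Randomness m d n} {t : ℕ} (hξ : ∀ τ ≤ t, ξ τ = ξ' τ) :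
    run M Q ξ t = run M Q ξ' t := by
  induction t using Nat.strong_induction_on with
  | _ t ih =>
    ext1 i
    rw [run_eq_nextAction hQ, run_eq_nextAction hQ]
    exact nextAction_congr hQ (fun τ h => hξ τ h.le) (by rw [hξ t le_rfl])
      fun τ h => ih τ h fun τ' h' => hξ τ' (h'.trans h.le)

lemma run_apply_congr (hQ : Q.IsCausal) {ξ ξ' : Randomness m d n} {t : ℕ} {i : Fin n}
    (hξ : ∀ τ < t, ξ τ = ξ' τ) (hx : (ξ t i).1 = (ξ' t i).1) :
    run M Q ξ t i = run M Q ξ' t i := by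
  rw [run_eq_nextAction hQ, run_eq_nextAction hQ]
  exact nextAction_congr hQ hξ hx
    fun τ h => run_congr hQ fun τ' h' => hξ τ' (h'.trans_lt h)

lemma run_of_le_explore (hQ : Q.IsCausal) (ξ ξ' : Randomness m d n) {t : ℕ} (h : t ≤ Q.explore) :
    run M Q ξ t = run M Q ξ' t := by
  ext1 i
  rw [run_eq_nextAction hQ, run_eq_nextAction hQ]
  simp only [nextAction, h, if_true]

variable (M) in
lemma posDef_gram (hB : (∑ k, Matrix.vecMulVec (Q.b k) (Q.b k)).PosDef) (a : Trajectory n N)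
    (t : ℕ) (i : Fin n) : (gram M Q a t i).PosDef :=
  hB.add_posSemidef (Matrix.posSemidef_sum _ fun _ _ => posSemidef_vecMulVec_self _)

lemma optimisticValue_eq (hB : (∑ k, Matrix.vecMulVec (Q.b k) (Q.b k)).PosDef)
    (ξ : Randomness m d n) (a : Trajectory n N) (t : ℕ) (i : Fin n) (j : Fin N) :
    optimisticValue M Q ξ a t i j = (predictor M Q ξ a t j *ᵥ feature ξ t i) ⬝ᵥ M.W j +
      (muHat M Q ξ a t i ⬝ᵥ M.W j - √(radius d n Q.γ t) *
        √(M.W j ⬝ᵥ ((gram M Q a t i)⁻¹ *ᵥ M.W j))) := by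
  obtain ⟨⟨ν, hν, hmin⟩, hlower⟩ := isLeast_dotProduct_ellipsoid (posDef_gram M hB a t i)
    (muHat M Q ξ a t i) (M.W j) (Real.sqrt_nonneg (radius d n Q.γ t))
  simp only [optimisticValue, add_dotProduct]
  refine IsLeast.csInf_eq ⟨⟨ν, hν, ?_⟩, ?_⟩
  · simp only [hmin]
  · rintro _ ⟨ν', hν', rfl⟩
    simpa using hlower ⟨ν', hν', rfl⟩

end Run

section Measurability

lemma measurable_mulVec {α ι κ : Type*} [MeasurableSpace α] [Fintype ι] {A : α → Matrix κ ι ℝ}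
    {x : α → ι → ℝ} (hA : ∀ k l, Measurable fun a => A a k l) (hx : Measurable x) :
    Measurable fun a => A a *ᵥ x a := by
  unfold Matrix.mulVec
  fun_prop

variable {m d n N : ℕ} {M : Model m d n N} {Q : Procedure m d N}

/-- The learned matrix is a measurable function of the data points, for every size of the data
set. -/
def MeasurableLearner (L : Learner m d) : Prop :=
  ∀ k p q, Measurable fun v : Fin k → Point m d => L (List.ofFn v) p q

lemma measurable_feature (t : ℕ) (i : Fin n) :
    Measurable fun ξ : Randomness m d n => feature ξ t i := by
  unfold feature
  fun_prop

lemma measurable_predictor (hL : MeasurableLearner Q.L) (a : Trajectory n N) (t : ℕ) (j : Fin N)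
    (p : Fin d) (q : Fin m) : Measurable fun ξ : Randomness m d n => predictor M Q ξ a t j p q := by
  simp only [predictor, dataUnder_eq_ofFn, feature]
  exact (hL _ p q).comp (measurable_pi_lambda _ fun r => by fun_prop)

lemma measurable_predictor_mulVec_feature (hL : MeasurableLearner Q.L) (a : Trajectory n N)
    (t : ℕ) (j : Fin N) (i : Fin n) :
    Measurable fun ξ : Randomness m d n => predictor M Q ξ a t j *ᵥ feature ξ t i :=
  measurable_mulVec (measurable_predictor hL a t j) (measurable_feature t i)

lemma measurable_muHat (a : Trajectory n N) (t : ℕ) (i : Fin n) :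
    Measurable fun ξ : Randomness m d n => muHat M Q ξ a t i := by
  unfold muHat banditCost
  fun_prop

lemma measurable_nextAction (hB : (∑ k, Matrix.vecMulVec (Q.b k) (Q.b k)).PosDef)
    (hL : MeasurableLearner Q.L) (hsel : Measurable Q.sel) (a : Trajectory n N) (t : ℕ)
    (i : Fin n) : Measurable fun ξ : Randomness m d n => nextAction M Q ξ a t i := by
  unfold nextAction
  split_ifs
  · exact measurable_const
  · exact measurable_const
  · refine hsel.comp (measurable_pi_lambda _ fun j => ?_)
    have := measurable_predictor_mulVec_feature (M := M) hL a t j i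
    have := measurable_muHat (M := M) (Q := Q) a t i
    simp only [optimisticValue_eq hB]
    fun_prop

/- Finitely many rounds of a trajectory take finitely many values. -/
lemma measurable_comp_trajectory [NeZero N] {β : Type*} [MeasurableSpace β]
    {f : Trajectory n N → Randomness m d n → β} (hf : ∀ a, Measurable (f a)) (t : ℕ)
    (hdep : ∀ a a' ξ, (∀ τ < t, a τ = a' τ) → f a ξ = f a' ξ)
    {g : Randomness m d n → Trajectory n N} (hg : ∀ τ < t, ∀ i, Measurable fun ξ => g ξ τ i) :
    Measurable fun ξ => f (g ξ) ξ := by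
  set extend : (Fin t → Fin n → Fin N) → Trajectory n N := fun c τ i =>
    if h : τ < t then c ⟨τ, h⟩ i else 0 with hextend
  set restrict : Randomness m d n → Fin t → Fin n → Fin N := fun ξ τ i => g ξ τ i
  have hrestrict : Measurable restrict :=
    measurable_pi_lambda _ fun τ => measurable_pi_lambda _ fun i => hg τ τ.2 i
  have heq (ξ : Randomness m d n) : f (g ξ) ξ = f (extend (restrict ξ)) ξ :=
    hdep _ _ _ fun τ hτ => by simp only [hextend, hτ, dif_pos, restrict]
  simp only [heq]
  exact (measurable_from_prod_countable_right
    (f := fun p : (Fin t → Fin n → Fin N) × Randomness m d n => f (extend p.1) p.2)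
    fun c => hf (extend c)).comp (hrestrict.prodMk measurable_id)

lemma measurable_run [NeZero N] (hQ : Q.IsCausal)
    (hB : (∑ k, Matrix.vecMulVec (Q.b k) (Q.b k)).PosDef) (hL : MeasurableLearner Q.L)
    (hsel : Measurable Q.sel) (t : ℕ) (i : Fin n) :
    Measurable fun ξ : Randomness m d n => run M Q ξ t i := by
  induction t using Nat.strong_induction_on generalizing i with
  | _ t ih =>
    simp only [run_eq_nextAction hQ _ t i]
    exact measurable_comp_trajectory (f := fun a ξ => nextAction M Q ξ a t i)
      (fun a => measurable_nextAction hB hL hsel a t i) t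
      (fun a a' ξ h => nextAction_congr hQ (fun _ _ => rfl) rfl h) ih

lemma measurable_along_run [NeZero N]
    (hrun : ∀ t i, Measurable fun ξ : Randomness m d n => run M Q ξ t i)
    {β : Type*} [MeasurableSpace β] {f : Trajectory n N → Randomness m d n → β}
    (hf : ∀ a, Measurable (f a)) (t : ℕ)
    (hdep : ∀ a a' ξ, (∀ τ < t, a τ = a' τ) → f a ξ = f a' ξ) :
    Measurable fun ξ => f (run M Q ξ) ξ :=
  measurable_comp_trajectory hf t hdep fun τ _ i => hrun τ i

lemma measurable_regret [NeZero N]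
    (hrun : ∀ t i, Measurable fun ξ : Randomness m d n => run M Q ξ t i) (T : ℕ) :
    Measurable fun ξ : Randomness m d n => regret M Q ξ T := by
  refine Finset.measurable_fun_sum _ fun t _ => Finset.measurable_fun_sum _ fun i _ =>
    Measurable.sub ?_ ((measurable_optimalCost M).comp (measurable_feature t i))
  exact measurable_along_run hrun (f := fun a ξ => expectedCost M (a t i) (feature ξ t i))
    (fun a => (measurable_expectedCost M _).comp (measurable_feature t i)) (t + 1)
    fun a a' ξ h => by rw [h t t.lt_succ_self]

end Measurability

section Independence

variable {Ω : Type*} [MeasurableSpace Ω] {P : Measure Ω}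

lemma lintegral_comp_of_indepFun [IsProbabilityMeasure P] {α β : Type*} [MeasurableSpace α]
    [MeasurableSpace β] {U : Ω → α} {V : Ω → β} (hUV : IndepFun U V P) (hU : Measurable U)
    (hV : Measurable V) {Φ : α → β → ℝ≥0∞} (hΦ : Measurable (Function.uncurry Φ)) :
    ∫⁻ ω, Φ (U ω) (V ω) ∂P = ∫⁻ ω, ∫⁻ v, Φ (U ω) v ∂(P.map V) ∂P := by
  have : IsProbabilityMeasure (P.map V) := Measure.isProbabilityMeasure_map hV.aemeasurable
  calc ∫⁻ ω, Φ (U ω) (V ω) ∂P = ∫⁻ p, Function.uncurry Φ p ∂(P.map fun ω => (U ω, V ω)) :=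
        (lintegral_map hΦ (hU.prodMk hV)).symm
    _ = ∫⁻ u, ∫⁻ v, Φ u v ∂(P.map V) ∂(P.map U) := by
        rw [(indepFun_iff_map_prod_eq_prod_map_map hU.aemeasurable hV.aemeasurable).1 hUV,
          lintegral_prod _ hΦ.aemeasurable]
        rfl
    _ = ∫⁻ ω, ∫⁻ v, Φ (U ω) v ∂(P.map V) ∂P := lintegral_map hΦ.lintegral_prod_right' hU

/-- The rounds before `t` of an array of samples, with zeros from round `t` on. -/
def past {ι E : Type*} [Zero E] (t : ℕ) (ζ : ℕ → ι → E) : ℕ → ι → E :=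
  fun τ l => if τ < t then ζ τ l else 0

variable {ι E : Type*} [Zero E] [MeasurableSpace E]

lemma measurable_past (t : ℕ) : Measurable (past t : (ℕ → ι → E) → ℕ → ι → E) := by
  refine measurable_pi_lambda _ fun τ => measurable_pi_lambda _ fun l => ?_
  unfold past
  split_ifs
  · fun_prop
  · exact measurable_const

lemma indepFun_past [Finite ι] {ξ : ℕ → ι → Ω → E} (hξ : ∀ t i, Measurable (ξ t i))
    (hind : iIndepFun (fun p : ℕ × ι => ξ p.1 p.2) P) (t : ℕ) (i : ι) :
    IndepFun (fun ω => past t fun τ l => ξ τ l ω) (ξ t i) P := by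
  classical
  cases nonempty_fintype ι
  set S : Finset (ℕ × ι) := Finset.range t ×ˢ Finset.univ with hS
  have hmem {τ : ℕ} {l : ι} : (τ, l) ∈ S ↔ τ < t := by simp [hS]
  set extend : (S → E) → ℕ → ι → E := fun u τ l =>
    if h : (τ, l) ∈ S then u ⟨(τ, l), h⟩ else 0 with hextend
  have hextend_meas : Measurable extend := by
    refine measurable_pi_lambda _ fun τ => measurable_pi_lambda _ fun l => ?_
    by_cases h : (τ, l) ∈ S
    · simp only [hextend, h, dif_pos, measurable_pi_apply]
    · simp only [hextend, h, dif_neg, not_false_eq_true, measurable_const]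
  have hindep := (hind.indepFun_finset S {(t, i)} (by simp [hmem]) fun p => hξ p.1 p.2).comp
    hextend_meas (measurable_pi_apply (⟨(t, i), by simp⟩ : ({(t, i)} : Finset (ℕ × ι))))
  have hpast : (fun ω => past t fun τ l => ξ τ l ω) =
      extend ∘ fun ω (p : S) => ξ p.1.1 p.1.2 ω := by
    ext ω τ l
    simp only [past, hextend, hmem, Function.comp_apply, dite_eq_ite]
  rw [hpast]
  exact hindep

end Independence

section Sample

/-- The `ξ t i` are independent samples from the law of one individual in one round. -/
structure IsSample {m d n N : ℕ} (M : Model m d n N) {Ω : Type*} [MeasurableSpace Ω]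
    (P : Measure Ω) (ξ : ℕ → Fin n → Ω → Point m d × ℝ) : Prop where
  measurable (t : ℕ) (i : Fin n) : Measurable (ξ t i)
  map_eq (t : ℕ) (i : Fin n) : P.map (ξ t i) = sampleLaw M
  indep : iIndepFun (fun p : ℕ × Fin n => ξ p.1 p.2) P

variable {m d n N : ℕ} {M : Model m d n N} {Ω : Type*} [MeasurableSpace Ω] {P : Measure Ω}
  {ξ : ℕ → Fin n → Ω → Point m d × ℝ}

lemma IsSample.measurable_randomness (hξ : IsSample M P ξ) :
    Measurable fun ω => ((fun t i => ξ t i ω) : Randomness m d n) :=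
  measurable_pi_lambda _ fun t => measurable_pi_lambda _ fun i => hξ.measurable t i

lemma IsSample.lintegral_comp_past [IsProbabilityMeasure P] (hξ : IsSample M P ξ) (t : ℕ)
    (i : Fin n) {Φ : Randomness m d n → Point m d × ℝ → ℝ≥0∞}
    (hΦ : Measurable (Function.uncurry Φ))
    (hdep : ∀ ζ ζ' v, (∀ τ < t, ζ τ = ζ' τ) → Φ ζ v = Φ ζ' v) :
    ∫⁻ ω, Φ (fun t i => ξ t i ω) (ξ t i ω) ∂P =
      ∫⁻ ω, ∫⁻ v, Φ (fun t i => ξ t i ω) v ∂(sampleLaw M) ∂P := by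
  have hpast (ζ : Randomness m d n) (v : Point m d × ℝ) : Φ ζ v = Φ (past t ζ) v :=
    hdep _ _ _ fun τ hτ => by ext1 l; simp only [past, hτ, if_true]
  simp only [hpast (fun t i => ξ t i _)]
  rw [lintegral_comp_of_indepFun (indepFun_past hξ.measurable hξ.indep t i)
    ((measurable_past t).comp hξ.measurable_randomness) (hξ.measurable t i) hΦ, hξ.map_eq]

end Sample

section Supermartingale

variable {m d n N : ℕ} (M : Model m d n N) (Q : Procedure m d N)

/-- The noise part of the right-hand side of the normal equations for `μ`. -/
def noiseSum (ξ : Randomness m d n) (a : Trajectory n N) (t : ℕ) (i : Fin n) : Fin d → ℝ :=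
  ∑ τ ∈ Finset.Ico 1 t, (ξ τ i).2 • M.W (a τ i)

/-- The squared norm of the noise part with respect to the inverse Gram matrix. -/
def noiseForm (ξ : Randomness m d n) (a : Trajectory n N) (t : ℕ) (i : Fin n) : ℝ :=
  noiseSum M ξ a t i ⬝ᵥ ((gram M Q a t i)⁻¹ *ᵥ noiseSum M ξ a t i)

/-- The statistical leverage `wᵀ A⁻¹ w` of the action `w` taken in round `t`. -/
def leverage (a : Trajectory n N) (t : ℕ) (i : Fin n) : ℝ :=
  M.W (a t i) ⬝ᵥ ((gram M Q a t i)⁻¹ *ᵥ M.W (a t i))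

/-- The contribution of the past noise to the estimated bandit cost of the action taken in
round `t`. -/
def estimateNoise (ξ : Randomness m d n) (a : Trajectory n N) (t : ℕ) (i : Fin n) : ℝ :=
  M.W (a t i) ⬝ᵥ ((gram M Q a t i)⁻¹ *ᵥ noiseSum M ξ a t i)

/-- The exponential supermartingale of the self-normalized bound, for noise with sub-Gaussian
variance proxy `s`. -/
def expProcess (s : ℝ) (ξ : Randomness m d n) (t : ℕ) (i : Fin n) : ℝ :=
  Real.exp (noiseForm M Q ξ (run M Q ξ) t i / (2 * s)) *
    √((∑ k, Matrix.vecMulVec (Q.b k) (Q.b k)).det / (gram M Q (run M Q ξ) t i).det)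

variable {M Q}

lemma gram_succ (a : Trajectory n N) {t : ℕ} (ht : 1 ≤ t) (i : Fin n) :
    gram M Q a (t + 1) i = gram M Q a t i + Matrix.vecMulVec (M.W (a t i)) (M.W (a t i)) := by
  rw [gram, gram, Finset.sum_Ico_succ_top ht, add_assoc]

lemma noiseSum_succ (ξ : Randomness m d n) (a : Trajectory n N) {t : ℕ} (ht : 1 ≤ t) (i : Fin n) :
    noiseSum M ξ a (t + 1) i = noiseSum M ξ a t i + (ξ t i).2 • M.W (a t i) := by
  rw [noiseSum, noiseSum, Finset.sum_Ico_succ_top ht]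

lemma leverage_nonneg (hB : (∑ k, Matrix.vecMulVec (Q.b k) (Q.b k)).PosDef) (a : Trajectory n N)
    (t : ℕ) (i : Fin n) : 0 ≤ leverage M Q a t i :=
  dotProduct_inv_mulVec_self_nonneg (posDef_gram M hB a t i) _

lemma expProcess_nonneg (s : ℝ) (ξ : Randomness m d n) (t : ℕ) (i : Fin n) :
    0 ≤ expProcess M Q s ξ t i := by
  unfold expProcess
  positivity

lemma expProcess_one (hB : (∑ k, Matrix.vecMulVec (Q.b k) (Q.b k)).PosDef) (s : ℝ)
    (ξ : Randomness m d n) (i : Fin n) : expProcess M Q s ξ 1 i = 1 := by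
  have hgram : gram M Q (run M Q ξ) 1 i = ∑ k, Matrix.vecMulVec (Q.b k) (Q.b k) := by simp [gram]
  simp [expProcess, noiseForm, noiseSum, hgram, hB.det_pos.ne']

lemma expProcess_succ (hB : (∑ k, Matrix.vecMulVec (Q.b k) (Q.b k)).PosDef) (s : ℝ)
    (ξ : Randomness m d n) {t : ℕ} (ht : 1 ≤ t) (i : Fin n) {q r : ℝ}
    (hq : leverage M Q (run M Q ξ) t i = q) (hr : estimateNoise M Q ξ (run M Q ξ) t i = r) :
    expProcess M Q s ξ (t + 1) i = expProcess M Q s ξ t i * (√(1 + q))⁻¹ *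
      Real.exp ((2 * (ξ t i).2 * r + (ξ t i).2 ^ 2 * q - r ^ 2) / (1 + q) / (2 * s)) := by
  have hA := posDef_gram M hB (run M Q ξ) t i
  have hq0 : 0 ≤ q := hq ▸ leverage_nonneg hB _ _ _
  have hdet (u v : ℝ) : √(u / (v * (1 + q))) = √(u / v) * (√(1 + q))⁻¹ := by
    rw [← div_div, Real.sqrt_div' _ (by linarith), div_eq_mul_inv]
  rw [leverage] at hq
  rw [estimateNoise] at hr
  rw [expProcess, expProcess, noiseForm, noiseForm, gram_succ _ ht, noiseSum_succ _ _ ht,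
    dotProduct_inv_add_vecMulVec_self hA, det_add_vecMulVec_self hA, hq, hr, hdet, add_div,
    Real.exp_add]
  ring

section Congr

variable {ξ ξ' : Randomness m d n} {t : ℕ} {i : Fin n}

lemma noiseSum_congr {a a' : Trajectory n N} (hξ : ∀ τ < t, ξ τ = ξ' τ)
    (ha : ∀ τ < t, a τ = a' τ) (i : Fin n) : noiseSum M ξ a t i = noiseSum M ξ' a' t i :=
  Finset.sum_congr rfl fun τ h => by
    rw [ha τ (Finset.mem_Ico.1 h).2, hξ τ (Finset.mem_Ico.1 h).2]

lemma run_congr_of_lt (hQ : Q.IsCausal) (hξ : ∀ τ < t, ξ τ = ξ' τ) :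
    ∀ τ < t, run M Q ξ τ = run M Q ξ' τ :=
  fun _ hτ => run_congr hQ fun τ' h => hξ τ' (h.trans_lt hτ)

lemma expProcess_congr (hQ : Q.IsCausal) (s : ℝ) (hξ : ∀ τ < t, ξ τ = ξ' τ) (i : Fin n) :
    expProcess M Q s ξ t i = expProcess M Q s ξ' t i := by
  have hrun := run_congr_of_lt (M := M) hQ hξ
  rw [expProcess, expProcess, noiseForm, noiseForm, gram_congr hrun, noiseSum_congr hξ hrun]

lemma leverage_congr (hQ : Q.IsCausal) (hξ : ∀ τ < t, ξ τ = ξ' τ) (hx : (ξ t i).1 = (ξ' t i).1) :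
    leverage M Q (run M Q ξ) t i = leverage M Q (run M Q ξ') t i := by
  rw [leverage, leverage, gram_congr (run_congr_of_lt hQ hξ), run_apply_congr hQ hξ hx]

lemma estimateNoise_congr (hQ : Q.IsCausal) (hξ : ∀ τ < t, ξ τ = ξ' τ)
    (hx : (ξ t i).1 = (ξ' t i).1) :
    estimateNoise M Q ξ (run M Q ξ) t i = estimateNoise M Q ξ' (run M Q ξ') t i := by
  have hrun := run_congr_of_lt (M := M) hQ hξ
  rw [estimateNoise, estimateNoise, gram_congr hrun, noiseSum_congr hξ hrun,
    run_apply_congr hQ hξ hx]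

lemma expProcess_succ_congr (hQ : Q.IsCausal)
    (hB : (∑ k, Matrix.vecMulVec (Q.b k) (Q.b k)).PosDef) (s : ℝ) (ht : 1 ≤ t)
    (hξ : ∀ τ < t, ξ τ = ξ' τ) (hi : ξ t i = ξ' t i) :
    expProcess M Q s ξ (t + 1) i = expProcess M Q s ξ' (t + 1) i := by
  rw [expProcess_succ hB s ξ ht i rfl rfl, expProcess_succ hB s ξ' ht i rfl rfl,
    expProcess_congr hQ s hξ, leverage_congr hQ hξ (by rw [hi]),
    estimateNoise_congr hQ hξ (by rw [hi]), hi]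

end Congr

lemma measurable_expProcess [NeZero N]
    (hrun : ∀ t i, Measurable fun ξ : Randomness m d n => run M Q ξ t i)
    (s : ℝ) (t : ℕ) (i : Fin n) :
    Measurable fun ξ : Randomness m d n => expProcess M Q s ξ t i := by
  refine measurable_along_run hrun
    (f := fun a ξ => Real.exp (noiseForm M Q ξ a t i / (2 * s)) *
      √((∑ k, Matrix.vecMulVec (Q.b k) (Q.b k)).det / (gram M Q a t i).det))
    (fun a => ?_) t (fun a a' ξ h => ?_)
  · unfold noiseForm noiseSum
    fun_prop
  · rw [noiseForm, noiseForm, gram_congr h, noiseSum_congr (fun _ _ => rfl) h]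

/-- The randomness `ζ` with the sample of individual `i` in round `t` replaced by `v`. -/
def replaceSample (ζ : Randomness m d n) (t : ℕ) (i : Fin n) (v : Point m d × ℝ) :
    Randomness m d n :=
  Function.update ζ t (Function.update (ζ t) i v)

lemma replaceSample_of_lt (ζ : Randomness m d n) {τ t : ℕ} (h : τ < t) (i : Fin n)
    (v : Point m d × ℝ) : replaceSample ζ t i v τ = ζ τ :=
  Function.update_of_ne h.ne _ _

@[simp]
lemma replaceSample_apply_self (ζ : Randomness m d n) (t : ℕ) (i : Fin n) (v : Point m d × ℝ) :
    replaceSample ζ t i v t i = v := by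
  simp [replaceSample]

@[simp]
lemma replaceSample_self (ζ : Randomness m d n) (t : ℕ) (i : Fin n) :
    replaceSample ζ t i (ζ t i) = ζ := by
  simp [replaceSample]

lemma measurable_replaceSample (t : ℕ) (i : Fin n) :
    Measurable fun p : Randomness m d n × (Point m d × ℝ) => replaceSample p.1 t i p.2 := by
  have hpair : Measurable fun p : Randomness m d n × (Point m d × ℝ) => (p.1 t, p.2) := by
    fun_prop
  have hround : Measurable fun p : Randomness m d n × (Point m d × ℝ) =>
      Function.update (p.1 t) i p.2 := (measurable_update' (a := i)).comp hpair
  exact (measurable_update' (a := t)).comp (measurable_fst.prodMk hround)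

/- One Gaussian integration in the bandit noise: the feature and the past fix the action, hence the
leverage, and the mean factor `√(1 + q)` is exactly the growth of the determinant. -/
lemma lintegral_expProcess_replaceSample_le (hQ : Q.IsCausal)
    (hB : (∑ k, Matrix.vecMulVec (Q.b k) (Q.b k)).PosDef) {s : ℝ≥0} (hs : s ≠ 0)
    (hσ : M.σ ^ 2 ≤ s) (ζ : Randomness m d n) {t : ℕ} (ht : 1 ≤ t) (i : Fin n) (z : Point m d) :
    ∫⁻ e, ENNReal.ofReal (expProcess M Q s (replaceSample ζ t i (z, e)) (t + 1) i)
      ∂(gaussianReal 0 (M.σ ^ 2)) ≤ ENNReal.ofReal (expProcess M Q s ζ t i) := by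
  have hlt (v : Point m d × ℝ) (τ : ℕ) (hτ : τ < t) : replaceSample ζ t i v τ = ζ τ :=
    replaceSample_of_lt ζ hτ i v
  have hlt' (e : ℝ) (τ : ℕ) (hτ : τ < t) :
      replaceSample ζ t i (z, e) τ = replaceSample ζ t i (z, 0) τ := by
    rw [hlt _ _ hτ, hlt _ _ hτ]
  set q := leverage M Q (run M Q (replaceSample ζ t i (z, 0))) t i
  set r := estimateNoise M Q (replaceSample ζ t i (z, 0))
    (run M Q (replaceSample ζ t i (z, 0))) t i
  have hq0 : 0 ≤ q := leverage_nonneg hB _ t i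
  have hstep (e : ℝ) : expProcess M Q s (replaceSample ζ t i (z, e)) (t + 1) i =
      expProcess M Q s ζ t i * (√(1 + q))⁻¹ *
        Real.exp ((2 * e * r + e ^ 2 * q - r ^ 2) / (1 + q) / (2 * s)) := by
    rw [expProcess_succ hB s _ ht i (q := q) (r := r)
      (leverage_congr hQ (hlt' e) (by simp)) (estimateNoise_congr hQ (hlt' e) (by simp)),
      expProcess_congr hQ s (hlt (z, e)), replaceSample_apply_self]
  have hfactor : 0 ≤ expProcess M Q s ζ t i * (√(1 + q))⁻¹ :=
    mul_nonneg (expProcess_nonneg _ _ _ _) (by positivity)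
  simp only [hstep, ENNReal.ofReal_mul hfactor]
  rw [lintegral_const_mul _ (by fun_prop)]
  calc _ ≤ ENNReal.ofReal (expProcess M Q s ζ t i * (√(1 + q))⁻¹) * ENNReal.ofReal (√(1 + q)) := by
        gcongr
        exact lintegral_exp_quadratic_le (hasSubgaussianMGF_id_gaussianReal hσ) hs hq0 r
    _ = ENNReal.ofReal (expProcess M Q s ζ t i) := by
        rw [← ENNReal.ofReal_mul hfactor, mul_assoc,
          inv_mul_cancel₀ (Real.sqrt_pos.2 (by linarith)).ne', mul_one]

variable {Ω : Type*} [MeasurableSpace Ω] {P : Measure Ω} [IsProbabilityMeasure P]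
  {ξ : ℕ → Fin n → Ω → Point m d × ℝ}

lemma lintegral_expProcess_succ_le [NeZero N] [IsProbabilityMeasure M.Dx] (hξ : IsSample M P ξ)
    (hQ : Q.IsCausal) (hB : (∑ k, Matrix.vecMulVec (Q.b k) (Q.b k)).PosDef)
    (hrun : ∀ t i, Measurable fun ξ : Randomness m d n => run M Q ξ t i)
    {s : ℝ≥0} (hs : s ≠ 0) (hσ : M.σ ^ 2 ≤ s) {t : ℕ} (ht : 1 ≤ t) (i : Fin n) :
    ∫⁻ ω, ENNReal.ofReal (expProcess M Q s (fun t i => ξ t i ω) (t + 1) i) ∂P ≤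
      ∫⁻ ω, ENNReal.ofReal (expProcess M Q s (fun t i => ξ t i ω) t i) ∂P := by
  have hmeas : Measurable (Function.uncurry fun (ζ : Randomness m d n) v =>
      ENNReal.ofReal (expProcess M Q s (replaceSample ζ t i v) (t + 1) i)) :=
    ((measurable_expProcess hrun s (t + 1) i).comp (measurable_replaceSample t i)).ennreal_ofReal
  have hdep (ζ ζ' : Randomness m d n) (v : Point m d × ℝ) (h : ∀ τ < t, ζ τ = ζ' τ) :
      ENNReal.ofReal (expProcess M Q s (replaceSample ζ t i v) (t + 1) i) =
        ENNReal.ofReal (expProcess M Q s (replaceSample ζ' t i v) (t + 1) i) := by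
    rw [expProcess_succ_congr hQ hB s ht (ξ' := replaceSample ζ' t i v)
      (fun τ hτ => by rw [replaceSample_of_lt _ hτ, replaceSample_of_lt _ hτ, h τ hτ]) (by simp)]
  have hcond := hξ.lintegral_comp_past t i hmeas hdep
  simp only [replaceSample_self (fun t i => ξ t i _)] at hcond
  rw [hcond]
  refine lintegral_mono fun ω => ?_
  rw [sampleLaw, lintegral_prod _ hmeas.of_uncurry_left.aemeasurable]
  refine (lintegral_mono fun z =>
    lintegral_expProcess_replaceSample_le hQ hB hs hσ _ ht i z).trans ?_
  simp

lemma lintegral_expProcess_le_one [NeZero N] [IsProbabilityMeasure M.Dx] (hξ : IsSample M P ξ)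
    (hQ : Q.IsCausal) (hB : (∑ k, Matrix.vecMulVec (Q.b k) (Q.b k)).PosDef)
    (hrun : ∀ t i, Measurable fun ξ : Randomness m d n => run M Q ξ t i)
    {s : ℝ≥0} (hs : s ≠ 0) (hσ : M.σ ^ 2 ≤ s) {t : ℕ} (ht : 1 ≤ t) (i : Fin n) :
    ∫⁻ ω, ENNReal.ofReal (expProcess M Q s (fun t i => ξ t i ω) t i) ∂P ≤ 1 := by
  induction t, ht using Nat.le_induction with
  | base => simp [expProcess_one hB]
  | succ t ht ih => exact (lintegral_expProcess_succ_le hξ hQ hB hrun hs hσ ht i).trans ih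

end Supermartingale

section Confidence

variable {m d n N : ℕ} (M : Model m d n N) (Q : Procedure m d N)

/-- The noise processes of all individuals stay below the level of the union bound in the rounds
`t₁ + 1, …, T`. -/
def ConfidenceEvent (s δ : ℝ) (t₁ T : ℕ) (ζ : Randomness m d n) : Prop :=
  ∀ t ∈ Finset.Ioc t₁ T, ∀ i, expProcess M Q s ζ t i < 16 * n * (t : ℝ) ^ 2 / δ

variable {M Q}

lemma measurableSet_confidenceEvent [NeZero N]
    (hrun : ∀ t i, Measurable fun ξ : Randomness m d n => run M Q ξ t i) (s δ : ℝ) (t₁ T : ℕ) :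
    MeasurableSet {ζ : Randomness m d n | ConfidenceEvent M Q s δ t₁ T ζ} := by
  simp only [ConfidenceEvent, Set.ofPred_forall]
  exact Finset.measurableSet_biInter _ fun t _ => MeasurableSet.iInter fun i =>
    measurableSet_lt (measurable_expProcess hrun s t i) measurable_const

lemma sum_one_div_sq_le_two (t₁ T : ℕ) : ∑ t ∈ Finset.Ioc t₁ T, 1 / (t : ℝ) ^ 2 ≤ 2 := by
  have hsub : Finset.Ioc t₁ T ⊆ Finset.Ioo 0 (T + 1) := fun t h => by
    rw [Finset.mem_Ioc] at h
    rw [Finset.mem_Ioo]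
    omega
  calc ∑ t ∈ Finset.Ioc t₁ T, 1 / (t : ℝ) ^ 2 ≤ ∑ t ∈ Finset.Ioo 0 (T + 1), ((t : ℝ) ^ 2)⁻¹ := by
        simp only [one_div]
        exact Finset.sum_le_sum_of_subset_of_nonneg hsub fun _ _ _ => by positivity
    _ ≤ 2 := (sum_Ioo_inv_sq_le 0 (T + 1)).trans (by norm_num)

lemma measureReal_le_inv_of_lintegral_le_one {Ω : Type*} [MeasurableSpace Ω] {P : Measure Ω}
    {f : Ω → ℝ} (hf : Measurable f) (hint : ∫⁻ ω, ENNReal.ofReal (f ω) ∂P ≤ 1) {c : ℝ}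
    (hc : 0 < c) : P.real {ω | c ≤ f ω} ≤ c⁻¹ := by
  refine ENNReal.toReal_le_of_le_ofReal (by positivity) ?_
  calc P {ω | c ≤ f ω} ≤ P {ω | ENNReal.ofReal c ≤ ENNReal.ofReal (f ω)} :=
        measure_mono fun ω h => ENNReal.ofReal_le_ofReal h
    _ ≤ (∫⁻ ω, ENNReal.ofReal (f ω) ∂P) / ENNReal.ofReal c :=
        meas_ge_le_lintegral_div hf.ennreal_ofReal.aemeasurable (by simpa using hc)
          ENNReal.ofReal_ne_top
    _ ≤ 1 / ENNReal.ofReal c := ENNReal.div_le_div_right hint _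
    _ = ENNReal.ofReal c⁻¹ := by rw [one_div, ENNReal.ofReal_inv_of_pos hc]

lemma measureReal_not_confidenceEvent_le [NeZero N] {Ω : Type*} [MeasurableSpace Ω]
    {P : Measure Ω} [IsProbabilityMeasure P] {ξ : ℕ → Fin n → Ω → Point m d × ℝ}
    [IsProbabilityMeasure M.Dx] (hξ : IsSample M P ξ) (hQ : Q.IsCausal)
    (hB : (∑ k, Matrix.vecMulVec (Q.b k) (Q.b k)).PosDef)
    (hrun : ∀ t i, Measurable fun ξ : Randomness m d n => run M Q ξ t i)
    {s : ℝ≥0} (hs : s ≠ 0) (hσ : M.σ ^ 2 ≤ s) {δ : ℝ} (hδ : 0 < δ) (t₁ T : ℕ) :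
    P.real {ω | ¬ ConfidenceEvent M Q s δ t₁ T (fun t i => ξ t i ω)} ≤ δ / 8 := by
  set bad : ℕ → Fin n → Set Ω := fun t i =>
    {ω | 16 * n * (t : ℝ) ^ 2 / δ ≤ expProcess M Q s (fun t i => ξ t i ω) t i}
  have hcover : {ω | ¬ ConfidenceEvent M Q s δ t₁ T (fun t i => ξ t i ω)} ⊆
      ⋃ t ∈ Finset.Ioc t₁ T, ⋃ i ∈ Finset.univ, bad t i := by
    intro ω hω
    simp only [ConfidenceEvent, Set.mem_ofPred_eq, not_forall, not_lt] at hω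
    obtain ⟨t, ht, i, h⟩ := hω
    exact Set.mem_biUnion (by exact ht) (Set.mem_biUnion (by simp) h)
  have hbad (t : ℕ) (ht : t ∈ Finset.Ioc t₁ T) (i : Fin n) :
      P.real (bad t i) ≤ (16 * n * (t : ℝ) ^ 2 / δ)⁻¹ := by
    have ht1 : 1 ≤ t := (Nat.zero_le t₁).trans_lt (Finset.mem_Ioc.1 ht).1
    have hn : 0 < n := i.pos
    exact measureReal_le_inv_of_lintegral_le_one
      ((measurable_expProcess hrun s t i).comp hξ.measurable_randomness)
      (lintegral_expProcess_le_one hξ hQ hB hrun hs hσ ht1 i) (by positivity)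
  calc P.real {ω | ¬ ConfidenceEvent M Q s δ t₁ T (fun t i => ξ t i ω)}
      ≤ P.real (⋃ t ∈ Finset.Ioc t₁ T, ⋃ i ∈ Finset.univ, bad t i) :=
        measureReal_mono hcover (measure_ne_top _ _)
    _ ≤ ∑ t ∈ Finset.Ioc t₁ T, ∑ i : Fin n, P.real (bad t i) :=
        (measureReal_biUnion_finset_le _ _).trans
          (Finset.sum_le_sum fun t _ => measureReal_biUnion_finset_le _ _)
    _ ≤ ∑ t ∈ Finset.Ioc t₁ T, ∑ _i : Fin n, (16 * n * (t : ℝ) ^ 2 / δ)⁻¹ :=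
        Finset.sum_le_sum fun t ht => Finset.sum_le_sum fun i _ => hbad t ht i
    _ ≤ ∑ t ∈ Finset.Ioc t₁ T, δ / 16 * (1 / (t : ℝ) ^ 2) := by
        refine Finset.sum_le_sum fun t _ => ?_
        rw [Finset.sum_const, Finset.card_univ, Fintype.card_fin, nsmul_eq_mul]
        rcases n.eq_zero_or_pos with rfl | hn
        · simp only [Nat.cast_zero, zero_mul]
          positivity
        · exact le_of_eq (by field_simp)
    _ ≤ δ / 16 * 2 := by
        rw [← Finset.mul_sum]
        gcongr
        exact sum_one_div_sq_le_two _ _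
    _ = δ / 8 := by ring

lemma det_gram_le (hb : IsBarycentricSpanner Q.b (Set.range M.W)) (a : Trajectory n N) {t : ℕ}
    (ht : 1 ≤ t) (i : Fin n) :
    (gram M Q a t i).det ≤ (t : ℝ) ^ d * (∑ k, Matrix.vecMulVec (Q.b k) (Q.b k)).det := by
  have hcard : ((Finset.Ico 1 t).card : ℝ) + 1 = t := by
    rw [Nat.card_Ico, Nat.cast_sub ht, Nat.cast_one, sub_add_cancel]
  have hdet := det_spanner_gram_le hb (Finset.Ico 1 t) (w := fun τ => M.W (a τ i))
    fun τ => ⟨_, rfl⟩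
  rwa [hcard] at hdet

lemma noiseForm_le_of_expProcess_lt (hB : (∑ k, Matrix.vecMulVec (Q.b k) (Q.b k)).PosDef)
    (hb : IsBarycentricSpanner Q.b (Set.range M.W)) {s c : ℝ} (hs : 0 < s)
    {ζ : Randomness m d n} {t : ℕ} (ht : 1 ≤ t) {i : Fin n} (h : expProcess M Q s ζ t i < c) :
    noiseForm M Q ζ (run M Q ζ) t i ≤ 2 * s * Real.log c + s * (d * Real.log t) := by
  have hA := (posDef_gram M hB (run M Q ζ) t i).det_pos
  have hBd := hB.det_pos
  set x := noiseForm M Q ζ (run M Q ζ) t i / (2 * s) with hx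
  have hratio : ((t : ℝ) ^ d)⁻¹ ≤
      (∑ k, Matrix.vecMulVec (Q.b k) (Q.b k)).det / (gram M Q (run M Q ζ) t i).det := by
    rw [inv_le_comm₀ (by positivity) (by positivity), inv_div, div_le_iff₀ hBd]
    exact det_gram_le hb _ ht i
  have hexp : Real.exp x * √(((t : ℝ) ^ d)⁻¹) ≤ c :=
    (mul_le_mul_of_nonneg_left (Real.sqrt_le_sqrt hratio) (Real.exp_pos _).le).trans h.le
  have hlog := Real.log_le_log (by positivity) hexp
  rw [Real.log_mul (Real.exp_pos _).ne' (by positivity), Real.log_exp,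
    Real.log_sqrt (by positivity), Real.log_inv, Real.log_pow] at hlog
  have hform : noiseForm M Q ζ (run M Q ζ) t i = 2 * s * x := by
    rw [hx]
    field_simp
  rw [hform]
  nlinarith

lemma gram_mulVec_sub_muHat (hB : (∑ k, Matrix.vecMulVec (Q.b k) (Q.b k)).PosDef)
    (ζ : Randomness m d n) (a : Trajectory n N) (t : ℕ) (i : Fin n) :
    gram M Q a t i *ᵥ (M.μ - muHat M Q ζ a t i) =
      (∑ k, Matrix.vecMulVec (Q.b k) (Q.b k)) *ᵥ M.μ - noiseSum M ζ a t i := by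
  rw [Matrix.mulVec_sub, muHat, mulVec_inv_mulVec (posDef_gram M hB a t i), gram,
    Matrix.add_mulVec, Matrix.sum_mulVec (Finset.Ico 1 t)]
  simp only [banditCost, noiseSum, add_smul, Finset.sum_add_distrib, vecMulVec_self_mulVec,
    dotProduct_comm _ M.μ]
  abel

lemma dotProduct_spanner_gram_mulVec_le (hb : IsBarycentricSpanner Q.b (Set.range M.W)) {K : ℝ}
    (hμ : ∀ j, |M.μ ⬝ᵥ M.W j| ≤ K) :
    M.μ ⬝ᵥ ((∑ k, Matrix.vecMulVec (Q.b k) (Q.b k)) *ᵥ M.μ) ≤ d * K ^ 2 := by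
  rw [Matrix.sum_mulVec, dotProduct_sum]
  calc ∑ k, M.μ ⬝ᵥ (Matrix.vecMulVec (Q.b k) (Q.b k) *ᵥ M.μ) ≤ ∑ _k : Fin d, K ^ 2 := by
        refine Finset.sum_le_sum fun k _ => ?_
        obtain ⟨j, hj⟩ := hb.1 k
        rw [dotProduct_vecMulVec_self_mulVec, ← hj, ← sq_abs]
        exact pow_le_pow_left₀ (abs_nonneg _) (hμ j) 2
    _ = d * K ^ 2 := by simp

lemma sq_dist_muHat_le (hB : (∑ k, Matrix.vecMulVec (Q.b k) (Q.b k)).PosDef)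
    (hb : IsBarycentricSpanner Q.b (Set.range M.W)) {K : ℝ}
    (hμ : ∀ j, |M.μ ⬝ᵥ M.W j| ≤ K) (ζ : Randomness m d n) (a : Trajectory n N) (t : ℕ)
    (i : Fin n) :
    (M.μ - muHat M Q ζ a t i) ⬝ᵥ (gram M Q a t i *ᵥ (M.μ - muHat M Q ζ a t i)) ≤
      2 * (d * K ^ 2) + 2 * noiseForm M Q ζ a t i := by
  have hA := posDef_gram M hB a t i
  have hbias : ((∑ k, Matrix.vecMulVec (Q.b k) (Q.b k)) *ᵥ M.μ) ⬝ᵥ ((gram M Q a t i)⁻¹ *ᵥ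
      ((∑ k, Matrix.vecMulVec (Q.b k) (Q.b k)) *ᵥ M.μ)) ≤ d * K ^ 2 :=
    (dotProduct_add_inv_mulVec_mulVec_le hB
      (Matrix.posSemidef_sum _ fun _ _ => posSemidef_vecMulVec_self _) _).trans
      (dotProduct_spanner_gram_mulVec_le hb hμ)
  rw [← dotProduct_inv_mulVec_self_mulVec hA, gram_mulVec_sub_muHat hB]
  refine (dotProduct_inv_mulVec_sub_self_le hA _ _).trans ?_
  rw [noiseForm]
  gcongr

lemma two_mul_log_le_log_div {n : ℕ} (hn : 0 < n) {δ : ℝ} (hδ : 0 < δ) (hδ1 : δ ≤ 1) (t : ℕ) :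
    2 * Real.log t ≤ Real.log (n * (t : ℝ) ^ 2 / δ) := by
  rcases t.eq_zero_or_pos with rfl | ht
  · simp
  have hn1 : (1 : ℝ) ≤ n := by exact_mod_cast hn
  calc 2 * Real.log t = Real.log ((t : ℝ) ^ 2) := by rw [Real.log_pow, Nat.cast_two]
    _ ≤ Real.log (n * (t : ℝ) ^ 2 / δ) := by
        refine Real.log_le_log (by positivity) ((le_div_iff₀ hδ).2 ?_)
        exact (mul_le_of_le_one_right (by positivity) hδ1).trans
          (le_mul_of_one_le_left (by positivity) hn1)

lemma log_sixteen_le : Real.log 16 ≤ 4 := by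
  rw [show (16 : ℝ) = 2 ^ 4 by norm_num, Real.log_pow]
  have := Real.log_two_lt_d9
  push_cast
  linarith

lemma confidence_level_le_radius {d n : ℕ} {K s δ : ℝ} (hs : 0 < s) (hd : 0 < d) (hn : 0 < n)
    (hδ : 0 < δ) (hδ1 : δ ≤ 1) {t : ℕ} (ht : 1 + s + K ^ 2 ≤ Real.log t) :
    2 * (d * K ^ 2) + 2 * (2 * s * Real.log (16 * n * (t : ℝ) ^ 2 / δ) + s * (d * Real.log t)) ≤
      radius d n δ t := by
  set g := Real.log t
  set ℓ := Real.log (n * (t : ℝ) ^ 2 / δ) with hℓ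
  have hd1 : (1 : ℝ) ≤ d := by exact_mod_cast hd
  have hK := sq_nonneg K
  have hg : 1 ≤ g := by linarith
  have ht0 : (t : ℝ) ≠ 0 := fun h => by simp [g, h] at hg; linarith
  have hgℓ : 2 * g ≤ ℓ := two_mul_log_le_log_div hn hδ hδ1 t
  have hlog : Real.log (16 * n * (t : ℝ) ^ 2 / δ) = Real.log 16 + ℓ := by
    rw [hℓ, ← Real.log_mul (by norm_num) (by positivity)]
    congr 1
    ring
  have hnoise : s * (Real.log 16 + ℓ) ≤ d * (g * (3 * ℓ)) := by
    have : s * (Real.log 16 + ℓ) ≤ g * (3 * ℓ) :=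
      mul_le_mul (by linarith) (by linarith [log_sixteen_le])
        (by linarith [Real.log_nonneg (show (1 : ℝ) ≤ 16 by norm_num)]) (by linarith)
    exact this.trans (le_mul_of_one_le_left (by nlinarith) hd1)
  have hdet : s * (d * g) ≤ d * (g * ℓ) := by
    have : s * (d * g) ≤ ℓ * (d * g) := by gcongr; linarith
    linarith
  have hbias : d * K ^ 2 ≤ d * (g * ℓ) := by
    gcongr
    nlinarith
  have hpos : 0 ≤ d * (g * ℓ) := by
    have : 0 ≤ ℓ := by linarith
    positivity
  rw [hlog]
  refine le_trans ?_ (le_max_left _ _)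
  linarith

lemma mem_confidenceBall_of_expProcess_lt (hB : (∑ k, Matrix.vecMulVec (Q.b k) (Q.b k)).PosDef)
    (hb : IsBarycentricSpanner Q.b (Set.range M.W)) {K s : ℝ} (hs : 0 < s) (hd : 0 < d)
    (hγ : 0 < Q.γ) (hγ1 : Q.γ ≤ 1) (hμ : ∀ j, |M.μ ⬝ᵥ M.W j| ≤ K) {ζ : Randomness m d n} {t : ℕ}
    {i : Fin n} (h : expProcess M Q s ζ t i < 16 * n * (t : ℝ) ^ 2 / Q.γ)
    (ht : 1 + s + K ^ 2 ≤ Real.log t) :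
    M.μ ∈ confidenceBall M Q ζ (run M Q ζ) t i := by
  have ht1 : 1 ≤ t := Nat.one_le_iff_ne_zero.2 fun h0 => by
    subst h0
    simp only [Nat.cast_zero, Real.log_zero] at ht
    linarith [sq_nonneg K]
  refine Real.sqrt_le_sqrt ((sq_dist_muHat_le hB hb hμ ζ _ t i).trans
    (le_trans ?_ (confidence_level_le_radius hs hd i.pos hγ hγ1 ht)))
  gcongr
  exact noiseForm_le_of_expProcess_lt hB hb hs ht1 h

end Confidence

section EllipticalPotential

lemma min_one_le_two_mul_log {q : ℝ} (hq : 0 ≤ q) : min 1 q ≤ 2 * Real.log (1 + q) := by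
  have hu0 : 0 ≤ min 1 q := le_min zero_le_one hq
  have hu1 : min 1 q ≤ 1 := min_le_left _ _
  have hmono : Real.log (1 + min 1 q) ≤ Real.log (1 + q) :=
    Real.log_le_log (by positivity) (by linarith [min_le_right 1 q])
  generalize min 1 q = u at *
  have hlog := Real.one_sub_inv_le_log_of_pos (show 0 < 1 + u by positivity)
  have hhalf : u / 2 ≤ 1 - (1 + u)⁻¹ := by
    have heq : 1 - (1 + u)⁻¹ = u / (1 + u) := by
      field_simp
      ring
    rw [heq]
    exact div_le_div_of_nonneg_left hu0 (by positivity) (by linarith)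
  linarith

lemma sum_le_sqrt_card_mul_sum {ι : Type*} {s : Finset ι} {f g : ι → ℝ}
    (h : ∀ i ∈ s, f i ^ 2 ≤ g i) : ∑ i ∈ s, f i ≤ √(s.card * ∑ i ∈ s, g i) := by
  refine Real.le_sqrt_of_sq_le (sq_sum_le_card_mul_sum_sq.trans ?_)
  gcongr with i hi
  exact h i hi

variable {m d n N : ℕ} {M : Model m d n N} {Q : Procedure m d N}

/- The determinant of the Gram matrix is multiplied by `1 + leverage` in each round, so the
logarithms telescope. -/
lemma sum_log_one_add_leverage (hB : (∑ k, Matrix.vecMulVec (Q.b k) (Q.b k)).PosDef)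
    (a : Trajectory n N) (T : ℕ) (i : Fin n) :
    ∑ t ∈ Finset.Icc 1 T, Real.log (1 + leverage M Q a t i) =
      Real.log (gram M Q a (T + 1) i).det -
        Real.log (∑ k, Matrix.vecMulVec (Q.b k) (Q.b k)).det := by
  induction T with
  | zero => simp [gram]
  | succ T ih =>
    have hA := posDef_gram M hB a (T + 1) i
    have hq := leverage_nonneg (M := M) hB a (T + 1) i
    rw [Finset.sum_Icc_succ_top (by omega), ih, gram_succ a (t := T + 1) (by omega),
      det_add_vecMulVec_self hA, ← leverage, Real.log_mul hA.det_pos.ne' (by positivity)]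
    ring

lemma sum_min_one_leverage_le (hB : (∑ k, Matrix.vecMulVec (Q.b k) (Q.b k)).PosDef)
    (hb : IsBarycentricSpanner Q.b (Set.range M.W)) (a : Trajectory n N) (T : ℕ) (i : Fin n) :
    ∑ t ∈ Finset.Icc 1 T, min 1 (leverage M Q a t i) ≤ 2 * (d * Real.log (T + 1)) := by
  have hlog := Real.log_le_log (posDef_gram M hB a (T + 1) i).det_pos
    (det_gram_le hb a (t := T + 1) (by omega) i)
  rw [Real.log_mul (by positivity) hB.det_pos.ne', Real.log_pow] at hlog
  push_cast at hlog
  calc ∑ t ∈ Finset.Icc 1 T, min 1 (leverage M Q a t i)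
      ≤ ∑ t ∈ Finset.Icc 1 T, 2 * Real.log (1 + leverage M Q a t i) :=
        Finset.sum_le_sum fun t _ => min_one_le_two_mul_log (leverage_nonneg hB a t i)
    _ = 2 * (Real.log (gram M Q a (T + 1) i).det -
          Real.log (∑ k, Matrix.vecMulVec (Q.b k) (Q.b k)).det) := by
        rw [← Finset.mul_sum, sum_log_one_add_leverage hB]
    _ ≤ 2 * (d * Real.log (T + 1)) := by linarith

lemma sum_min_one_sqrt_leverage_le (hB : (∑ k, Matrix.vecMulVec (Q.b k) (Q.b k)).PosDef)
    (hb : IsBarycentricSpanner Q.b (Set.range M.W)) (a : Trajectory n N) (T : ℕ) (i : Fin n) :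
    ∑ t ∈ Finset.Icc 1 T, min 1 (√(leverage M Q a t i)) ≤
      √(T * (2 * (d * Real.log (T + 1)))) := by
  have hsq (t : ℕ) : min 1 (√(leverage M Q a t i)) ^ 2 ≤ min 1 (leverage M Q a t i) := by
    have h0 : 0 ≤ min 1 (√(leverage M Q a t i)) := le_min zero_le_one (Real.sqrt_nonneg _)
    exact le_min (pow_le_one₀ h0 (min_le_left _ _))
      ((Real.le_sqrt h0 (leverage_nonneg hB a t i)).1 (min_le_right _ _))
  refine (sum_le_sqrt_card_mul_sum fun t _ => hsq t).trans ?_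
  rw [Nat.card_Icc, Nat.add_sub_cancel]
  gcongr
  exact sum_min_one_leverage_le hB hb a T i

end EllipticalPotential

section RegretBound

variable {m d n N : ℕ} {M : Model m d n N} {Q : Procedure m d N}

lemma abs_dotProduct_le_sum_abs {ι : Type*} [Fintype ι] (v : ι → ℝ) {w : ι → ℝ}
    (hw : w ⬝ᵥ w ≤ 1) : |v ⬝ᵥ w| ≤ ∑ k, |v k| := by
  have hw1 (k : ι) : |w k| ≤ 1 := by
    rw [← sq_le_one_iff_abs_le_one, sq]
    exact (Finset.single_le_sum (f := fun k => w k * w k) (fun _ _ => mul_self_nonneg _)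
      (Finset.mem_univ k)).trans hw
  refine (Finset.abs_sum_le_sum_abs _ _).trans (Finset.sum_le_sum fun k _ => ?_)
  rw [abs_mul]
  exact mul_le_of_le_one_right (abs_nonneg _) (hw1 k)

lemma abs_expectedCost_le {j : Fin N} (hW : M.W j ⬝ᵥ M.W j ≤ 1) {K_C K_μ : ℝ}
    (hμ : |M.μ ⬝ᵥ M.W j| ≤ K_μ) {x : Fin m → ℝ} (hx : ∑ k, |(M.F j *ᵥ x) k| ≤ K_C) :
    |expectedCost M j x| ≤ K_C + K_μ := by
  rw [expectedCost_eq]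
  exact (abs_add_le _ _).trans (add_le_add ((abs_dotProduct_le_sum_abs _ hW).trans hx) hμ)

lemma exists_optimalCost_eq [Nonempty (Fin N)] (x : Fin m → ℝ) :
    ∃ j, optimalCost M x = expectedCost M j x := by
  obtain ⟨j, hj⟩ := exists_eq_ciInf_of_finite (f := fun j => expectedCost M j x)
  exact ⟨j, hj.symm⟩

lemma optimalCost_le (x : Fin m → ℝ) (j : Fin N) : optimalCost M x ≤ expectedCost M j x :=
  ciInf_le (Set.finite_range _).bddBelow j

lemma expectedCost_sub_optimalCost_le {K : ℝ} {x : Fin m → ℝ}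
    (hK : ∀ j, |expectedCost M j x| ≤ K) (j : Fin N) :
    expectedCost M j x - optimalCost M x ≤ 2 * K := by
  have : Nonempty (Fin N) := ⟨j⟩
  obtain ⟨j', hj'⟩ := exists_optimalCost_eq (M := M) x
  rw [hj']
  linarith [(abs_le.1 (hK j)).2, (abs_le.1 (hK j')).1]

lemma regret_nonneg (ζ : Randomness m d n) (T : ℕ) : 0 ≤ regret M Q ζ T :=
  Finset.sum_nonneg fun _ _ => Finset.sum_nonneg fun _ _ => sub_nonneg.2 (optimalCost_le _ _)

variable (M Q) in
/-- The squared Euclidean prediction error at the feature of individual `i` in round `t`, summed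
over all actions. -/
def predErr (ζ : Randomness m d n) (t : ℕ) (i : Fin n) : ℝ :=
  ∑ j, sqPredErr (M.F j) (predictor M Q ζ (run M Q ζ) t j) (feature ζ t i)

lemma predErr_nonneg (ζ : Randomness m d n) (t : ℕ) (i : Fin n) : 0 ≤ predErr M Q ζ t i :=
  Finset.sum_nonneg fun _ _ => sqPredErr_nonneg _ _ _

variable (M Q) in
/-- The cumulative prediction error after the exploration. -/
def totalPredErr (T : ℕ) (ζ : Randomness m d n) : ℝ :=
  ∑ t ∈ Finset.Ioc Q.explore T, ∑ i, predErr M Q ζ t i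

lemma totalPredErr_nonneg (T : ℕ) (ζ : Randomness m d n) : 0 ≤ totalPredErr M Q T ζ :=
  Finset.sum_nonneg fun t _ => Finset.sum_nonneg fun i _ => predErr_nonneg ζ t i

lemma abs_sub_predictor_dotProduct_le {j : Fin N} (hW : M.W j ⬝ᵥ M.W j ≤ 1)
    (ζ : Randomness m d n) (t : ℕ) (i : Fin n) :
    |(M.F j *ᵥ feature ζ t i) ⬝ᵥ M.W j -
      (predictor M Q ζ (run M Q ζ) t j *ᵥ feature ζ t i) ⬝ᵥ M.W j| ≤ √(predErr M Q ζ t i) := by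
  rw [← sub_dotProduct]
  refine Real.abs_le_sqrt ((Finset.sum_mul_sq_le_sq_mul_sq _ _ _).trans ?_)
  have hW' : ∑ k, M.W j k ^ 2 ≤ 1 := by simpa only [dotProduct, sq] using hW
  refine (mul_le_of_le_one_right (Finset.sum_nonneg fun _ _ => sq_nonneg _) hW').trans ?_
  exact Finset.single_le_sum
    (f := fun j => sqPredErr (M.F j) (predictor M Q ζ (run M Q ζ) t j) (feature ζ t i))
    (fun _ _ => sqPredErr_nonneg _ _ _) (Finset.mem_univ j)

lemma abs_sub_muHat_dotProduct_le (hB : (∑ k, Matrix.vecMulVec (Q.b k) (Q.b k)).PosDef)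
    {ζ : Randomness m d n} {a : Trajectory n N} {t : ℕ} {i : Fin n} {ν : Fin d → ℝ}
    (hν : ν ∈ confidenceBall M Q ζ a t i) (w : Fin d → ℝ) :
    |ν ⬝ᵥ w - muHat M Q ζ a t i ⬝ᵥ w| ≤
      √(radius d n Q.γ t) * √(w ⬝ᵥ ((gram M Q a t i)⁻¹ *ᵥ w)) := by
  rw [← sub_dotProduct]
  exact (abs_dotProduct_le_sqrt_mul_sqrt_inv (posDef_gram M hB a t i) _ _).trans
    (mul_le_mul_of_nonneg_right hν (Real.sqrt_nonneg _))

lemma run_optimisticValue_le (hQ : Q.IsCausal)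
    (hsel : ∀ (v : Fin N → ℝ) (j : Fin N), v (Q.sel v) ≤ v j) (ζ : Randomness m d n) {t : ℕ}
    (ht : Q.explore < t) (i : Fin n) (j : Fin N) :
    optimisticValue M Q ζ (run M Q ζ) t i (run M Q ζ t i) ≤
      optimisticValue M Q ζ (run M Q ζ) t i j := by
  have hrun : run M Q ζ t i = Q.sel (optimisticValue M Q ζ (run M Q ζ) t i) := by
    rw [run_eq_nextAction hQ, nextAction, if_neg (by omega), if_neg (by omega)]
  rw [hrun]
  exact hsel _ j

/- Optimism: the value of the optimal action is underestimated, up to the prediction error, and the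
value of the chosen action is overestimated by at most its confidence width. -/
lemma expectedCost_run_sub_optimalCost_le
    (hB : (∑ k, Matrix.vecMulVec (Q.b k) (Q.b k)).PosDef) (hQ : Q.IsCausal)
    (hsel : ∀ (v : Fin N → ℝ) (j : Fin N), v (Q.sel v) ≤ v j)
    (hW : ∀ j, M.W j ⬝ᵥ M.W j ≤ 1) {ζ : Randomness m d n} {t : ℕ} {i : Fin n}
    (ht : Q.explore < t) (hμ : M.μ ∈ confidenceBall M Q ζ (run M Q ζ) t i) :
    expectedCost M (run M Q ζ t i) (feature ζ t i) - optimalCost M (feature ζ t i) ≤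
      2 * √(predErr M Q ζ t i) +
        2 * √(radius d n Q.γ t) * √(leverage M Q (run M Q ζ) t i) := by
  have : Nonempty (Fin N) := ⟨run M Q ζ t i⟩
  obtain ⟨j, hj⟩ := exists_optimalCost_eq (M := M) (feature ζ t i)
  have hmin := run_optimisticValue_le (M := M) hQ hsel ζ ht i j
  rw [optimisticValue_eq hB, optimisticValue_eq hB, ← leverage] at hmin
  have hpred (j : Fin N) := abs_le.1 (abs_sub_predictor_dotProduct_le (Q := Q) (hW j) ζ t i)
  have hbandit (j : Fin N) := abs_le.1 (abs_sub_muHat_dotProduct_le hB hμ (M.W j))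
  have hwidth := (hbandit (run M Q ζ t i)).2
  rw [← leverage] at hwidth
  rw [hj, expectedCost_eq, expectedCost_eq]
  linarith [(hpred (run M Q ζ t i)).2, (hpred j).1, (hbandit j).1]

lemma expectedCost_run_sub_optimalCost_le_min
    (hB : (∑ k, Matrix.vecMulVec (Q.b k) (Q.b k)).PosDef) (hQ : Q.IsCausal)
    (hsel : ∀ (v : Fin N → ℝ) (j : Fin N), v (Q.sel v) ≤ v j)
    (hW : ∀ j, M.W j ⬝ᵥ M.W j ≤ 1) {K : ℝ} {ζ : Randomness m d n} {t : ℕ} {i : Fin n}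
    (hK : ∀ j, |expectedCost M j (feature ζ t i)| ≤ K) (ht : Q.explore < t)
    (hμ : M.μ ∈ confidenceBall M Q ζ (run M Q ζ) t i) :
    expectedCost M (run M Q ζ t i) (feature ζ t i) - optimalCost M (feature ζ t i) ≤
      2 * √(predErr M Q ζ t i) +
        (2 * √(radius d n Q.γ t) + 2 * K) * min 1 (√(leverage M Q (run M Q ζ) t i)) := by
  have hK0 : 0 ≤ K := (abs_nonneg _).trans (hK (run M Q ζ t i))
  rcases le_total 1 (√(leverage M Q (run M Q ζ) t i)) with hq | hq
  · rw [min_eq_left hq, mul_one]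
    have hβ := Real.sqrt_nonneg (radius d n Q.γ t)
    linarith [expectedCost_sub_optimalCost_le hK (run M Q ζ t i),
      Real.sqrt_nonneg (predErr M Q ζ t i)]
  · rw [min_eq_right hq]
    refine (expectedCost_run_sub_optimalCost_le hB hQ hsel hW ht hμ).trans ?_
    gcongr
    linarith

lemma sum_sqrt_predErr_le (ζ : Randomness m d n) {L : ℕ} (hL : Q.explore ≤ L) (T : ℕ) :
    ∑ t ∈ Finset.Ioc L T, ∑ i, √(predErr M Q ζ t i) ≤ √(n * T * totalPredErr M Q T ζ) := by
  have hcard : (((Finset.Ioc Q.explore T) ×ˢ (Finset.univ : Finset (Fin n))).card : ℝ) ≤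
      n * T := by
    rw [Finset.card_product, Nat.card_Ioc, Finset.card_univ, Fintype.card_fin, mul_comm (n : ℝ)]
    exact_mod_cast Nat.mul_le_mul_right n (Nat.sub_le T Q.explore)
  refine (Finset.sum_le_sum_of_subset_of_nonneg (Finset.Ioc_subset_Ioc_left hL) fun _ _ _ =>
    Finset.sum_nonneg fun _ _ => Real.sqrt_nonneg _).trans ?_
  rw [← Finset.sum_product']
  refine (sum_le_sqrt_card_mul_sum fun p _ => (Real.sq_sqrt (predErr_nonneg ζ p.1 p.2)).le).trans ?_
  rw [Finset.sum_product (f := fun p => predErr M Q ζ p.1 p.2), ← totalPredErr]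
  gcongr
  exact totalPredErr_nonneg T ζ

lemma regret_le_sum_add_sum {K : ℝ} {ζ : Randomness m d n}
    (hK : ∀ t i j, |expectedCost M j (feature ζ t i)| ≤ K) (L T : ℕ) :
    regret M Q ζ T ≤ n * L * (2 * K) + ∑ t ∈ Finset.Ioc L T, ∑ i,
      (expectedCost M (run M Q ζ t i) (feature ζ t i) - optimalCost M (feature ζ t i)) := by
  have hnonneg (t : ℕ) : 0 ≤ ∑ i, (expectedCost M (run M Q ζ t i) (feature ζ t i) -
      optimalCost M (feature ζ t i)) :=
    Finset.sum_nonneg fun _ _ => sub_nonneg.2 (optimalCost_le _ _)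
  have hsub : Finset.Icc 1 T ⊆ Finset.Icc 1 L ∪ Finset.Ioc L T := by
    intro t
    simp only [Finset.mem_union, Finset.mem_Icc, Finset.mem_Ioc]
    omega
  have hdisj : Disjoint (Finset.Icc 1 L) (Finset.Ioc L T) :=
    Finset.disjoint_left.2 fun t => by
      simp only [Finset.mem_Icc, Finset.mem_Ioc]
      omega
  have hearly : ∑ t ∈ Finset.Icc 1 L, ∑ i, (expectedCost M (run M Q ζ t i) (feature ζ t i) -
      optimalCost M (feature ζ t i)) ≤ n * L * (2 * K) :=
    (Finset.sum_le_sum fun t _ => Finset.sum_le_sum fun i _ =>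
      expectedCost_sub_optimalCost_le (hK t i) _).trans_eq (by simp; ring)
  calc regret M Q ζ T
      ≤ ∑ t ∈ Finset.Icc 1 L ∪ Finset.Ioc L T, ∑ i,
          (expectedCost M (run M Q ζ t i) (feature ζ t i) - optimalCost M (feature ζ t i)) :=
        Finset.sum_le_sum_of_subset_of_nonneg hsub fun t _ _ => hnonneg t
    _ ≤ _ := by
        rw [Finset.sum_union hdisj]
        gcongr

lemma regret_le (hB : (∑ k, Matrix.vecMulVec (Q.b k) (Q.b k)).PosDef)
    (hb : IsBarycentricSpanner Q.b (Set.range M.W)) (hQ : Q.IsCausal)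
    (hsel : ∀ (v : Fin N → ℝ) (j : Fin N), v (Q.sel v) ≤ v j)
    (hW : ∀ j, M.W j ⬝ᵥ M.W j ≤ 1) {K β : ℝ} (hK0 : 0 ≤ K) {ζ : Randomness m d n} {L T : ℕ}
    (hL : Q.explore ≤ L) (hK : ∀ t i j, |expectedCost M j (feature ζ t i)| ≤ K)
    (hβ : ∀ t ∈ Finset.Ioc L T, radius d n Q.γ t ≤ β)
    (hμ : ∀ t ∈ Finset.Ioc L T, ∀ i, M.μ ∈ confidenceBall M Q ζ (run M Q ζ) t i) :
    regret M Q ζ T ≤ n * L * (2 * K) +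
      2 * √(n * T * totalPredErr M Q T ζ) +
      (2 * √β + 2 * K) * (n * √(T * (2 * (d * Real.log (T + 1))))) := by
  have hterm (t : ℕ) (ht : t ∈ Finset.Ioc L T) (i : Fin n) :
      expectedCost M (run M Q ζ t i) (feature ζ t i) - optimalCost M (feature ζ t i) ≤
        2 * √(predErr M Q ζ t i) +
          (2 * √β + 2 * K) * min 1 (√(leverage M Q (run M Q ζ) t i)) := by
    refine (expectedCost_run_sub_optimalCost_le_min hB hQ hsel hW (hK t i)
      (hL.trans_lt (Finset.mem_Ioc.1 ht).1) (hμ t ht i)).trans ?_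
    gcongr
    exact hβ t ht
  have hpotential : ∑ t ∈ Finset.Ioc L T, ∑ i, min 1 (√(leverage M Q (run M Q ζ) t i)) ≤
      n * √(T * (2 * (d * Real.log (T + 1)))) := by
    rw [Finset.sum_comm]
    refine (Finset.sum_le_card_nsmul _ _ (√(T * (2 * (d * Real.log (T + 1)))))
      fun i _ => ?_).trans_eq (by simp)
    refine (Finset.sum_le_sum_of_subset_of_nonneg (fun t => ?_) fun _ _ _ =>
      le_min zero_le_one (Real.sqrt_nonneg _)).trans
        (sum_min_one_sqrt_leverage_le hB hb (run M Q ζ) T i)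
    simp only [Finset.mem_Ioc, Finset.mem_Icc]
    omega
  have hsum := Finset.sum_le_sum fun t ht => Finset.sum_le_sum fun i (_ : i ∈ Finset.univ) =>
    hterm t ht i
  simp only [Finset.sum_add_distrib, ← Finset.mul_sum] at hsum
  refine (regret_le_sum_add_sum hK L T).trans ?_
  rw [add_assoc]
  refine add_le_add le_rfl (hsum.trans ?_)
  gcongr
  exact sum_sqrt_predErr_le ζ hL T

end RegretBound

section Exploration

lemma exists_forall_add_mod_eq {N j : ℕ} (hj : j < N) (c : ℕ) :
    ∃ r < N, ∀ q, (c + (N * q + r)) % N = j := by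
  refine ⟨(j + N * c - c) % N, Nat.mod_lt _ (by omega), fun q => ?_⟩
  have hc : c ≤ N * c := Nat.le_mul_of_pos_left _ (by omega)
  calc (c + (N * q + (j + N * c - c) % N)) % N = (c + (j + N * c - c)) % N := by
        rw [add_left_comm, Nat.mul_add_mod, Nat.add_mod_mod]
    _ = (j + N * c) % N := by congr 1; omega
    _ = j := by rw [Nat.add_mul_mod_self_left, Nat.mod_eq_of_lt hj]

variable {m d n N : ℕ}

/-- The rounds `1, …, t₁` and individuals that the cyclic exploration assigns to action `j`. -/
def exploreIndex (n : ℕ) (t₁ : ℕ) (j : Fin N) : Finset (ℕ × Fin n) :=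
  (Finset.Icc 1 t₁ ×ˢ Finset.univ).filter fun p => (n * p.1 + (p.2 + 1)) % N = j

lemma mem_exploreIndex {t₁ : ℕ} {j : Fin N} {p : ℕ × Fin n} :
    p ∈ exploreIndex n t₁ j ↔ (1 ≤ p.1 ∧ p.1 ≤ t₁) ∧ (n * p.1 + (p.2 + 1)) % N = j := by
  simp only [exploreIndex, Finset.mem_filter, Finset.mem_product, Finset.mem_Icc,
    Finset.mem_univ, and_true]

lemma card_exploreIndex_le (t₁ : ℕ) (j : Fin N) : (exploreIndex n t₁ j).card ≤ n * t₁ := by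
  refine (Finset.card_filter_le _ _).trans ?_
  simp [mul_comm]

/- Every block of `N` consecutive individuals of a round contains one that takes action `j`. -/
lemma le_card_exploreIndex (t₁ : ℕ) (j : Fin N) : t₁ * (n / N) ≤ (exploreIndex n t₁ j).card := by
  choose r hr hmod using fun t => exists_forall_add_mod_eq j.2 (n * t + 1)
  have hlt (t : ℕ) {q : ℕ} (hq : q < n / N) : N * q + r t < n :=
    calc N * q + r t < N * (q + 1) := by rw [mul_add_one]; exact Nat.add_lt_add_left (hr t) _
      _ ≤ N * (n / N) := Nat.mul_le_mul_left _ hq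
      _ ≤ n := Nat.mul_div_le _ _
  calc t₁ * (n / N) = (Finset.Icc 1 t₁ ×ˢ Finset.range (n / N)).card := by simp
    _ ≤ (exploreIndex n t₁ j).card :=
        Finset.card_le_card_of_surjOn (fun p : ℕ × Fin n => (p.1, (p.2 : ℕ) / N)) ?_
  rintro ⟨t, q⟩ h
  obtain ⟨ht, hq⟩ := Finset.mem_product.1 (Finset.mem_coe.1 h)
  refine ⟨(t, ⟨N * q + r t, hlt t (Finset.mem_range.1 hq)⟩), mem_exploreIndex.2 ⟨?_, ?_⟩, ?_⟩
  · exact Finset.mem_Icc.1 ht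
  · rw [← hmod t q]
    congr 1
    ring
  · simp only [Prod.mk.injEq, true_and]
    rw [Nat.mul_add_div j.pos, Nat.div_eq_of_lt (hr t), add_zero]

lemma exploreIndex_nonempty (hNn : N ≤ n) {t₁ : ℕ} (ht₁ : 0 < t₁) (j : Fin N) :
    (exploreIndex n t₁ j).Nonempty :=
  Finset.card_pos.1 ((Nat.mul_pos ht₁ (Nat.div_pos hNn j.pos)).trans_le (le_card_exploreIndex t₁ j))

variable {M : Model m d n N} {Q : Procedure m d N}

lemma run_exploreIndex (hQ : Q.IsCausal) (ζ : Randomness m d n) {j : Fin N} {p : ℕ × Fin n}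
    (hp : p ∈ exploreIndex n Q.explore j) : run M Q ζ p.1 p.2 = j := by
  obtain ⟨⟨h1, h2⟩, hmod⟩ := mem_exploreIndex.1 hp
  rw [run_eq_nextAction hQ, nextAction, if_neg (by omega), if_pos h2]
  exact Fin.ext hmod

lemma exploreIndex_subset_dataIndex (hQ : Q.IsCausal) (ζ : Randomness m d n) {s : ℕ}
    (hs : Q.explore ≤ s) (j : Fin N) :
    exploreIndex n Q.explore j ⊆ (dataIndex (run M Q ζ) s j).toFinset := fun _ hp =>
  List.mem_toFinset.2 <| mem_dataIndex.2
    ⟨(mem_exploreIndex.1 hp).1.2.trans hs, run_exploreIndex hQ ζ hp⟩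

end Exploration

section Laws

variable {m d n N : ℕ} {M : Model m d n N} {Ω : Type*} [MeasurableSpace Ω] {P : Measure Ω}
  {ξ : ℕ → Fin n → Ω → Point m d × ℝ}

lemma map_fst_sampleLaw : (sampleLaw M).map Prod.fst = M.Dx.prod (labelNoise d M.σ) :=
  Measure.fst_prod

lemma map_feature_sampleLaw : (sampleLaw M).map (fun v => v.1.1) = M.Dx :=
  calc (sampleLaw M).map (fun v => v.1.1) = ((sampleLaw M).map Prod.fst).map Prod.fst :=
        (Measure.map_map measurable_fst measurable_fst).symm
    _ = M.Dx := by rw [map_fst_sampleLaw]; exact Measure.fst_prod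

lemma IsSample.map_point_eq (hξ : IsSample M P ξ) (t : ℕ) (i : Fin n) :
    P.map (fun ω => (ξ t i ω).1) = M.Dx.prod (labelNoise d M.σ) := by
  rw [← map_fst_sampleLaw, ← hξ.map_eq t i, Measure.map_map measurable_fst (hξ.measurable t i)]
  rfl

lemma IsSample.map_feature_eq (hξ : IsSample M P ξ) (t : ℕ) (i : Fin n) :
    P.map (fun ω => (ξ t i ω).1.1) = M.Dx := by
  conv_rhs => rw [← map_feature_sampleLaw (M := M), ← hξ.map_eq t i]
  rw [Measure.map_map (by fun_prop) (hξ.measurable t i)]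
  rfl

lemma IsSample.map_points_eq_pi [IsProbabilityMeasure P] (hξ : IsSample M P ξ)
    {idx : List (ℕ × Fin n)} (hidx : idx.Nodup) :
    P.map (fun ω (r : Fin idx.length) => (ξ (idx.get r).1 (idx.get r).2 ω).1) =
      Measure.pi fun _ => M.Dx.prod (labelNoise d M.σ) := by
  have hind : iIndepFun (fun (r : Fin idx.length) ω => (ξ (idx.get r).1 (idx.get r).2 ω).1) P :=
    (hξ.indep.precomp (List.nodup_iff_injective_get.1 hidx)).comp (fun _ v => v.1)
      fun _ => measurable_fst
  rw [(iIndepFun_iff_map_fun_eq_pi_map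
    fun r => (hξ.measurable (idx.get r).1 (idx.get r).2).fst.aemeasurable).1 hind]
  simp only [hξ.map_point_eq]

end Laws

section TrainedOnce

variable {m d n N : ℕ} {M : Model m d n N} {Q : Procedure m d N}

lemma measurable_inSampleError_ofFn {L : Learner m d} (hL : MeasurableLearner L)
    (F : Matrix (Fin d) (Fin m) ℝ) (k : ℕ) :
    Measurable fun s : Fin k → Point m d => inSampleError F
      (L (List.ofFn fun r => ((s r).1, F *ᵥ (s r).1 + (s r).2)))
      (List.ofFn fun r => ((s r).1, F *ᵥ (s r).1 + (s r).2)) := by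
  have hfeature (r : Fin k) : Measurable fun s : Fin k → Point m d => (s r).1 := by fun_prop
  have hlabel (r : Fin k) := measurable_mulVec (A := fun _ => F) (by fun_prop) (hfeature r)
  have hpoints : Measurable fun s : Fin k → Point m d =>
      ((fun r => ((s r).1, F *ᵥ (s r).1 + (s r).2)) : Fin k → Point m d) := by fun_prop
  have hlearned (r : Fin k) :=
    measurable_mulVec (fun p q => (hL k p q).comp hpoints) (hfeature r)
  simp only [Function.comp_apply] at hlearned
  simp only [inSampleError, List.map_ofFn, List.sum_ofFn, Function.comp_apply]
  fun_prop

lemma dataUnder_run_explore (hQ : Q.IsCausal) (ζ ζ' : Randomness m d n) (j : Fin N) :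
    dataUnder M ζ (run M Q ζ) Q.explore j = dataUnder M ζ (run M Q ζ') Q.explore j :=
  dataUnder_congr M (fun _ _ => rfl) (fun _ hτ => run_of_le_explore hQ _ _ hτ) j

/- The actions of the exploration phase are not random, so that the data collected under an action
during it are i.i.d. training points. -/
lemma constantERAlongRun_of_constantER {Ω : Type*} [MeasurableSpace Ω]
    {P : Measure Ω} [IsProbabilityMeasure P] {ξ : ℕ → Fin n → Ω → Point m d × ℝ}
    (hξ : IsSample M P ξ) (hL : MeasurableLearner Q.L) (hQ : Q.IsCausal)
    (honce : ∀ t, Q.explore < t → Q.last t = Q.explore) {B : ℝ}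
    (hER : ∀ j, ConstantER Q.L M.Dx M.σ (M.F j) B) (T : ℕ) :
    ConstantERAlongRun M Q P ξ T B := by
  intro t ht _ j
  set idx := dataIndex (run M Q (0 : Randomness m d n)) Q.explore j
  calc _ = ∫⁻ ω, ENNReal.ofReal (inSampleError (M.F j)
          (Q.L (dataUnder M (fun τ i => ξ τ i ω) (run M Q 0) Q.explore j))
          (dataUnder M (fun τ i => ξ τ i ω) (run M Q 0) Q.explore j)) ∂P := by
        simp only [predictor, honce t ht, dataUnder_run_explore hQ _ 0]
    _ = ∫⁻ s, ENNReal.ofReal (inSampleError (M.F j)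
          (Q.L (List.ofFn fun r => ((s r).1, M.F j *ᵥ (s r).1 + (s r).2)))
          (List.ofFn fun r => ((s r).1, M.F j *ᵥ (s r).1 + (s r).2)))
          ∂(P.map fun ω (r : Fin idx.length) => (ξ (idx.get r).1 (idx.get r).2 ω).1) := by
        simp only [dataUnder_eq_ofFn]
        exact (lintegral_map (measurable_inSampleError_ofFn hL (M.F j) idx.length).ennreal_ofReal
          (measurable_pi_lambda _ fun r => (hξ.measurable _ _).fst)).symm
    _ ≤ ENNReal.ofReal B := by
        rw [hξ.map_points_eq_pi (nodup_dataIndex _ _ _)]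
        exact hER j idx.length

end TrainedOnce

section ExploreEvent

variable {m d n N : ℕ} {M : Model m d n N} {Q : Procedure m d N}

lemma WellSpread.congr {κ ι : Type*} [Fintype κ] {D : Measure (κ → ℝ)} {S : Finset ι} {b c : ℝ}
    {x y : ι → κ → ℝ} (hx : WellSpread D S b c x) (h : ∀ p ∈ S, x p = y p) :
    WellSpread D S b c y := by
  intro g hg
  have hsum : ∑ p ∈ S, (g ⬝ᵥ y p) ^ 2 = ∑ p ∈ S, (g ⬝ᵥ x p) ^ 2 :=
    Finset.sum_congr rfl fun p hp => by rw [h p hp]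
  rw [hsum]
  exact hx g hg

lemma spreadSlack_mono (m : ℕ) {k k' : ℕ} (hk : 0 < k) (hkk' : k ≤ k') {b K : ℝ} (hb : 0 ≤ b)
    (hK : 0 ≤ K) (r : ℝ) : spreadSlack m k b K r ≤ spreadSlack m k' b K r := by
  have : (0 : ℝ) < k := by exact_mod_cast hk
  unfold spreadSlack
  gcongr

/-- The features met with each action in the exploration phase are well spread: this event makes
the in-sample error of every predictor trained on them control its error on a new feature. -/
def ExploreEvent (M : Model m d n N) (Q : Procedure m d N) (b c : ℝ) (ζ : Randomness m d n) :
    Prop :=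
  ∀ j : Fin N, WellSpread M.Dx (exploreIndex n Q.explore j) b c fun p => feature ζ p.1 p.2

lemma measurableSet_exploreEvent (b c : ℝ) :
    MeasurableSet {ζ : Randomness m d n | ExploreEvent M Q b c ζ} := by
  simp only [ExploreEvent, Set.ofPred_forall]
  refine MeasurableSet.iInter fun j => ?_
  have h : Measurable fun ζ : Randomness m d n => fun p : ℕ × Fin n => feature ζ p.1 p.2 :=
    measurable_pi_lambda _ fun p => measurable_feature p.1 p.2
  exact h (measurableSet_wellSpread M.Dx (exploreIndex n Q.explore j) b c)

lemma exploreEvent_congr {b c : ℝ} {ζ ζ' : Randomness m d n}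
    (h : ∀ τ ≤ Q.explore, ζ τ = ζ' τ) : ExploreEvent M Q b c ζ ↔ ExploreEvent M Q b c ζ' := by
  suffices himp : ∀ {ζ ζ' : Randomness m d n}, (∀ τ ≤ Q.explore, ζ τ = ζ' τ) →
      ExploreEvent M Q b c ζ → ExploreEvent M Q b c ζ' from
    ⟨himp h, himp fun τ hτ => (h τ hτ).symm⟩
  intro ζ ζ' h hζ j
  refine (hζ j).congr fun p hp => ?_
  simp only [feature, h p.1 (mem_exploreIndex.1 hp).1.2]

lemma measureReal_not_exploreEvent_le [IsProbabilityMeasure M.Dx] {Ω : Type*} [MeasurableSpace Ω]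
    {P : Measure Ω} [IsProbabilityMeasure P] {ξ : ℕ → Fin n → Ω → Point m d × ℝ}
    (hξ : IsSample M P ξ) {K b r : ℝ} (hK : 0 < K) (hD : ∀ᵐ y ∂M.Dx, y ⬝ᵥ y ≤ K) (hb : 0 ≤ b)
    (hm : 0 < m) (hNn : N ≤ n) (hexp : 0 < Q.explore) (hr : 0 < r) :
    P.real {ω | ¬ ExploreEvent M Q b (spreadSlack m (n * Q.explore) b K r)
      (fun t i => ξ t i ω)} ≤ N * r := by
  have : Nonempty (Fin m) := ⟨⟨0, hm⟩⟩
  have hne (j : Fin N) := exploreIndex_nonempty hNn hexp j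
  have hsub : {ω | ¬ ExploreEvent M Q b (spreadSlack m (n * Q.explore) b K r)
      (fun t i => ξ t i ω)} ⊆ ⋃ j ∈ (Finset.univ : Finset (Fin N)),
      {ω | ¬ WellSpread M.Dx (exploreIndex n Q.explore j) b
        (spreadSlack (Fintype.card (Fin m)) (exploreIndex n Q.explore j).card b K r)
        fun p => (ξ p.1 p.2 ω).1.1} := by
    intro ω hω
    simp only [ExploreEvent, Set.mem_ofPred_eq, not_forall] at hω
    obtain ⟨j, hj⟩ := hω
    refine Set.mem_biUnion (Finset.mem_univ j) fun hspread => hj fun g hg => ?_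
    rw [Fintype.card_fin] at hspread
    exact (hspread g hg).trans (add_le_add le_rfl
      (spreadSlack_mono m (hne j).card_pos (card_exploreIndex_le _ _) hb hK.le r))
  calc _ ≤ P.real (⋃ j ∈ (Finset.univ : Finset (Fin N)), _) :=
        measureReal_mono hsub (measure_ne_top _ _)
    _ ≤ ∑ j : Fin N, _ := measureReal_biUnion_finset_le _ _
    _ ≤ ∑ _j : Fin N, r := Finset.sum_le_sum fun j _ =>
        measureReal_not_wellSpread_le (X := fun (p : ℕ × Fin n) ω => (ξ p.1 p.2 ω).1.1)
          (fun p => (hξ.measurable p.1 p.2).fst.fst) (fun p => hξ.map_feature_eq p.1 p.2)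
          (hξ.indep.comp (fun _ v => v.1.1) fun _ => by fun_prop) hK hD hb (hne j) hr
    _ = N * r := by simp

end ExploreEvent

section SqPredErr

variable {m d : ℕ}

lemma sqPredErr_eq_sum_sq_dotProduct (F G : Matrix (Fin d) (Fin m) ℝ) (x : Fin m → ℝ) :
    sqPredErr F G x = ∑ k, ((F k - G k) ⬝ᵥ x) ^ 2 := by
  simp only [sqPredErr, Matrix.mulVec, sub_dotProduct]

lemma measurable_sqPredErr {α : Type*} [MeasurableSpace α] (F : Matrix (Fin d) (Fin m) ℝ)
    {G : α → Matrix (Fin d) (Fin m) ℝ} {x : α → Fin m → ℝ}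
    (hG : ∀ k l, Measurable fun a => G a k l) (hx : Measurable x) :
    Measurable fun a => sqPredErr F (G a) (x a) := by
  have := measurable_mulVec hG hx
  have := measurable_mulVec (A := fun _ => F) (by fun_prop) hx
  unfold sqPredErr
  fun_prop

variable {D : Measure (Fin m → ℝ)}

lemma integrable_sqPredErr [IsFiniteMeasure D] {K : ℝ} (hD : ∀ᵐ y ∂D, y ⬝ᵥ y ≤ K)
    (F G : Matrix (Fin d) (Fin m) ℝ) : Integrable (sqPredErr F G) D := by
  simp only [funext (sqPredErr_eq_sum_sq_dotProduct F G)]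
  exact integrable_finsetSum _ fun k _ => integrable_sq_dotProduct hD _

lemma WellSpread.card_mul_integral_sqPredErr_le [IsFiniteMeasure D] {K : ℝ}
    (hD : ∀ᵐ y ∂D, y ⬝ᵥ y ≤ K) {ι : Type*} {S : Finset ι} {b c : ℝ} {x : ι → Fin m → ℝ}
    (hx : WellSpread D S b c x) {F G : Matrix (Fin d) (Fin m) ℝ}
    (hFG : ∀ k l, |F k l - G k l| ≤ b) :
    S.card * ∫ y, sqPredErr F G y ∂D ≤ 8 * ∑ p ∈ S, sqPredErr F G (x p) + d * c := by
  simp only [sqPredErr_eq_sum_sq_dotProduct]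
  rw [integral_finsetSum _ fun k _ => integrable_sq_dotProduct hD _, Finset.mul_sum,
    Finset.sum_comm]
  calc ∑ k, (S.card : ℝ) * ∫ y, ((F k - G k) ⬝ᵥ y) ^ 2 ∂D
      ≤ ∑ k : Fin d, (8 * ∑ p ∈ S, ((F k - G k) ⬝ᵥ x p) ^ 2 + c) :=
        Finset.sum_le_sum fun k _ => hx (F k - G k) (hFG k)
    _ = 8 * ∑ k, ∑ p ∈ S, ((F k - G k) ⬝ᵥ x p) ^ 2 + d * c := by
        rw [Finset.sum_add_distrib, ← Finset.mul_sum]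
        simp

end SqPredErr

section PredictionError

variable {m d n N : ℕ} {M : Model m d n N} {Q : Procedure m d N}

lemma measurable_predictor_run [NeZero N] (hL : MeasurableLearner Q.L) (hQ : Q.IsCausal)
    (hrun : ∀ t i, Measurable fun ξ : Randomness m d n => run M Q ξ t i) {t : ℕ}
    (ht : Q.explore < t) (j : Fin N) (k : Fin d) (l : Fin m) :
    Measurable fun ζ : Randomness m d n => predictor M Q ζ (run M Q ζ) t j k l :=
  measurable_along_run hrun (f := fun a ζ => predictor M Q ζ a t j k l)
    (fun a => measurable_predictor hL a t j k l) t
    fun a a' ζ h => by rw [predictor_congr (hQ t ht) (fun _ _ => rfl) h]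

lemma measurable_predErr [NeZero N] (hL : MeasurableLearner Q.L) (hQ : Q.IsCausal)
    (hrun : ∀ t i, Measurable fun ξ : Randomness m d n => run M Q ξ t i) {t : ℕ}
    (ht : Q.explore < t) (i : Fin n) :
    Measurable fun ζ : Randomness m d n => predErr M Q ζ t i :=
  Finset.measurable_fun_sum _ fun j _ => measurable_sqPredErr (M.F j)
    (measurable_predictor_run hL hQ hrun ht j) (measurable_feature t i)

lemma measurable_totalPredErr [NeZero N] (hL : MeasurableLearner Q.L) (hQ : Q.IsCausal)
    (hrun : ∀ t i, Measurable fun ξ : Randomness m d n => run M Q ξ t i) (T : ℕ) :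
    Measurable (totalPredErr M Q T) :=
  Finset.measurable_fun_sum _ fun _ ht => Finset.measurable_fun_sum _ fun i _ =>
    measurable_predErr hL hQ hrun (Finset.mem_Ioc.1 ht).1 i

/-- The in-sample error of the predictor for action `j` in round `t` of the run, on the data it was
trained on. -/
def trainErr (M : Model m d n N) (Q : Procedure m d N) (ζ : Randomness m d n) (t : ℕ) (j : Fin N) :
    ℝ :=
  inSampleError (M.F j) (predictor M Q ζ (run M Q ζ) t j)
    (dataUnder M ζ (run M Q ζ) (Q.last t) j)

lemma trainErr_nonneg (ζ : Randomness m d n) (t : ℕ) (j : Fin N) : 0 ≤ trainErr M Q ζ t j :=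
  inSampleError_nonneg _ _ _

lemma measurable_trainErr [NeZero N] (hL : MeasurableLearner Q.L) (hQ : Q.IsCausal)
    (hrun : ∀ t i, Measurable fun ξ : Randomness m d n => run M Q ξ t i) {t : ℕ}
    (ht : Q.explore < t) (j : Fin N) :
    Measurable fun ζ : Randomness m d n => trainErr M Q ζ t j := by
  refine measurable_along_run hrun (f := fun a ζ => inSampleError (M.F j)
      (predictor M Q ζ a t j) (dataUnder M ζ a (Q.last t) j)) (fun a => ?_) t
    fun a a' ζ h => ?_
  · simp only [inSampleError_dataUnder]
    exact Finset.measurable_fun_sum _ fun p _ => measurable_sqPredErr (M.F j)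
      (measurable_predictor hL a t j) (measurable_feature p.1 p.2)
  · rw [predictor_congr (hQ t ht) (fun _ _ => rfl) h,
      dataUnder_congr M (fun _ _ => rfl) fun τ hτ => h τ (hτ.trans_lt (hQ t ht))]

lemma sum_exploreIndex_sqPredErr_le (hQ : Q.IsCausal) (ζ : Randomness m d n) {t : ℕ}
    (ht : Q.explore ≤ Q.last t) (j : Fin N) :
    ∑ p ∈ exploreIndex n Q.explore j, sqPredErr (M.F j) (predictor M Q ζ (run M Q ζ) t j)
      (feature ζ p.1 p.2) ≤ trainErr M Q ζ t j := by
  rw [trainErr, inSampleError_dataUnder]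
  exact Finset.sum_le_sum_of_subset_of_nonneg (exploreIndex_subset_dataIndex hQ ζ ht j)
    fun _ _ _ => sqPredErr_nonneg _ _ _

variable [IsProbabilityMeasure M.Dx] {K K_F c κ : ℝ}

lemma integral_sqPredErr_predictor_le (hD : ∀ᵐ y ∂M.Dx, y ⬝ᵥ y ≤ K) (hQ : Q.IsCausal)
    (hL : ∀ D, BoundedEntries K_F (Q.L D)) {j : Fin N} (hF : BoundedEntries K_F (M.F j))
    (hκ : 0 < κ) (hcard : κ ≤ (exploreIndex n Q.explore j).card) {ζ : Randomness m d n}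
    (hζ : ExploreEvent M Q (2 * K_F) c ζ) {t : ℕ} (ht : Q.explore ≤ Q.last t) :
    ∫ y, sqPredErr (M.F j) (predictor M Q ζ (run M Q ζ) t j) y ∂M.Dx ≤
      8 / κ * trainErr M Q ζ t j + d * c / κ := by
  have hFG (k : Fin d) (l : Fin m) :
      |M.F j k l - predictor M Q ζ (run M Q ζ) t j k l| ≤ 2 * K_F :=
    (abs_sub _ _).trans ((add_le_add (hF k l) (hL _ k l)).trans_eq (two_mul K_F).symm)
  have hspread := (hζ j).card_mul_integral_sqPredErr_le hD hFG
  have htrain := sum_exploreIndex_sqPredErr_le (M := M) hQ ζ ht j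
  have hκ' := mul_le_mul_of_nonneg_right hcard
    (integral_nonneg (μ := M.Dx) (sqPredErr_nonneg (M.F j) (predictor M Q ζ (run M Q ζ) t j)))
  calc _ ≤ (8 * trainErr M Q ζ t j + d * c) / κ := by
        rw [le_div_iff₀' hκ]
        linarith
    _ = 8 / κ * trainErr M Q ζ t j + d * c / κ := by ring

lemma lintegral_sampleLaw_sqPredErr (hD : ∀ᵐ y ∂M.Dx, y ⬝ᵥ y ≤ K)
    (F G : Matrix (Fin d) (Fin m) ℝ) :
    ∫⁻ v, ENNReal.ofReal (sqPredErr F G v.1.1) ∂(sampleLaw M) =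
      ENNReal.ofReal (∫ y, sqPredErr F G y ∂M.Dx) := by
  rw [ofReal_integral_eq_lintegral_ofReal (integrable_sqPredErr hD F G)
    (Filter.Eventually.of_forall (sqPredErr_nonneg F G))]
  conv_rhs => rw [← map_feature_sampleLaw (M := M)]
  exact (lintegral_map (f := fun y => ENNReal.ofReal (sqPredErr F G y))
    (measurable_sqPredErr F (by fun_prop) measurable_id).ennreal_ofReal (by fun_prop)).symm

/- The predictors of round `t` do not depend on the feature of the round, over which the error can
therefore be averaged first. -/
lemma lintegral_indicator_sqPredErr_le [NeZero N] {Ω : Type*} [MeasurableSpace Ω] {P : Measure Ω}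
    [IsProbabilityMeasure P] {ξ : ℕ → Fin n → Ω → Point m d × ℝ} (hξ : IsSample M P ξ)
    (hL : MeasurableLearner Q.L) (hQ : Q.IsCausal)
    (hrun : ∀ t i, Measurable fun ξ : Randomness m d n => run M Q ξ t i)
    {E : Set (Randomness m d n)} (hE : MeasurableSet E) {t : ℕ} (ht : Q.explore < t)
    (hEt : ∀ ζ ζ' : Randomness m d n, (∀ τ < t, ζ τ = ζ' τ) → (ζ ∈ E ↔ ζ' ∈ E))
    (hD : ∀ᵐ y ∂M.Dx, y ⬝ᵥ y ≤ K) {j : Fin N} {g : Randomness m d n → ℝ≥0∞}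
    (hg : ∀ ζ ∈ E, ENNReal.ofReal
      (∫ y, sqPredErr (M.F j) (predictor M Q ζ (run M Q ζ) t j) y ∂M.Dx) ≤ g ζ) (i : Fin n) :
    ∫⁻ ω, E.indicator (fun ζ => ENNReal.ofReal (sqPredErr (M.F j)
        (predictor M Q ζ (run M Q ζ) t j) (feature ζ t i))) (fun t i => ξ t i ω) ∂P ≤
      ∫⁻ ω, g (fun t i => ξ t i ω) ∂P := by
  set Φ : Randomness m d n → Point m d × ℝ → ℝ≥0∞ := fun ζ v => E.indicator (fun ζ =>
    ENNReal.ofReal (sqPredErr (M.F j) (predictor M Q ζ (run M Q ζ) t j) v.1.1)) ζ with hΦ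
  have hΦm : Measurable (Function.uncurry Φ) :=
    (measurable_sqPredErr (M.F j)
      (fun k l => (measurable_predictor_run hL hQ hrun ht j k l).comp measurable_fst)
      (by fun_prop)).ennreal_ofReal.indicator (measurable_fst hE)
  have hdep (ζ ζ' : Randomness m d n) (v : Point m d × ℝ) (h : ∀ τ < t, ζ τ = ζ' τ) :
      Φ ζ v = Φ ζ' v := by
    have hpred : predictor M Q ζ (run M Q ζ) t j = predictor M Q ζ' (run M Q ζ') t j :=
      predictor_congr (hQ t ht) h
        (fun τ hτ => run_congr hQ fun τ' hτ' => h τ' (hτ'.trans_lt hτ)) j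
    classical
    simp only [hΦ, Set.indicator_apply, hEt ζ ζ' h, hpred]
  refine (hξ.lintegral_comp_past t i hΦm hdep).trans_le (lintegral_mono fun ω => ?_)
  by_cases hω : (fun t i => ξ t i ω) ∈ E
  · simp only [hΦ, Set.indicator_of_mem hω, lintegral_sampleLaw_sqPredErr hD]
    exact hg _ hω
  · simp only [hΦ, Set.indicator_of_notMem hω, lintegral_zero, zero_le]

lemma setLIntegral_exploreEvent_sqPredErr_le [NeZero N] {Ω : Type*} [MeasurableSpace Ω]
    {P : Measure Ω} [IsProbabilityMeasure P] {ξ : ℕ → Fin n → Ω → Point m d × ℝ}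
    (hξ : IsSample M P ξ) (hL : MeasurableLearner Q.L) (hQ : Q.IsCausal)
    (hrun : ∀ t i, Measurable fun ξ : Randomness m d n => run M Q ξ t i)
    (hD : ∀ᵐ y ∂M.Dx, y ⬝ᵥ y ≤ K) {j : Fin N} (hF : BoundedEntries K_F (M.F j))
    (hLF : ∀ D, BoundedEntries K_F (Q.L D)) (hκ : 0 < κ)
    (hcard : κ ≤ (exploreIndex n Q.explore j).card) (hc : 0 ≤ c) {B : ℝ} (hB : 0 ≤ B)
    {t : ℕ} (ht : Q.explore < t) (hlast : Q.explore ≤ Q.last t)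
    (hER : ∫⁻ ω, ENNReal.ofReal (trainErr M Q (fun t i => ξ t i ω) t j) ∂P ≤ ENNReal.ofReal B)
    (i : Fin n) :
    ∫⁻ ω in {ω | ExploreEvent M Q (2 * K_F) c fun t i => ξ t i ω}, ENNReal.ofReal
        (sqPredErr (M.F j) (predictor M Q (fun t i => ξ t i ω)
          (run M Q fun t i => ξ t i ω) t j) (feature (fun t i => ξ t i ω) t i)) ∂P ≤
      ENNReal.ofReal ((8 * B + d * c) / κ) := by
  have hE : MeasurableSet {ζ | ExploreEvent M Q (2 * K_F) c ζ} := measurableSet_exploreEvent _ _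
  change ∫⁻ ω in (fun ω t i => ξ t i ω) ⁻¹' {ζ | ExploreEvent M Q (2 * K_F) c ζ}, _ ∂P ≤ _
  rw [← lintegral_indicator (hξ.measurable_randomness hE)]
  calc _ ≤ ∫⁻ ω, (ENNReal.ofReal (8 / κ) * ENNReal.ofReal (trainErr M Q (fun t i => ξ t i ω) t j) +
          ENNReal.ofReal (d * c / κ)) ∂P := by
        refine lintegral_indicator_sqPredErr_le hξ hL hQ hrun hE ht
          (fun ζ ζ' h => exploreEvent_congr fun τ hτ => h τ (hτ.trans_lt ht)) hD
          (g := fun ζ => ENNReal.ofReal (8 / κ) * ENNReal.ofReal (trainErr M Q ζ t j) +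
            ENNReal.ofReal (d * c / κ)) (fun ζ hζ => ?_) i
        rw [← ENNReal.ofReal_mul (by positivity), ← ENNReal.ofReal_add
          (mul_nonneg (by positivity) (trainErr_nonneg ζ t j)) (by positivity)]
        exact ENNReal.ofReal_le_ofReal
          (integral_sqPredErr_predictor_le hD hQ hLF hF hκ hcard hζ hlast)
    _ ≤ ENNReal.ofReal (8 / κ) * ENNReal.ofReal B + ENNReal.ofReal (d * c / κ) := by
        have htrain : Measurable fun ω => ENNReal.ofReal (trainErr M Q (fun t i => ξ t i ω) t j) :=
          ((measurable_trainErr hL hQ hrun ht j).comp hξ.measurable_randomness).ennreal_ofReal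
        rw [lintegral_add_right _ measurable_const, lintegral_const_mul _ htrain,
          lintegral_const, measure_univ, mul_one]
        gcongr
    _ = ENNReal.ofReal ((8 * B + d * c) / κ) := by
        rw [← ENNReal.ofReal_mul (by positivity), ← ENNReal.ofReal_add (by positivity)
          (by positivity)]
        congr 1
        ring

lemma setLIntegral_exploreEvent_totalPredErr_le [NeZero N] {Ω : Type*} [MeasurableSpace Ω]
    {P : Measure Ω} [IsProbabilityMeasure P] {ξ : ℕ → Fin n → Ω → Point m d × ℝ}
    (hξ : IsSample M P ξ) (hL : MeasurableLearner Q.L) (hQ : Q.IsCausal)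
    (hrun : ∀ t i, Measurable fun ξ : Randomness m d n => run M Q ξ t i)
    (hD : ∀ᵐ y ∂M.Dx, y ⬝ᵥ y ≤ K) (hF : ∀ j, BoundedEntries K_F (M.F j))
    (hLF : ∀ D, BoundedEntries K_F (Q.L D)) (hκ : 0 < κ)
    (hcard : ∀ j : Fin N, κ ≤ (exploreIndex n Q.explore j).card) (hc : 0 ≤ c) {B : ℝ} (hB : 0 ≤ B)
    {T : ℕ} (hlast : ∀ t, Q.explore < t → Q.explore ≤ Q.last t)
    (hER : ConstantERAlongRun M Q P ξ T B) :
    ∫⁻ ω in {ω | ExploreEvent M Q (2 * K_F) c fun t i => ξ t i ω},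
        ENNReal.ofReal (totalPredErr M Q T fun t i => ξ t i ω) ∂P ≤
      ENNReal.ofReal (T * (n * (N * ((8 * B + d * c) / κ)))) := by
  have hmeas {t : ℕ} (ht : Q.explore < t) (i : Fin n) (j : Fin N) :
      Measurable fun ω => ENNReal.ofReal (sqPredErr (M.F j) (predictor M Q (fun t i => ξ t i ω)
        (run M Q fun t i => ξ t i ω) t j) (feature (fun t i => ξ t i ω) t i)) :=
    ((measurable_sqPredErr (M.F j) (measurable_predictor_run hL hQ hrun ht j)
      (measurable_feature t i)).comp hξ.measurable_randomness).ennreal_ofReal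
  have hexpand (ζ : Randomness m d n) : ENNReal.ofReal (totalPredErr M Q T ζ) =
      ∑ t ∈ Finset.Ioc Q.explore T, ∑ i, ∑ j, ENNReal.ofReal
        (sqPredErr (M.F j) (predictor M Q ζ (run M Q ζ) t j) (feature ζ t i)) := by
    rw [totalPredErr, ENNReal.ofReal_sum_of_nonneg fun t _ =>
      Finset.sum_nonneg fun i _ => predErr_nonneg ζ t i]
    refine Finset.sum_congr rfl fun t _ => ?_
    rw [ENNReal.ofReal_sum_of_nonneg fun i _ => predErr_nonneg ζ t i]
    exact Finset.sum_congr rfl fun i _ =>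
      ENNReal.ofReal_sum_of_nonneg fun j _ => sqPredErr_nonneg _ _ _
  simp only [hexpand]
  rw [lintegral_finsetSum _ fun t ht => Finset.measurable_fun_sum _ fun i _ =>
    Finset.measurable_fun_sum _ fun j _ => hmeas (Finset.mem_Ioc.1 ht).1 i j]
  calc _ ≤ ∑ _t ∈ Finset.Ioc Q.explore T, ∑ _i : Fin n, ∑ _j : Fin N,
          ENNReal.ofReal ((8 * B + d * c) / κ) := by
        refine Finset.sum_le_sum fun t ht => ?_
        obtain ⟨ht1, ht2⟩ := Finset.mem_Ioc.1 ht
        rw [lintegral_finsetSum _ fun i _ =>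
          Finset.measurable_fun_sum _ fun j _ => hmeas ht1 i j]
        refine Finset.sum_le_sum fun i _ => ?_
        rw [lintegral_finsetSum _ fun j _ => hmeas ht1 i j]
        exact Finset.sum_le_sum fun j _ => setLIntegral_exploreEvent_sqPredErr_le hξ hL hQ hrun hD
          (hF j) hLF hκ (hcard j) hc hB ht1 (hlast t ht1) (hER t ht1 ht2 j) i
    _ ≤ ENNReal.ofReal (T * (n * (N * ((8 * B + d * c) / κ)))) := by
        have hT : T - Q.explore ≤ T := Nat.sub_le _ _
        simp only [Finset.sum_const, Finset.card_univ, Fintype.card_fin, Nat.card_Ioc,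
          nsmul_eq_mul, ENNReal.ofReal_mul, Nat.cast_nonneg, ENNReal.ofReal_natCast]
        gcongr

end PredictionError

section Rates

/-- The length of the exploration phase before rounding. -/
def exploreRate (m d N T : ℕ) : ℝ :=
  (T : ℝ) ^ (2 / 3 : ℝ) * (N : ℝ) ^ (1 / 3 : ℝ) * ((m : ℝ) * d) ^ (2 / 3 : ℝ)

variable {m d n N T : ℕ}

lemma rate_eq_mul_exploreRate : rate m d n N T = n * exploreRate m d N T := by
  unfold rate exploreRate
  ring

lemma one_le_exploreRate (hm : 0 < m) (hd : 0 < d) (hN : 0 < N) (hT : 0 < T) :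
    1 ≤ exploreRate m d N T := by
  have hT' : (1 : ℝ) ≤ T := by exact_mod_cast hT
  have hN' : (1 : ℝ) ≤ N := by exact_mod_cast hN
  have hmd : (1 : ℝ) ≤ (m : ℝ) * d := by exact_mod_cast Nat.mul_pos hm hd
  exact one_le_mul_of_one_le_of_one_le
    (one_le_mul_of_one_le_of_one_le (Real.one_le_rpow hT' (by norm_num))
      (Real.one_le_rpow hN' (by norm_num))) (Real.one_le_rpow hmd (by norm_num))

lemma exploreRate_pow_three :
    exploreRate m d N T ^ 3 = (T : ℝ) ^ 2 * N * ((m : ℝ) * d) ^ 2 := by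
  have hpow {x : ℝ} (hx : 0 ≤ x) (y : ℝ) : (x ^ y) ^ 3 = x ^ (y * 3) := by
    rw [← Real.rpow_natCast, ← Real.rpow_mul hx, Nat.cast_ofNat]
  rw [exploreRate, mul_pow, mul_pow, hpow (by positivity), hpow (by positivity),
    hpow (by positivity)]
  norm_num

lemma exploreRate_le (hm : 0 < m) (hd : 0 < d) (hN : 0 < N) (hT : 0 < T) :
    exploreRate m d N T ≤ (m : ℝ) * d * N * T := by
  have hT' : (1 : ℝ) ≤ T := by exact_mod_cast hT
  have hN' : (1 : ℝ) ≤ N := by exact_mod_cast hN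
  have hmd : (1 : ℝ) ≤ (m : ℝ) * d := by exact_mod_cast Nat.mul_pos hm hd
  refine le_of_pow_le_pow_left₀ (n := 3) (by norm_num) (by positivity) ?_
  calc exploreRate m d N T ^ 3 = (T : ℝ) ^ 2 * N * ((m : ℝ) * d) ^ 2 := exploreRate_pow_three
    _ ≤ (T : ℝ) ^ 3 * (N : ℝ) ^ 3 * ((m : ℝ) * d) ^ 3 := by
        gcongr
        · norm_num
        · exact le_self_pow₀ hN' (by norm_num)
        · norm_num
    _ = ((m : ℝ) * d * N * T) ^ 3 := by ring

lemma dim_mul_sqrt_le_exploreRate (hm : 0 < m) (hd : 0 < d) (hT : 0 < T) (hdN : d ≤ N) :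
    d * √T ≤ exploreRate m d N T := by
  have hT' : (1 : ℝ) ≤ T := by exact_mod_cast hT
  have hm' : (1 : ℝ) ≤ m := by exact_mod_cast hm
  have hrate := one_le_exploreRate hm hd (hd.trans_le hdN) hT
  refine le_of_pow_le_pow_left₀ (n := 6) (by norm_num) (by linarith) ?_
  calc ((d : ℝ) * √T) ^ 6 = (d : ℝ) ^ 6 * (√T ^ 2) ^ 3 := by ring
    _ = ((T : ℝ) ^ 3 * (d : ℝ) ^ 2) * (d : ℝ) ^ 4 := by
        rw [Real.sq_sqrt (by positivity)]
        ring
    _ ≤ ((T : ℝ) ^ 4 * (N : ℝ) ^ 2) * ((m : ℝ) * d) ^ 4 := by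
        gcongr
        · norm_num
        · exact le_mul_of_one_le_left (by positivity) hm'
    _ = (exploreRate m d N T ^ 3) ^ 2 := by
        rw [exploreRate_pow_three]
        ring
    _ = exploreRate m d N T ^ 6 := by ring

lemma exploreRate_le_exploreLength : exploreRate m d N T ≤ exploreLength m d N T := Nat.le_ceil _

lemma exploreLength_le (h : 1 ≤ exploreRate m d N T) :
    (exploreLength m d N T : ℝ) ≤ 2 * exploreRate m d N T := by
  have : (exploreLength m d N T : ℝ) < exploreRate m d N T + 1 :=
    Nat.ceil_lt_add_one (zero_le_one.trans h)
  linarith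

variable {δ : ℝ}

lemma log_div_le_logFactor_sub_one (hδ : 0 < δ) {x : ℝ} (hx : 0 < x)
    (h : x ≤ (m : ℝ) * d * n * N * T) : Real.log (x / δ) ≤ logFactor m d n N T δ - 1 := by
  rw [logFactor, add_sub_cancel_left]
  gcongr

lemma log_le_logFactor_sub_one (hδ : 0 < δ) (hδ1 : δ ≤ 1) {x : ℝ} (hx : 0 < x)
    (h : x ≤ (m : ℝ) * d * n * N * T) : Real.log x ≤ logFactor m d n N T δ - 1 :=
  (Real.log_le_log hx (le_div_self hx.le hδ hδ1)).trans (log_div_le_logFactor_sub_one hδ hx h)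

lemma one_le_logFactor (hδ : 0 < δ) (hδ1 : δ ≤ 1) (h : 0 < m * d * n * N * T) :
    1 ≤ logFactor m d n N T δ := by
  have := log_le_logFactor_sub_one (n := n) hδ hδ1 one_pos (by exact_mod_cast h)
  rw [Real.log_one] at this
  linarith

lemma log_mul_sq_div_le_logFactor (hδ : 0 < δ) (hδ1 : δ ≤ 1) (h : 0 < m * d * n * N * T) {t : ℕ}
    (ht : 1 ≤ t) (htT : t ≤ T) : Real.log (n * (t : ℝ) ^ 2 / δ) ≤ 2 * logFactor m d n N T δ := by
  have hmdN : 0 < m * d * N := Nat.pos_of_ne_zero fun h0 => h.ne' <| by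
    rw [show m * d * n * N * T = m * d * N * (n * T) by ring, h0, zero_mul]
  have hn : 0 < n := Nat.pos_of_ne_zero fun h0 => by simp [h0] at h
  have htime : n * t ≤ m * d * n * N * T :=
    calc n * t ≤ n * T := Nat.mul_le_mul_left n htT
      _ ≤ m * d * N * (n * T) := Nat.le_mul_of_pos_left _ hmdN
      _ = m * d * n * N * T := by ring
  have hlog_mul := log_div_le_logFactor_sub_one (x := n * t) hδ (by positivity)
    (by exact_mod_cast htime)
  have hlog := log_le_logFactor_sub_one (x := t) hδ hδ1 (by positivity)
    (by exact_mod_cast (Nat.le_mul_of_pos_left t hn).trans htime)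
  rw [show n * (t : ℝ) ^ 2 / δ = (n * t / δ) * t by ring,
    Real.log_mul (by positivity) (by positivity)]
  linarith

lemma radius_le (hδ : 0 < δ) (hδ1 : δ ≤ 1) (h : 0 < m * d * n * N * T) {t : ℕ}
    (ht : 1 ≤ t) (htT : t ≤ T) :
    radius d n δ t ≤ 256 * d * logFactor m d n N T δ ^ 2 := by
  have hd : 0 < d := Nat.pos_of_ne_zero fun h0 => by simp [h0] at h
  have hn : 0 < n := Nat.pos_of_ne_zero fun h0 => by simp [h0] at h
  have hd' : (1 : ℝ) ≤ d := by exact_mod_cast hd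
  have hn' : (1 : ℝ) ≤ n := by exact_mod_cast hn
  have ht' : (1 : ℝ) ≤ t := by exact_mod_cast ht
  have hΛ := one_le_logFactor hδ hδ1 h
  have htT' : t ≤ m * d * n * N * T := htT.trans <| Nat.le_mul_of_pos_left T <|
    Nat.pos_of_ne_zero fun h0 => by simp [h0] at h
  have hlog : Real.log t ≤ logFactor m d n N T δ := by
    linarith [log_le_logFactor_sub_one (x := t) hδ hδ1 (by positivity) (by exact_mod_cast htT')]
  have hlog_sq := log_mul_sq_div_le_logFactor hδ hδ1 h ht htT
  have hlog_sq0 : 0 ≤ Real.log (n * (t : ℝ) ^ 2 / δ) := by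
    refine Real.log_nonneg ((one_le_div₀ hδ).2 (hδ1.trans ?_))
    exact one_le_mul_of_one_le_of_one_le hn' (one_le_pow₀ ht')
  refine max_le ?_ ?_
  · calc 128 * d * Real.log t * Real.log (n * (t : ℝ) ^ 2 / δ)
        ≤ 128 * d * logFactor m d n N T δ * (2 * logFactor m d n N T δ) := by gcongr
      _ = 256 * d * logFactor m d n N T δ ^ 2 := by ring
  · calc (8 / 3 * Real.log (n * (t : ℝ) ^ 2 / δ)) ^ 2
        ≤ (8 / 3 * (2 * logFactor m d n N T δ)) ^ 2 := by gcongr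
      _ ≤ 256 * 1 * logFactor m d n N T δ ^ 2 := by nlinarith
      _ ≤ 256 * d * logFactor m d n N T δ ^ 2 := by gcongr

/-- The constant in the bound for the slack of the exploration features. -/
def slackConst (b K : ℝ) : ℝ := K * (10 + 4 * (b + 1) ^ 2 * (2 * b + 7))

lemma slackConst_pos {b K : ℝ} (hb : 0 ≤ b) (hK : 0 < K) : 0 < slackConst b K := by
  unfold slackConst
  positivity

lemma spreadSlack_nonneg {k : ℕ} {b K r : ℝ} (hb : 0 ≤ b) (hK : 0 ≤ K) (hk : 0 < k) (hr : 0 < r)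
    (hr1 : r ≤ 1) : 0 ≤ spreadSlack m k b K r := by
  have hk' : (1 : ℝ) ≤ k := by exact_mod_cast hk
  have hlog_k : 0 ≤ Real.log ((2 * b + 3) * k) := Real.log_nonneg (by nlinarith)
  have hlog_r : 0 ≤ Real.log (1 / r) := Real.log_nonneg ((one_le_div₀ hr).2 hr1)
  unfold spreadSlack
  positivity

lemma log_mul_exploreLength_le (hm : 0 < m) (hd : 0 < d) (hn : 0 < n) (hN : 0 < N) (hT : 0 < T)
    (hδ : 0 < δ) (hδ1 : δ ≤ 1) {b : ℝ} (hb : 0 ≤ b) :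
    Real.log ((2 * b + 3) * (n * exploreLength m d N T : ℕ)) ≤
      (2 * b + 4) * logFactor m d n N T δ := by
  have hρ := one_le_exploreRate hm hd hN hT
  have hL : (0 : ℝ) < exploreLength m d N T := by
    linarith [exploreRate_le_exploreLength (m := m) (d := d) (N := N) (T := T)]
  have hΛ := one_le_logFactor (n := n) hδ hδ1 (by positivity : 0 < m * d * n * N * T)
  have hhalf : (n * exploreLength m d N T / 2 : ℝ) ≤ (m : ℝ) * d * n * N * T :=
    calc (n * exploreLength m d N T / 2 : ℝ) ≤ n * (2 * exploreRate m d N T) / 2 := by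
          gcongr
          exact exploreLength_le hρ
      _ = n * exploreRate m d N T := by ring
      _ ≤ n * ((m : ℝ) * d * N * T) := by
          gcongr
          exact exploreRate_le hm hd hN hT
      _ = (m : ℝ) * d * n * N * T := by ring
  have hlog := log_le_logFactor_sub_one hδ hδ1 (by positivity) hhalf
  have hlog_b := Real.log_le_sub_one_of_pos (show 0 < 2 * b + 3 by linarith)
  rw [show (2 * b + 3) * ((n * exploreLength m d N T : ℕ) : ℝ) =
      (2 * b + 3) * (2 * (n * exploreLength m d N T / 2)) by push_cast; ring,
    Real.log_mul (by positivity) (by positivity), Real.log_mul (by norm_num) (by positivity)]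
  nlinarith [Real.log_two_lt_d9]

lemma log_one_div_div_le (hm : 0 < m) (hd : 0 < d) (hn : 0 < n) (hN : 0 < N) (hT : 0 < T)
    (hδ : 0 < δ) (hδ1 : δ ≤ 1) :
    Real.log (1 / (δ / (8 * N))) ≤ 3 * logFactor m d n N T δ := by
  have hΛ := one_le_logFactor (n := n) hδ hδ1 (by positivity : 0 < m * d * n * N * T)
  have hNle : N ≤ m * d * n * N * T := by
    calc N ≤ m * d * n * T * N := Nat.le_mul_of_pos_left N (by positivity)
      _ = m * d * n * N * T := by ring
  have hlog := log_div_le_logFactor_sub_one (x := N) hδ (by positivity) (by exact_mod_cast hNle)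
  rw [show 1 / (δ / (8 * N)) = 2 ^ 3 * (N / δ) by field_simp; norm_num,
    Real.log_mul (by norm_num) (by positivity), Real.log_pow, Nat.cast_ofNat]
  linarith [Real.log_two_lt_d9]

lemma spreadSlack_le {b K : ℝ} (hb : 0 ≤ b) (hK : 0 ≤ K) (hm : 0 < m) (hd : 0 < d) (hn : 0 < n)
    (hN : 0 < N) (hT : 0 < T) (hδ : 0 < δ) (hδ1 : δ ≤ 1) :
    spreadSlack m (n * exploreLength m d N T) b K (δ / (8 * N)) ≤
      slackConst b K * ((m : ℝ) ^ 2 * logFactor m d n N T δ) := by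
  have hm' : (1 : ℝ) ≤ m := by exact_mod_cast hm
  have hΛ := one_le_logFactor (n := n) hδ hδ1 (by positivity : 0 < m * d * n * N * T)
  have hmΛ : (m : ℝ) ≤ (m : ℝ) ^ 2 * logFactor m d n N T δ :=
    (le_self_pow₀ hm' two_ne_zero).trans (le_mul_of_one_le_right (by positivity) hΛ)
  have hlog : m * Real.log ((2 * b + 3) * (n * exploreLength m d N T : ℕ)) +
      Real.log (1 / (δ / (8 * N))) ≤ m * ((2 * b + 7) * logFactor m d n N T δ) :=
    calc _ ≤ m * ((2 * b + 4) * logFactor m d n N T δ) +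
            m * (3 * logFactor m d n N T δ) := by
          gcongr
          · exact log_mul_exploreLength_le hm hd hn hN hT hδ hδ1 hb
          · exact (log_one_div_div_le hm hd hn hN hT hδ hδ1).trans
              (le_mul_of_one_le_left (by linarith) hm')
      _ = m * ((2 * b + 7) * logFactor m d n N T δ) := by ring
  calc spreadSlack m (n * exploreLength m d N T) b K (δ / (8 * N))
      ≤ 10 * ((m : ℝ) ^ 2 * logFactor m d n N T δ) * K +
          4 * ((b + 1) ^ 2 * m * K) * (m * ((2 * b + 7) * logFactor m d n N T δ)) := by
        unfold spreadSlack
        gcongr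
    _ = slackConst b K * ((m : ℝ) ^ 2 * logFactor m d n N T δ) := by
        unfold slackConst
        ring

end Rates

section GoodEvent

variable {Ω : Type*} [MeasurableSpace Ω] {P : Measure Ω}

lemma two_mul_sqrt_le_add_div {z D : ℝ} (hz : 0 ≤ z) (hD : 0 < D) : 2 * √z ≤ D + z / D := by
  have h : D + z / D - 2 * √z = (D - √z) ^ 2 / D := by
    field_simp
    rw [sub_sq, Real.sq_sqrt hz]
    ring
  rw [← sub_nonneg, h]
  positivity

lemma integral_cond_le_two_mul {R : Ω → ℝ} {G : Set Ω} {B : ℝ}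
    (hR0 : ∀ ω, 0 ≤ R ω) (hG : 1 / 2 ≤ P.real G) (hR : ∫ ω in G, R ω ∂P ≤ B) :
    ∫ ω, R ω ∂(P[|G]) ≤ 2 * B := by
  have hcond : ∫ ω, R ω ∂(P[|G]) = (P.real G)⁻¹ * ∫ ω in G, R ω ∂P := by
    rw [ProbabilityTheory.cond, integral_smul_measure, ENNReal.toReal_inv, smul_eq_mul,
      Measure.real]
  have hinv : (P.real G)⁻¹ ≤ 2 := inv_le_of_inv_le₀ two_pos (by simpa using hG)
  rw [hcond]
  exact mul_le_mul hinv hR (integral_nonneg hR0) two_pos.le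

lemma measureReal_lt_inter_le {Z : Ω → ℝ} (hZ : Measurable Z) {G : Set Ω} {B z : ℝ} (hB : 0 ≤ B)
    (hz : 0 < z) (hZG : ∫⁻ ω in G, ENNReal.ofReal (Z ω) ∂P ≤ ENNReal.ofReal B) :
    P.real ({ω | z ≤ Z ω} ∩ G) ≤ B / z := by
  have hset : {ω | z ≤ Z ω} ⊆ {ω | ENNReal.ofReal z ≤ ENNReal.ofReal (Z ω)} :=
    fun _ h => ENNReal.ofReal_le_ofReal h
  refine ENNReal.toReal_le_of_le_ofReal (by positivity) ?_
  calc P ({ω | z ≤ Z ω} ∩ G) = P.restrict G {ω | z ≤ Z ω} :=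
        (Measure.restrict_apply (measurableSet_le measurable_const hZ)).symm
    _ ≤ P.restrict G {ω | ENNReal.ofReal z ≤ ENNReal.ofReal (Z ω)} := measure_mono hset
    _ ≤ (∫⁻ ω in G, ENNReal.ofReal (Z ω) ∂P) / ENNReal.ofReal z :=
        meas_ge_le_lintegral_div hZ.ennreal_ofReal.aemeasurable
          (by simpa using hz) ENNReal.ofReal_ne_top
    _ ≤ ENNReal.ofReal (B / z) := by
        rw [ENNReal.ofReal_div_of_pos hz]
        gcongr

variable [IsProbabilityMeasure P] {R Z : Ω → ℝ} {G : Set Ω} {A D δ : ℝ}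

lemma setIntegral_le_of_le_add_sqrt (hRint : Integrable R P) (hZm : Measurable Z)
    (hZ0 : ∀ ω, 0 ≤ Z ω) (hG : MeasurableSet G) (hA : 0 ≤ A) (hD : 0 < D)
    (hZ : ∫⁻ ω in G, ENNReal.ofReal (Z ω) ∂P ≤ ENNReal.ofReal (D ^ 2))
    (hR : ∀ᵐ ω ∂P, ω ∈ G → R ω ≤ A + 2 * √(Z ω)) : ∫ ω in G, R ω ∂P ≤ A + 2 * D := by
  have hZint : IntegrableOn Z G P := by
    refine ⟨hZm.aestronglyMeasurable, ?_⟩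
    rw [hasFiniteIntegral_iff_ofReal (Filter.Eventually.of_forall hZ0)]
    exact hZ.trans_lt ENNReal.ofReal_lt_top
  have hZle : ∫ ω in G, Z ω ∂P ≤ D ^ 2 := by
    rw [integral_eq_lintegral_of_nonneg_ae (Filter.Eventually.of_forall hZ0)
      hZm.aestronglyMeasurable]
    exact ENNReal.toReal_le_of_le_ofReal (by positivity) hZ
  calc ∫ ω in G, R ω ∂P ≤ ∫ ω in G, (A + D + Z ω / D) ∂P := by
        refine integral_mono_ae hRint.integrableOn
          ((integrable_const _).add (hZint.div_const _)) ?_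
        filter_upwards [ae_restrict_of_ae hR, ae_restrict_mem hG] with ω h hω
        linarith [h hω, two_mul_sqrt_le_add_div (hZ0 ω) hD]
    _ = (A + D) * P.real G + (∫ ω in G, Z ω ∂P) / D := by
        rw [integral_add (integrable_const _) (hZint.div_const _), integral_div,
          setIntegral_const, smul_eq_mul, mul_comm]
    _ ≤ (A + D) * 1 + D ^ 2 / D := by
        gcongr
        exact measureReal_le_one
    _ = A + 2 * D := by
        field_simp
        ring

lemma le_measureReal_le_div_sqrt (hZm : Measurable Z) (hδ : 0 < δ) (hδ1 : δ ≤ 1)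
    (hG : P.real Gᶜ ≤ δ / 4) (hA : 0 ≤ A) (hD : 0 < D)
    (hZ : ∫⁻ ω in G, ENNReal.ofReal (Z ω) ∂P ≤ ENNReal.ofReal (D ^ 2))
    (hR : ∀ᵐ ω ∂P, ω ∈ G → R ω ≤ A + 2 * √(Z ω)) :
    1 - δ ≤ P.real {ω | R ω ≤ (A + 3 * D) / √δ} := by
  have htail : P.real ({ω | 2 * D ^ 2 / δ ≤ Z ω} ∩ G) ≤ δ / 2 :=
    (measureReal_lt_inter_le hZm (by positivity) (by positivity) hZ).trans_eq (by field_simp)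
  have hsub : {ω | R ω ≤ (A + 3 * D) / √δ}ᶜ ≤ᵐ[P]
      (Gᶜ ∪ ({ω | 2 * D ^ 2 / δ ≤ Z ω} ∩ G) : Set Ω) := by
    filter_upwards [hR] with ω hω hnot
    by_contra hmem
    obtain ⟨hωG, hωZ⟩ : ω ∈ G ∧ Z ω < 2 * D ^ 2 / δ := by
      by_contra hcontra
      apply hmem
      by_cases h : ω ∈ G
      · exact Or.inr ⟨not_lt.1 fun hlt => hcontra ⟨h, hlt⟩, h⟩
      · exact Or.inl h
    have hsqrt : √(Z ω) ≤ 3 / 2 * D / √δ := by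
      refine Real.sqrt_le_iff.2 ⟨by positivity, hωZ.le.trans ?_⟩
      rw [div_pow, Real.sq_sqrt hδ.le]
      gcongr
      nlinarith [sq_nonneg D]
    refine hnot ?_
    calc R ω ≤ A + 2 * √(Z ω) := hω hωG
      _ ≤ A / √δ + 2 * (3 / 2 * D / √δ) := by
          gcongr
          exact le_div_self hA (Real.sqrt_pos.2 hδ) (Real.sqrt_le_one.2 hδ1)
      _ = (A + 3 * D) / √δ := by ring
  have hcompl : P.real {ω | R ω ≤ (A + 3 * D) / √δ}ᶜ ≤ δ / 4 + δ / 2 :=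
    calc _ ≤ P.real (Gᶜ ∪ ({ω | 2 * D ^ 2 / δ ≤ Z ω} ∩ G)) :=
          ENNReal.toReal_mono (measure_ne_top _ _) (measure_mono_ae hsub)
      _ ≤ P.real Gᶜ + P.real ({ω | 2 * D ^ 2 / δ ≤ Z ω} ∩ G) := measureReal_union_le _ _
      _ ≤ δ / 4 + δ / 2 := add_le_add hG htail
  have hunion := measureReal_union_le (μ := P) {ω | R ω ≤ (A + 3 * D) / √δ}
    {ω | R ω ≤ (A + 3 * D) / √δ}ᶜ
  rw [Set.union_compl_self, probReal_univ] at hunion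
  linarith

end GoodEvent

section Budget

variable {m d n N T : ℕ} {δ K : ℝ}

lemma card_exploration_add_le (t₀ : ℕ) (hρ : 1 ≤ exploreRate m d N T) :
    (n : ℝ) * (exploreLength m d N T + t₀ : ℕ) ≤ (2 + t₀) * rate m d n N T := by
  have hround := exploreLength_le hρ
  have ht₀ : (t₀ : ℝ) ≤ t₀ * exploreRate m d N T := le_mul_of_one_le_right t₀.cast_nonneg hρ
  calc (n : ℝ) * (exploreLength m d N T + t₀ : ℕ)
      ≤ n * ((2 + t₀) * exploreRate m d N T) := by
        push_cast
        gcongr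
        linarith
    _ = (2 + t₀) * rate m d n N T := by
        rw [rate_eq_mul_exploreRate]
        ring

lemma two_mul_sqrt_add_le {a Λ : ℝ} (ha : 1 ≤ a) (hΛ : 1 ≤ Λ) (hK : 0 ≤ K) :
    2 * √(256 * a * Λ ^ 2) + 2 * K ≤ (32 + 2 * K) * (√a * Λ) := by
  have hsqrt : √(256 * a * Λ ^ 2) = 16 * (√a * Λ) := by
    rw [show 256 * a * Λ ^ 2 = (16 * Λ) ^ 2 * a by ring, Real.sqrt_mul (by positivity),
      Real.sqrt_sq (by positivity)]
    ring
  have hone : 2 * K ≤ 2 * K * (√a * Λ) :=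
    le_mul_of_one_le_right (by positivity)
      (one_le_mul_of_one_le_of_one_le (Real.one_le_sqrt.2 ha) hΛ)
  rw [hsqrt]
  linarith

lemma log_add_one_le_logFactor (hδ : 0 < δ) (hδ1 : δ ≤ 1) (h : 0 < m * d * n * N * T) :
    Real.log (T + 1) ≤ logFactor m d n N T δ := by
  have hT : 0 < T := Nat.pos_of_mul_pos_left h
  have hT' : (1 : ℝ) ≤ T := by exact_mod_cast hT
  have hle : T ≤ m * d * n * N * T := Nat.le_mul_of_pos_left T (Nat.pos_of_mul_pos_right h)
  have hlog := log_le_logFactor_sub_one (x := T) hδ hδ1 (by positivity) (by exact_mod_cast hle)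
  have hdouble : Real.log (T + 1) ≤ Real.log (2 * T) :=
    Real.log_le_log (by positivity) (by linarith)
  rw [Real.log_mul (by norm_num) (by positivity)] at hdouble
  linarith [Real.log_two_lt_d9]

lemma sqrt_potential_le (hδ : 0 < δ) (hδ1 : δ ≤ 1) (h : 0 < m * d * n * N * T) :
    √(T * (2 * (d * Real.log (T + 1)))) ≤ 2 * √T * √d * logFactor m d n N T δ := by
  have hΛ := one_le_logFactor hδ hδ1 h
  have hlog := log_add_one_le_logFactor hδ hδ1 h
  refine Real.sqrt_le_iff.2 ⟨by positivity, ?_⟩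
  calc (T : ℝ) * (2 * (d * Real.log (T + 1)))
      ≤ T * (2 * (d * logFactor m d n N T δ)) := by gcongr
    _ = (T * d) * (2 * logFactor m d n N T δ) := by ring
    _ ≤ (T * d) * (4 * logFactor m d n N T δ ^ 2) :=
        mul_le_mul_of_nonneg_left (by nlinarith) (by positivity)
    _ = (2 * √T * √d * logFactor m d n N T δ) ^ 2 := by
        rw [mul_pow, mul_pow, mul_pow, Real.sq_sqrt (by positivity), Real.sq_sqrt (by positivity)]
        ring

lemma width_mul_sqrt_potential_le (hK : 0 ≤ K) (hm : 0 < m) (hd : 0 < d) (hn : 0 < n)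
    (hdN : d ≤ N) (hT : 0 < T) (hδ : 0 < δ) (hδ1 : δ ≤ 1) :
    (2 * √(256 * d * logFactor m d n N T δ ^ 2) + 2 * K) *
        (n * √(T * (2 * (d * Real.log (T + 1))))) ≤
      (64 + 4 * K) * (logFactor m d n N T δ ^ 2 * rate m d n N T) := by
  have hpos : 0 < m * d * n * N * T := by
    have := hd.trans_le hdN
    positivity
  have hΛ := one_le_logFactor hδ hδ1 hpos
  have hd' : (1 : ℝ) ≤ d := by exact_mod_cast hd
  calc _ ≤ (32 + 2 * K) * (√d * logFactor m d n N T δ) *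
          (n * (2 * √T * √d * logFactor m d n N T δ)) := by
        gcongr
        · exact two_mul_sqrt_add_le hd' hΛ hK
        · exact sqrt_potential_le hδ hδ1 hpos
    _ = (64 + 4 * K) * (logFactor m d n N T δ ^ 2 * (n * (√d ^ 2 * √T))) := by ring
    _ = (64 + 4 * K) * (logFactor m d n N T δ ^ 2 * (n * (d * √T))) := by
        rw [Real.sq_sqrt (by positivity)]
    _ ≤ (64 + 4 * K) * (logFactor m d n N T δ ^ 2 * rate m d n N T) := by
        rw [rate_eq_mul_exploreRate]
        gcongr
        exact dim_mul_sqrt_le_exploreRate hm hd hT hdN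

/-- The constant in the bound for the regret that is not due to the prediction error, where the
expected costs are at most `K` and the first `t₀` rounds after the exploration are given up. -/
def banditConst (K : ℝ) (t₀ : ℕ) : ℝ := 2 * K * (2 + t₀) + (64 + 4 * K)

lemma exploration_add_bandit_le (hK : 0 ≤ K) (t₀ : ℕ) (hm : 0 < m) (hd : 0 < d) (hn : 0 < n)
    (hdN : d ≤ N) (hT : 0 < T) (hδ : 0 < δ) (hδ1 : δ ≤ 1) :
    n * (exploreLength m d N T + t₀ : ℕ) * (2 * K) +
        (2 * √(256 * d * logFactor m d n N T δ ^ 2) + 2 * K) *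
          (n * √(T * (2 * (d * Real.log (T + 1))))) ≤
      banditConst K t₀ * (logFactor m d n N T δ ^ 2 * rate m d n N T) := by
  have hN := hd.trans_le hdN
  have hρ := one_le_exploreRate hm hd hN hT
  have hΛ := one_le_logFactor (n := n) hδ hδ1 (by positivity : 0 < m * d * n * N * T)
  have hrate : 0 ≤ rate m d n N T := by
    unfold rate
    positivity
  have hexplore : n * (exploreLength m d N T + t₀ : ℕ) * (2 * K) ≤
      2 * K * (2 + t₀) * (logFactor m d n N T δ ^ 2 * rate m d n N T) :=
    calc n * (exploreLength m d N T + t₀ : ℕ) * (2 * K)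
        ≤ (2 + t₀) * rate m d n N T * (2 * K) :=
          mul_le_mul_of_nonneg_right (card_exploration_add_le t₀ hρ) (by positivity)
      _ = 2 * K * (2 + t₀) * (1 * rate m d n N T) := by ring
      _ ≤ _ := by
          gcongr
          exact one_le_pow₀ hΛ
  rw [banditConst, add_mul (2 * K * (2 + (t₀ : ℝ)))]
  exact add_le_add hexplore (width_mul_sqrt_potential_le hK hm hd hn hdN hT hδ hδ1)

lemma div_two_mul_le_cast_div (hN : 0 < N) (hNn : N ≤ n) : (n : ℝ) / (2 * N) ≤ (n / N : ℕ) := by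
  rw [div_le_iff₀ (by positivity)]
  have hlt : n < N * (n / N + 1) := Nat.lt_mul_div_succ n hN
  have hone : 1 ≤ n / N := Nat.div_pos hNn hN
  have hle : n ≤ (n / N) * (2 * N) := by nlinarith
  exact_mod_cast hle

/-- The constant in the bound for the regret that is due to the prediction error. -/
def predictionConst (B C : ℝ) : ℝ := √(2 * (8 * B + C))

lemma prediction_bound_le {B c C Λ : ℝ} (hB : 0 ≤ B) (hC : 0 ≤ C) (hm : 0 < m) (hd : 0 < d)
    (hN : 0 < N) (hNn : N ≤ n) (hT : 0 < T) (hΛ : 1 ≤ Λ) (hc : c ≤ C * ((m : ℝ) ^ 2 * Λ)) :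
    (n : ℝ) * T * (T * (n * (N * ((8 * (B * ((m : ℝ) * d) ^ 2) + d * c) /
      (exploreLength m d N T * (n / N : ℕ)))))) ≤
      (predictionConst B C * (Λ * rate m d n N T)) ^ 2 := by
  have hn := hN.trans_le hNn
  have hd' : (1 : ℝ) ≤ d := by exact_mod_cast hd
  have hρ := one_le_exploreRate hm hd hN hT
  have hdiv := div_two_mul_le_cast_div hN hNn
  have hround : exploreRate m d N T ≤ exploreLength m d N T := exploreRate_le_exploreLength
  have hnum : 8 * (B * ((m : ℝ) * d) ^ 2) + d * c ≤ (8 * B + C) * (((m : ℝ) * d) ^ 2 * Λ) :=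
    calc 8 * (B * ((m : ℝ) * d) ^ 2) + d * c
        ≤ 8 * (B * (((m : ℝ) * d) ^ 2 * Λ)) + d * (C * ((m : ℝ) ^ 2 * Λ)) := by
          gcongr
          exact le_mul_of_one_le_right (by positivity) hΛ
      _ ≤ 8 * (B * (((m : ℝ) * d) ^ 2 * Λ)) + d ^ 2 * (C * ((m : ℝ) ^ 2 * Λ)) := by
          gcongr
          exact le_self_pow₀ hd' two_ne_zero
      _ = (8 * B + C) * (((m : ℝ) * d) ^ 2 * Λ) := by ring
  calc _ ≤ (n : ℝ) * T * (T * (n * (N * ((8 * B + C) * (((m : ℝ) * d) ^ 2 * Λ) /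
        (exploreRate m d N T * (n / (2 * N))))))) := by gcongr
    _ = 2 * (8 * B + C) * Λ * n * N *
          (((T : ℝ) ^ 2 * N * ((m : ℝ) * d) ^ 2) / exploreRate m d N T) := by
        field_simp
    _ = 2 * (8 * B + C) * Λ * n * N * exploreRate m d N T ^ 2 := by
        rw [← exploreRate_pow_three]
        field_simp
    _ ≤ 2 * (8 * B + C) * Λ ^ 2 * n * n * exploreRate m d N T ^ 2 := by
        gcongr
        exact le_self_pow₀ hΛ two_ne_zero
    _ = (predictionConst B C * (Λ * rate m d n N T)) ^ 2 := by
        rw [predictionConst, mul_pow, Real.sq_sqrt (by positivity), rate_eq_mul_exploreRate]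
        ring

end Budget

section Assembly

lemma dim_le_card {d N : ℕ} {W : Fin N → Fin d → ℝ}
    (hspan : Submodule.span ℝ (Set.range W) = ⊤) : d ≤ N := by
  have hle := finrank_range_le_card (R := ℝ) W
  rw [Set.finrank, hspan, finrank_top] at hle
  simpa using hle

/-- The setting of the theorem: the conditions on the environment and on the procedure. -/
structure Setting {m d n N : ℕ} (M : Model m d n N) (Q : Procedure m d N) (T : ℕ)
    (K_X K_F K_C K_μ : ℝ) (K_σ : ℝ≥0) : Prop where
  m_pos : 0 < m
  d_pos : 0 < d
  T_pos : 0 < T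
  card_le : N ≤ n
  norm_le (j : Fin N) : M.W j ⬝ᵥ M.W j ≤ 1
  span_eq_top : Submodule.span ℝ (Set.range M.W) = ⊤
  feature_le : ∀ᵐ x ∂M.Dx, x ⬝ᵥ x ≤ K_X ^ 2 ∧ ∀ j, ∑ k, |(M.F j *ᵥ x) k| ≤ K_C
  boundedEntries (j : Fin N) : BoundedEntries K_F (M.F j)
  abs_bandit_le (j : Fin N) : |M.μ ⬝ᵥ M.W j| ≤ K_μ
  noise_le : M.σ ≤ K_σ
  spanner : IsBarycentricSpanner Q.b (Set.range M.W)
  boundedLearner (D : List (Point m d)) : BoundedEntries K_F (Q.L D)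
  measurableLearner : MeasurableLearner Q.L
  measurable_sel : Measurable Q.sel
  sel_le (v : Fin N → ℝ) (j : Fin N) : v (Q.sel v) ≤ v j
  explore_eq : Q.explore = exploreLength m d N T
  last_mem (t : ℕ) (ht : Q.explore < t) : Q.explore ≤ Q.last t ∧ Q.last t < t
  γ_pos : 0 < Q.γ
  γ_lt_one : Q.γ < 1

/-- The randomness for which the bandit estimates stay in their confidence balls and the explored
features cover the feature distribution. The bound `K_X ^ 2 + 1` on the squared norms of the
features is chosen positive. -/
def goodEvent {m d n N : ℕ} (M : Model m d n N) (Q : Procedure m d N) (T : ℕ) (K_X K_F : ℝ)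
    (K_σ : ℝ≥0) : Set (Randomness m d n) :=
  {ζ | ConfidenceEvent M Q (1 + (K_σ : ℝ) ^ 2) Q.γ Q.explore T ζ ∧
    ExploreEvent M Q (2 * K_F)
      (spreadSlack m (n * Q.explore) (2 * K_F) (K_X ^ 2 + 1) (Q.γ / (8 * N))) ζ}

/-- The number of rounds after the exploration until `log t` exceeds the threshold from which on
the radius of the confidence ball dominates the deviation of the bandit estimates. -/
def burnIn (K_μ : ℝ) (K_σ : ℝ≥0) : ℕ := ⌈Real.exp (2 + (K_σ : ℝ) ^ 2 + K_μ ^ 2)⌉₊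

/-- The constant `C` of the theorem. -/
def regretConst (K_X K_F K_C K_μ K_E : ℝ) (K_σ : ℝ≥0) : ℝ :=
  2 * (banditConst (K_C + K_μ) (burnIn K_μ K_σ) +
    2 * predictionConst |K_E| (slackConst (2 * K_F) (K_X ^ 2 + 1)))

namespace Setting

variable {m d n N T : ℕ} {M : Model m d n N} {Q : Procedure m d N} {K_X K_F K_C K_μ K_E : ℝ}
  {K_σ : ℝ≥0} (h : Setting M Q T K_X K_F K_C K_μ K_σ)

include h

lemma N_pos : 0 < N := h.d_pos.trans_le (dim_le_card h.span_eq_top)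

lemma n_pos : 0 < n := h.N_pos.trans_le h.card_le

lemma isCausal : Q.IsCausal := fun t ht => (h.last_mem t ht).2

lemma posDef_spanner : (∑ k, Matrix.vecMulVec (Q.b k) (Q.b k)).PosDef :=
  posDef_spanner_gram h.span_eq_top h.spanner

lemma measurable_action (t : ℕ) (i : Fin n) :
    Measurable fun ζ : Randomness m d n => run M Q ζ t i :=
  have : NeZero N := ⟨h.N_pos.ne'⟩
  measurable_run h.isCausal h.posDef_spanner h.measurableLearner h.measurable_sel t i

lemma K_F_nonneg : 0 ≤ K_F :=
  (abs_nonneg _).trans (h.boundedEntries ⟨0, h.N_pos⟩ ⟨0, h.d_pos⟩ ⟨0, h.m_pos⟩)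

lemma K_μ_nonneg : 0 ≤ K_μ := (abs_nonneg _).trans (h.abs_bandit_le ⟨0, h.N_pos⟩)

lemma K_C_nonneg [IsProbabilityMeasure M.Dx] : 0 ≤ K_C := by
  obtain ⟨x, hx⟩ := h.feature_le.exists
  exact (Finset.sum_nonneg fun k _ => abs_nonneg _).trans (hx.2 ⟨0, h.N_pos⟩)

lemma explore_pos : 0 < Q.explore := by
  have : (1 : ℝ) ≤ Q.explore := by
    rw [h.explore_eq]
    exact (one_le_exploreRate h.m_pos h.d_pos h.N_pos h.T_pos).trans exploreRate_le_exploreLength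
  exact_mod_cast this

lemma rate_pos : 0 < rate m d n N T := by
  have := h.m_pos
  have := h.d_pos
  have := h.T_pos
  have := h.N_pos
  have := h.n_pos
  unfold rate
  positivity

lemma size_pos : 0 < m * d * n * N * T := by
  have := h.m_pos
  have := h.d_pos
  have := h.T_pos
  have := h.N_pos
  have := h.n_pos
  positivity

lemma one_le_logFactor : 1 ≤ logFactor m d n N T Q.γ :=
  BanditDDO.one_le_logFactor h.γ_pos h.γ_lt_one.le h.size_pos

lemma ae_dotProduct_self_le : ∀ᵐ x ∂M.Dx, x ⬝ᵥ x ≤ K_X ^ 2 + 1 :=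
  h.feature_le.mono fun x hx => by linarith [hx.1]

lemma confidence_div_pos : 0 < Q.γ / (8 * N) :=
  div_pos h.γ_pos (by have := h.N_pos; positivity)

lemma slack_nonneg :
    0 ≤ spreadSlack m (n * Q.explore) (2 * K_F) (K_X ^ 2 + 1) (Q.γ / (8 * N)) := by
  have hF := h.K_F_nonneg
  have hN : (1 : ℝ) ≤ N := by exact_mod_cast h.N_pos
  refine spreadSlack_nonneg (by positivity) (by positivity) (Nat.mul_pos h.n_pos h.explore_pos)
    h.confidence_div_pos ?_
  rw [div_le_one (by positivity)]
  linarith [h.γ_lt_one]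

lemma slackConst_pos : 0 < slackConst (2 * K_F) (K_X ^ 2 + 1) :=
  BanditDDO.slackConst_pos (mul_nonneg two_pos.le h.K_F_nonneg) (by positivity)

lemma predictionConst_pos : 0 < predictionConst |K_E| (slackConst (2 * K_F) (K_X ^ 2 + 1)) :=
  Real.sqrt_pos.2 (by have := h.slackConst_pos; positivity)

lemma banditConst_nonneg [IsProbabilityMeasure M.Dx] (t₀ : ℕ) : 0 ≤ banditConst (K_C + K_μ) t₀ := by
  have := h.K_C_nonneg
  have := h.K_μ_nonneg
  unfold banditConst
  positivity

lemma banditPart_nonneg [IsProbabilityMeasure M.Dx] :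
    0 ≤ banditConst (K_C + K_μ) (burnIn K_μ K_σ) *
      (logFactor m d n N T Q.γ ^ 2 * rate m d n N T) :=
  mul_nonneg (h.banditConst_nonneg _) (mul_nonneg (sq_nonneg _) h.rate_pos.le)

lemma predictionPart_pos :
    0 < predictionConst |K_E| (slackConst (2 * K_F) (K_X ^ 2 + 1)) *
      (logFactor m d n N T Q.γ * rate m d n N T) :=
  mul_pos h.predictionConst_pos (mul_pos (one_pos.trans_le h.one_le_logFactor) h.rate_pos)

lemma two_mul_parts_le (K_E : ℝ) :
    2 * (banditConst (K_C + K_μ) (burnIn K_μ K_σ) *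
        (logFactor m d n N T Q.γ ^ 2 * rate m d n N T) +
      2 * (predictionConst |K_E| (slackConst (2 * K_F) (K_X ^ 2 + 1)) *
        (logFactor m d n N T Q.γ * rate m d n N T))) ≤
      regretConst K_X K_F K_C K_μ K_E K_σ * logFactor m d n N T Q.γ ^ 2 * rate m d n N T := by
  have hΛ := mul_le_mul_of_nonneg_right (le_self_pow₀ h.one_le_logFactor two_ne_zero) h.rate_pos.le
  have hprod := mul_le_mul_of_nonneg_left hΛ (h.predictionConst_pos (K_E := K_E)).le
  unfold regretConst
  linarith

lemma measurableSet_goodEvent : MeasurableSet (goodEvent M Q T K_X K_F K_σ) :=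
  have : NeZero N := ⟨h.N_pos.ne'⟩
  (measurableSet_confidenceEvent h.measurable_action _ _ _ _).inter
    (measurableSet_exploreEvent _ _)

lemma mem_confidenceBall {ζ : Randomness m d n} (hζ : ζ ∈ goodEvent M Q T K_X K_F K_σ) {t : ℕ}
    (ht : t ∈ Finset.Ioc (Q.explore + burnIn K_μ K_σ) T) (i : Fin n) :
    M.μ ∈ confidenceBall M Q ζ (run M Q ζ) t i := by
  obtain ⟨hlt, htT⟩ := Finset.mem_Ioc.1 ht
  refine mem_confidenceBall_of_expProcess_lt h.posDef_spanner h.spanner (by positivity) h.d_pos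
    h.γ_pos h.γ_lt_one.le h.abs_bandit_le (hζ.1 t (Finset.mem_Ioc.2 ⟨by omega, htT⟩) i) ?_
  have hexp : Real.exp (2 + (K_σ : ℝ) ^ 2 + K_μ ^ 2) ≤ t := by
    have hle : burnIn K_μ K_σ ≤ t := by omega
    exact Nat.ceil_le.1 hle
  linarith [(Real.le_log_iff_exp_le ((Real.exp_pos _).trans_le hexp)).2 hexp]

lemma regret_le_of_mem_goodEvent [IsProbabilityMeasure M.Dx] {ζ : Randomness m d n}
    (hζ : ζ ∈ goodEvent M Q T K_X K_F K_σ)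
    (hcost : ∀ t i j, |expectedCost M j (feature ζ t i)| ≤ K_C + K_μ) :
    regret M Q ζ T ≤ banditConst (K_C + K_μ) (burnIn K_μ K_σ) *
      (logFactor m d n N T Q.γ ^ 2 * rate m d n N T) + 2 * √(n * T * totalPredErr M Q T ζ) := by
  have hK : 0 ≤ K_C + K_μ := add_nonneg h.K_C_nonneg h.K_μ_nonneg
  have hregret := regret_le h.posDef_spanner h.spanner h.isCausal h.sel_le h.norm_le hK
    (Nat.le_add_right Q.explore (burnIn K_μ K_σ)) hcost
    (fun t ht => radius_le h.γ_pos h.γ_lt_one.le h.size_pos (by have := Finset.mem_Ioc.1 ht; omega)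
      (Finset.mem_Ioc.1 ht).2)
    (fun t ht i => h.mem_confidenceBall hζ ht i)
  have hbound := exploration_add_bandit_le hK (burnIn K_μ K_σ) h.m_pos h.d_pos h.n_pos
    (dim_le_card h.span_eq_top) h.T_pos h.γ_pos h.γ_lt_one.le
  rw [← h.explore_eq] at hbound
  linarith

variable {Ω : Type*} [MeasurableSpace Ω] {P : Measure Ω} {ξ : ℕ → Fin n → Ω → Point m d × ℝ}
  (hξ : IsSample M P ξ)

include hξ

lemma ae_abs_expectedCost_le :
    ∀ᵐ ω ∂P, ∀ t i j,
      |expectedCost M j (feature (fun t i => ξ t i ω) t i)| ≤ K_C + K_μ := by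
  have hx : ∀ᵐ x ∂M.Dx, ∀ j, |expectedCost M j x| ≤ K_C + K_μ :=
    h.feature_le.mono fun x hx j => abs_expectedCost_le (h.norm_le j) (h.abs_bandit_le j) (hx.2 j)
  refine ae_all_iff.2 fun t => ae_all_iff.2 fun i => ?_
  rw [← hξ.map_feature_eq t i] at hx
  exact ae_of_ae_map (hξ.measurable t i).fst.fst.aemeasurable hx

lemma integrable_regret [IsFiniteMeasure P] :
    Integrable (fun ω => regret M Q (fun t i => ξ t i ω) T) P := by
  have : NeZero N := ⟨h.N_pos.ne'⟩
  refine Integrable.of_bound ((measurable_regret h.measurable_action T).comp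
    hξ.measurable_randomness).aestronglyMeasurable
    (∑ _t ∈ Finset.Icc 1 T, ∑ _i : Fin n, 2 * (K_C + K_μ)) ?_
  filter_upwards [h.ae_abs_expectedCost_le hξ] with ω hω
  rw [Real.norm_eq_abs, abs_of_nonneg (regret_nonneg _ _)]
  exact Finset.sum_le_sum fun t _ => Finset.sum_le_sum fun i _ =>
    expectedCost_sub_optimalCost_le (hω t i) _

lemma measurableSet_preimage_goodEvent :
    MeasurableSet {ω | (fun t i => ξ t i ω) ∈ goodEvent M Q T K_X K_F K_σ} :=
  hξ.measurable_randomness h.measurableSet_goodEvent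

lemma ae_regret_le [IsProbabilityMeasure M.Dx] :
    ∀ᵐ ω ∂P, ω ∈ {ω | (fun t i => ξ t i ω) ∈ goodEvent M Q T K_X K_F K_σ} →
      regret M Q (fun t i => ξ t i ω) T ≤ banditConst (K_C + K_μ) (burnIn K_μ K_σ) *
        (logFactor m d n N T Q.γ ^ 2 * rate m d n N T) +
          2 * √(n * T * totalPredErr M Q T fun t i => ξ t i ω) :=
  (h.ae_abs_expectedCost_le hξ).mono fun _ hω hG => h.regret_le_of_mem_goodEvent hG hω

variable [IsProbabilityMeasure M.Dx] [IsProbabilityMeasure P]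

lemma measureReal_goodEvent_compl_le :
    P.real {ω | (fun t i => ξ t i ω) ∈ goodEvent M Q T K_X K_F K_σ}ᶜ ≤ Q.γ / 4 := by
  have : NeZero N := ⟨h.N_pos.ne'⟩
  have hN : (0 : ℝ) < N := by exact_mod_cast h.N_pos
  have hs : M.σ ^ 2 ≤ 1 + K_σ ^ 2 :=
    (pow_le_pow_left₀ zero_le h.noise_le 2).trans le_add_self
  have hconf := measureReal_not_confidenceEvent_le hξ h.isCausal h.posDef_spanner
    h.measurable_action (by positivity) hs h.γ_pos Q.explore T
  have hexpl := measureReal_not_exploreEvent_le (Q := Q) hξ (by positivity) h.ae_dotProduct_self_le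
    (mul_nonneg two_pos.le h.K_F_nonneg) h.m_pos h.card_le h.explore_pos h.confidence_div_pos
  push_cast at hconf
  calc _ = P.real ({ω | ¬ ConfidenceEvent M Q (1 + (K_σ : ℝ) ^ 2) Q.γ Q.explore T
          fun t i => ξ t i ω} ∪ {ω | ¬ ExploreEvent M Q (2 * K_F) (spreadSlack m (n * Q.explore)
            (2 * K_F) (K_X ^ 2 + 1) (Q.γ / (8 * N))) fun t i => ξ t i ω}) := by
        congr 1
        exact Set.ext fun ω => not_and_or
    _ ≤ Q.γ / 8 + N * (Q.γ / (8 * N)) :=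
        (measureReal_union_le _ _).trans (add_le_add hconf hexpl)
    _ = Q.γ / 4 := by
        field_simp
        ring

lemma le_measureReal_goodEvent :
    1 - Q.γ ≤ P.real {ω | (fun t i => ξ t i ω) ∈ goodEvent M Q T K_X K_F K_σ} := by
  have hcompl := h.measureReal_goodEvent_compl_le hξ
  rw [probReal_compl_eq_one_sub (h.measurableSet_preimage_goodEvent hξ)] at hcompl
  linarith [h.γ_pos]

omit [IsProbabilityMeasure M.Dx] in
lemma constantERAlongRun
    (hER : ((∀ t, Q.explore < t → Q.last t = Q.explore) ∧
        ∀ j, ConstantER Q.L M.Dx M.σ (M.F j) (K_E * ((m : ℝ) * d) ^ 2)) ∨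
      ConstantERAlongRun M Q P ξ T (K_E * ((m : ℝ) * d) ^ 2)) :
    ConstantERAlongRun M Q P ξ T (|K_E| * ((m : ℝ) * d) ^ 2) := by
  have hrun : ConstantERAlongRun M Q P ξ T (K_E * ((m : ℝ) * d) ^ 2) := by
    rcases hER with ⟨honce, hER⟩ | hER
    · exact constantERAlongRun_of_constantER hξ h.measurableLearner h.isCausal honce hER T
    · exact hER
  intro t ht htT j
  refine (hrun t ht htT j).trans (ENNReal.ofReal_le_ofReal ?_)
  gcongr
  exact le_abs_self K_E

variable (hER : ConstantERAlongRun M Q P ξ T (|K_E| * ((m : ℝ) * d) ^ 2))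

include hER

lemma setLIntegral_goodEvent_le :
    ∫⁻ ω in {ω | (fun t i => ξ t i ω) ∈ goodEvent M Q T K_X K_F K_σ},
        ENNReal.ofReal (n * T * totalPredErr M Q T fun t i => ξ t i ω) ∂P ≤
      ENNReal.ofReal ((predictionConst |K_E| (slackConst (2 * K_F) (K_X ^ 2 + 1)) *
        (logFactor m d n N T Q.γ * rate m d n N T)) ^ 2) := by
  have : NeZero N := ⟨h.N_pos.ne'⟩
  have hκ : 0 < (Q.explore : ℝ) * (n / N : ℕ) := by
    exact_mod_cast Nat.mul_pos h.explore_pos (Nat.div_pos h.card_le h.N_pos)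
  have hslack := spreadSlack_le (mul_nonneg two_pos.le h.K_F_nonneg)
    (by positivity : 0 ≤ K_X ^ 2 + 1) h.m_pos h.d_pos h.n_pos h.N_pos h.T_pos h.γ_pos h.γ_lt_one.le
  have hbound := prediction_bound_le (abs_nonneg K_E) h.slackConst_pos.le h.m_pos h.d_pos h.N_pos
    h.card_le h.T_pos h.one_le_logFactor hslack
  rw [← h.explore_eq] at hbound
  calc _ ≤ ∫⁻ ω in {ω | ExploreEvent M Q (2 * K_F)
            (spreadSlack m (n * Q.explore) (2 * K_F) (K_X ^ 2 + 1) (Q.γ / (8 * N)))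
            fun t i => ξ t i ω},
          ENNReal.ofReal (n * T * totalPredErr M Q T fun t i => ξ t i ω) ∂P :=
        lintegral_mono_set fun _ hω => hω.2
    _ = ENNReal.ofReal (n * T) * ∫⁻ ω in {ω | ExploreEvent M Q (2 * K_F)
            (spreadSlack m (n * Q.explore) (2 * K_F) (K_X ^ 2 + 1) (Q.γ / (8 * N)))
            fun t i => ξ t i ω},
          ENNReal.ofReal (totalPredErr M Q T fun t i => ξ t i ω) ∂P := by
        rw [← lintegral_const_mul' _ _ ENNReal.ofReal_ne_top]
        exact lintegral_congr fun ω => ENNReal.ofReal_mul (by positivity)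
    _ ≤ ENNReal.ofReal (n * T) * ENNReal.ofReal _ := by
        gcongr
        exact setLIntegral_exploreEvent_totalPredErr_le hξ h.measurableLearner h.isCausal
          h.measurable_action h.ae_dotProduct_self_le h.boundedEntries h.boundedLearner hκ
          (fun j => by exact_mod_cast le_card_exploreIndex Q.explore j) h.slack_nonneg
          (by positivity) (fun t ht => (h.last_mem t ht).1) hER
    _ ≤ _ := by
        rw [← ENNReal.ofReal_mul (by positivity)]
        exact ENNReal.ofReal_le_ofReal hbound

lemma integral_cond_goodEvent_le :
    ∫ ω, regret M Q (fun t i => ξ t i ω) T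
        ∂(P[|{ω | (fun t i => ξ t i ω) ∈ goodEvent M Q T K_X K_F K_σ}]) ≤
      regretConst K_X K_F K_C K_μ K_E K_σ * logFactor m d n N T Q.γ ^ 2 * rate m d n N T := by
  have : NeZero N := ⟨h.N_pos.ne'⟩
  have hG := h.measurableSet_preimage_goodEvent hξ
  have hcompl := h.measureReal_goodEvent_compl_le hξ
  rw [probReal_compl_eq_one_sub hG] at hcompl
  have hprob : 1 / 2 ≤ P.real {ω | (fun t i => ξ t i ω) ∈ goodEvent M Q T K_X K_F K_σ} := by
    linarith [h.γ_lt_one]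
  refine (integral_cond_le_two_mul (fun ω => regret_nonneg _ T) hprob
    (setIntegral_le_of_le_add_sqrt (h.integrable_regret hξ)
      (((measurable_totalPredErr h.measurableLearner h.isCausal h.measurable_action T).comp
        hξ.measurable_randomness).const_mul _)
      (fun ω => mul_nonneg (by positivity) (totalPredErr_nonneg T _)) hG h.banditPart_nonneg
      h.predictionPart_pos (h.setLIntegral_goodEvent_le hξ hER) (h.ae_regret_le hξ))).trans
    (h.two_mul_parts_le K_E)

lemma le_measureReal_regret_le :
    1 - Q.γ ≤ P.real {ω | regret M Q (fun t i => ξ t i ω) T ≤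
      regretConst K_X K_F K_C K_μ K_E K_σ * logFactor m d n N T Q.γ ^ 2 * rate m d n N T /
        √Q.γ} := by
  have : NeZero N := ⟨h.N_pos.ne'⟩
  have hle := h.two_mul_parts_le K_E
  have hbandit := h.banditPart_nonneg
  have hprediction := h.predictionPart_pos (K_E := K_E)
  refine (le_measureReal_le_div_sqrt
    (((measurable_totalPredErr h.measurableLearner h.isCausal h.measurable_action T).comp
      hξ.measurable_randomness).const_mul _) h.γ_pos h.γ_lt_one.le
    (h.measureReal_goodEvent_compl_le hξ) hbandit hprediction
    (h.setLIntegral_goodEvent_le hξ hER) (h.ae_regret_le hξ)).trans (measureReal_mono ?_)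
  refine Set.ofPred_subset_ofPred.2 fun ω hω => hω.trans ?_
  gcongr
  linarith

end Setting

end Assembly

end BanditDDO

end

theorem mainTheorem7 :
    ∃ κ : ℕ, ∀ (K_X K_F K_C K_μ K_E : ℝ) (K_σ : ℝ≥0), ∃ C : ℝ,
      ∀ (m d n N T : ℕ) (_ : 0 < m) (_ : 0 < d) (_ : 0 < T) (_ : N ≤ n)
        (δ : ℝ) (_ : 0 < δ) (_ : δ < 1)
        -- the environment
        (M : BanditDDO.Model m d n N)
        (_ : Function.Injective M.W)
        (_ : ∀ j, M.W j ⬝ᵥ M.W j ≤ 1)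
        (_ : Submodule.span ℝ (Set.range M.W) = ⊤)
        (_ : IsProbabilityMeasure M.Dx)
        (_ : ∀ᵐ x ∂M.Dx, x ⬝ᵥ x ≤ K_X ^ 2 ∧ ∀ j, ∑ k, |(M.F j *ᵥ x) k| ≤ K_C)
        (_ : ∀ j, BanditDDO.BoundedEntries K_F (M.F j))
        (_ : ∀ j, |M.μ ⬝ᵥ M.W j| ≤ K_μ)
        (_ : M.σ ≤ K_σ)
        -- the procedure
        (Q : BanditDDO.Procedure m d N)
        (_ : BanditDDO.IsBarycentricSpanner Q.b (Set.range M.W))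
        (_ : ∀ D, BanditDDO.BoundedEntries K_F (Q.L D))
        (_ : ∀ k p q, Measurable fun v : Fin k → BanditDDO.Point m d => Q.L (List.ofFn v) p q)
        (_ : Measurable Q.sel)
        (_ : ∀ (v : Fin N → ℝ) (j : Fin N), v (Q.sel v) ≤ v j)
        (_ : Q.explore = BanditDDO.exploreLength m d N T)
        (_ : ∀ t, Q.explore < t → Q.explore ≤ Q.last t ∧ Q.last t < t)
        (_ : Q.γ = δ)
        -- the randomness
        (Ω : Type*) [MeasurableSpace Ω] (P : Measure Ω) [IsProbabilityMeasure P]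
        (ξ : ℕ → Fin n → Ω → BanditDDO.Point m d × ℝ)
        (_ : ∀ t i, Measurable (ξ t i))
        (_ : ∀ t i, P.map (ξ t i) = BanditDDO.sampleLaw M)
        (_ : iIndepFun (fun (p : ℕ × Fin n) => ξ p.1 p.2) P)
        -- the assumption on the learner
        (_ : ((∀ t, Q.explore < t → Q.last t = Q.explore) ∧
              ∀ j, BanditDDO.ConstantER Q.L M.Dx M.σ (M.F j) (K_E * ((m : ℝ) * d) ^ 2)) ∨
            BanditDDO.ConstantERAlongRun M Q P ξ T (K_E * ((m : ℝ) * d) ^ 2)),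
        Integrable (fun ω => BanditDDO.regret M Q (fun t i => ξ t i ω) T) P ∧
        (∃ G : Set Ω, MeasurableSet G ∧ 1 - δ ≤ P.real G ∧
          ∫ ω, BanditDDO.regret M Q (fun t i => ξ t i ω) T ∂(P[|G]) ≤
            C * BanditDDO.logFactor m d n N T δ ^ κ * BanditDDO.rate m d n N T) ∧
        1 - δ ≤ P.real {ω | BanditDDO.regret M Q (fun t i => ξ t i ω) T ≤
          C * BanditDDO.logFactor m d n N T δ ^ κ * BanditDDO.rate m d n N T / Real.sqrt δ} := by
  refine ⟨2, fun K_X K_F K_C K_μ K_E K_σ => ⟨BanditDDO.regretConst K_X K_F K_C K_μ K_E K_σ, ?_⟩⟩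
  intro m d n N T hm hd hT hNn δ hδ hδ1 M _ hW hspan _ hx hF hμ hσ Q hb hLF hL hselm hsel
    hexplore hlast hγ Ω _ P _ ξ hmeas hlaw hind hER
  subst hγ
  have hS : BanditDDO.Setting M Q T K_X K_F K_C K_μ K_σ :=
    ⟨hm, hd, hT, hNn, hW, hspan, hx, hF, hμ, hσ, hb, hLF, hL, hselm, hsel, hexplore, hlast, hδ,
      hδ1⟩
  have hξ : BanditDDO.IsSample M P ξ := ⟨hmeas, hlaw, hind⟩
  have hER' := hS.constantERAlongRun hξ hER
  exact ⟨hS.integrable_regret hξ,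
    ⟨_, hS.measurableSet_preimage_goodEvent hξ, hS.le_measureReal_goodEvent hξ,
      hS.integral_cond_goodEvent_le hξ hER'⟩,
    hS.le_measureReal_regret_le hξ hER'⟩
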